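/- Let $n\ge 1$. For a (possibly disconnected) complex reductive group $\Gamma$ let $$\mathcal Y(\Gamma)_{\mathrm{ell}}=\{(s,h)\in\Gamma\times\Gamma\mid s,h\text{ semisimple},\ sh=hs,\ Z_\Gamma(s)\cap Z_\Gamma(h)\text{ finite}\}$$ be the set of elliptic pairs, on which $\Gamma$ acts by simultaneous conjugation; the flip $(s,h)\mapsto(h,s)$ induces an involution of the set of orbits. For a unipotent $u\in\mathrm{PGL}_n(\mathbb C)$ let $\Gamma_u$ be a reductive part of its centralizer $Z(u)$, i.e. a Zariski-closed subgroup of $Z(u)$ with $Z(u)=\Gamma_u\ltimes R_u(Z(u))$, where $R_u(Z(u))$ is the unipotent radical; such a $\Gamma_u$ exists. Let $\lambda$ be the partition of $n$ formed by the sizes of the Jordan blocks of $u$. Write $\Delta_m(z)$ for the class of $\mathrm{diag}(1,z,\dots,z^{m-1})$ in $\mathrm{PGL}_m(\mathbb C)$, put $s_m=\Delta_m(\zeta_m)$ for a primitive $m$-th root of unity $\zeta_m$, and let $\dot w_m\in\mathrm{PGL}_m(\mathbb C)$ be the class of the permutation matrix of the $m$-cycle $(1,2,\dots,m)$. (1)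 One has $$\mathcal Y(\mathrm{PGL}_n(\mathbb C))_{\mathrm{ell}}=\bigsqcup_{k\in(\mathbb Z/n\mathbb Z)^\times}\mathrm{PGL}_n(\mathbb C)\cdot(s_n,\dot w_n^k).$$ In particular there are $\varphi(n)$ orbits of elliptic pairs, and the flip sends the orbit of $(s_n,\dot w_n^k)$ to the orbit of $(s_n,\dot w_n^{-k})$. (2) Let $u\in\mathrm{PGL}_n(\mathbb C)$ be unipotent with partition $\lambda$. Then $\mathcal Y(\Gamma_u)_{\mathrm{ell}}\ne\emptyset$ if and only if $\lambda$ is rectangular, i.e. $\lambda=(i,\dots,i)$ with $r$ equal parts for some $i,r$. In this case, in a suitable basis of $\mathbb C^n$, $\Gamma_u$ is the image in $\mathrm{PGL}_n(\mathbb C)$ of $\mathrm{GL}_r(\mathbb C)$ embedded diagonally in $\mathrm{GL}_r(\mathbb C)^i\subset\mathrm{GL}_n(\mathbb C)$. The embedding induces an isomorphism $\mathrm{PGL}_r(\mathbb C)\cong\Gamma_u$, through which $\mathcal Y(\Gamma_u)_{\mathrm{ell}}$, its orbits and the flip are described as in (1) with $r$ in place of $n$. (3) There are finitely many unipotent conjugacy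 classes in $\mathrm{PGL}_n(\mathbb C)$, the set of orbits $\Gamma_u\backslash\mathcal Y(\Gamma_u)_{\mathrm{ell}}$ is finite for each unipotent $u$, and $$\sum_{u}\bigl|\Gamma_u\backslash\mathcal Y(\Gamma_u)_{\mathrm{ell}}\bigr|=n,$$ where $u$ runs over representatives of the unipotent conjugacy classes. -/

import Mathlib

open scoped MatrixGroups

noncomputable section

namespace EllipticPGL

/-! ### Elements and closed subsets of `PGL_n(ℂ)` -/

/-- An element of `PGL_n(ℂ)` is unipotent if it is the image of a unipotent matrix. -/
def IsUnipotentElt {n : ℕ} (x : PGL(n, ℂ)) : Prop :=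
  ∃ g : GL (Fin n) ℂ, Matrix.ProjGenLinGroup.mk g = x ∧
    IsNilpotent ((g : Matrix (Fin n) (Fin n) ℂ) - 1)

/-- An element of `PGL_n(ℂ)` is semisimple if it is the image of a semisimple
(that is, diagonalizable) matrix. -/
def IsSemisimpleElt {n : ℕ} (x : PGL(n, ℂ)) : Prop :=
  ∃ g : GL (Fin n) ℂ, Matrix.ProjGenLinGroup.mk g = x ∧
    Module.End.IsSemisimple (Matrix.toLin' (g : Matrix (Fin n) (Fin n) ℂ))

/-- Zariski-closed subsets of `PGL_n(ℂ)`: the preimage in `GL_n(ℂ)` is the zero locus of a set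
of polynomials in the matrix entries. -/
def IsZariskiClosed {n : ℕ} (S : Set PGL(n, ℂ)) : Prop :=
  ∃ I : Set (MvPolynomial (Fin n × Fin n) ℂ), ∀ g : GL (Fin n) ℂ,
    Matrix.ProjGenLinGroup.mk g ∈ S ↔
      ∀ p ∈ I, MvPolynomial.eval
        (fun ij : Fin n × Fin n => (g : Matrix (Fin n) (Fin n) ℂ) ij.1 ij.2) p = 0

/-! ### The reductive part of the centralizer of a unipotent element -/

/-- `R` is the unipotent radical of `Z`: the largest closed normal unipotent subgroup of `Z`
(in characteristic zero closed unipotent subgroups are automatically connected). -/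
def IsUnipotentRadical {n : ℕ} (Z R : Subgroup PGL(n, ℂ)) : Prop :=
  IsGreatest {U : Subgroup PGL(n, ℂ) | U ≤ Z ∧ (U.subgroupOf Z).Normal ∧
    IsZariskiClosed (U : Set PGL(n, ℂ)) ∧ ∀ x ∈ U, IsUnipotentElt x} R

/-- `Γ` is a reductive part `Γ_u` of the centralizer `Z(u)` of `u` in `PGL_n(ℂ)`: a closed
subgroup of `Z(u)` which is a complement to the unipotent radical, so that
`Z(u) = Γ ⋉ R_u(Z(u))`. It is determined by `u` only up to conjugation in `Z(u)`. -/
def IsReductivePart {n : ℕ} (u : PGL(n, ℂ)) (Γ : Subgroup PGL(n, ℂ)) : Prop :=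
  IsZariskiClosed (Γ : Set PGL(n, ℂ)) ∧
    ∃ R : Subgroup PGL(n, ℂ), IsUnipotentRadical (Subgroup.centralizer {u}) R ∧
      Γ ⊓ R = ⊥ ∧ Γ ⊔ R = Subgroup.centralizer {u}

/-! ### The partition of a unipotent element -/

/-- The unipotent upper triangular Jordan block of size `m`. -/
def jordanBlock (m : ℕ) : Matrix (Fin m) (Fin m) ℂ :=
  Matrix.of fun i j => if i = j ∨ (i : ℕ) + 1 = j then 1 else 0

/-- `u ∈ PGL_n(ℂ)` is represented by a matrix whose Jordan canonical form has only the
eigenvalue `1` and whose Jordan blocks have the parts of `p` as sizes. -/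
def HasJordanType {n : ℕ} (u : PGL(n, ℂ)) (p : n.Partition) : Prop :=
  ∃ (m : ℕ) (a : Fin m → ℕ) (e : (Σ j : Fin m, Fin (a j)) ≃ Fin n) (P g : GL (Fin n) ℂ),
    Multiset.map a Finset.univ.val = p.parts ∧
    (g : Matrix (Fin n) (Fin n) ℂ) =
      (P : Matrix (Fin n) (Fin n) ℂ) *
        Matrix.reindex e e (Matrix.blockDiagonal' fun j => jordanBlock (a j)) *
        ((P⁻¹ : GL (Fin n) ℂ) : Matrix (Fin n) (Fin n) ℂ) ∧
    u = Matrix.ProjGenLinGroup.mk g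

/-- The diagonal embedding `A ↦ diag(A, …, A)` (`i` copies) of `GL_r(ℂ)` into `GL_n(ℂ)`, where
`n = r i`, with respect to a labelling `e` of the basis vectors. -/
def diagEmb {n r i : ℕ} (e : Fin r × Fin i ≃ Fin n) : GL (Fin r) ℂ →* GL (Fin n) ℂ :=
  Units.map ((Matrix.reindexRingEquiv ℂ e).toRingHom.comp
    ((Matrix.blockDiagonalRingHom (Fin r) (Fin i) ℂ).comp
      (Pi.constRingHom (Fin i) (Matrix (Fin r) (Fin r) ℂ)))).toMonoidHom

/-! ### Elliptic pairs -/

/-- The set of elliptic pairs of a group `H`, where `ss` is the predicate of being semisimple. -/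
def ellipticPairs {H : Type*} [Group H] (ss : H → Prop) : Set (H × H) :=
  {x | ss x.1 ∧ ss x.2 ∧ x.1 * x.2 = x.2 * x.1 ∧
    (Subgroup.centralizer {x.1, x.2} : Set H).Finite}

/-- `Y(PGL_n(ℂ))_ell`. -/
def ellPGL (n : ℕ) : Set (PGL(n, ℂ) × PGL(n, ℂ)) :=
  ellipticPairs IsSemisimpleElt

/-- `Y(Γ)_ell` for a subgroup `Γ` of `PGL_n(ℂ)`. -/
def ellSub {n : ℕ} (Γ : Subgroup PGL(n, ℂ)) : Set (Γ × Γ) :=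
  ellipticPairs fun x : Γ => IsSemisimpleElt (x : PGL(n, ℂ))

/-- The orbit of a pair under simultaneous conjugation. -/
def pairOrbit {H : Type*} [Group H] (x : H × H) : Set (H × H) :=
  MulAction.orbit (ConjAct H) x

/-- The set of orbits, under simultaneous conjugation, of the elements of `Y`. -/
def pairOrbits {H : Type*} [Group H] (Y : Set (H × H)) : Set (Set (H × H)) :=
  pairOrbit '' Y

/-- `Δ_n(z)`, the class of `diag(1, z, …, z^{n-1})`. -/
def Delta (n : ℕ) (z : ℂˣ) : PGL(n, ℂ) :=
  Matrix.ProjGenLinGroup.mk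
    (Units.map (Matrix.diagonalRingHom (Fin n) ℂ).toMonoidHom
      (MulEquiv.piUnits.symm fun j : Fin n => z ^ (j : ℕ)))

/-- The class of the permutation matrix of the `n`-cycle `j ↦ j + 1`, which maps the basis
vector `e_j` to `e_{j+1}` (in Mathlib, `σ.permMatrix` maps `e_j` to `e_{σ⁻¹ j}`). -/
def wdot (n : ℕ) : PGL(n, ℂ) :=
  Matrix.ProjGenLinGroup.mk
    (Matrix.GeneralLinearGroup.mkOfDetNeZero (((finRotate n)⁻¹).permMatrix ℂ) (by
      rw [Matrix.det_permutation]
      exact_mod_cast (Equiv.Perm.sign (finRotate n)⁻¹).ne_zero))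

/-- The set `Y` of pairs is the disjoint union of the orbits of `(s, w ^ k)`,
`k ∈ (ℤ/mℤ)ˣ`; there are `φ(m)` orbits; and the flip `(x, y) ↦ (y, x)` maps the orbit of
`(s, w ^ k)` to the orbit of `(s, w ^ (-k))`. -/
structure IsStandardUnion {H : Type*} [Group H] (Y : Set (H × H)) (m : ℕ) (s w : H) :
    Prop where
  eq_iUnion : Y = ⋃ k : (ZMod m)ˣ, pairOrbit (s, w ^ (k : ZMod m).val)
  disjoint : Pairwise fun k l : (ZMod m)ˣ =>
    Disjoint (pairOrbit (s, w ^ (k : ZMod m).val)) (pairOrbit (s, w ^ (l : ZMod m).val))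
  card_orbits : (pairOrbits Y).Finite ∧ (pairOrbits Y).ncard = Nat.totient m
  flip : ∀ k : (ZMod m)ˣ, Prod.swap '' pairOrbit (s, w ^ (k : ZMod m).val) =
    pairOrbit (s, w ^ ((-k : (ZMod m)ˣ) : ZMod m).val)

/-- The unipotent conjugacy classes of `PGL_n(ℂ)`. -/
def UnipotentClass (n : ℕ) : Type :=
  {c : ConjClasses PGL(n, ℂ) // ∃ u, IsUnipotentElt u ∧ ConjClasses.mk u = c}

end EllipticPGL

end

namespace EllipticPGL
open Matrix Matrix.ProjGenLinGroup

/-! ### Representatives of elements of `PGL_n(ℂ)` -/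

/-! Elements `x`, `y` of `PGL_n` commute exactly when lifts satisfy `X Y = ω Y X` for a scalar `ω`.
Determinants give `ω ^ n = 1`, and `ω` does not depend on the lifts. The classification rests on two
facts: a commuting semisimple pair is elliptic if and only if `ω` is a primitive `n`-th root of
unity, and then `ω` is a complete conjugation invariant.

If `ω` is primitive and `X v = μ v`, the vectors `Y ^ j v` with `j < n` are eigenvectors of `X` for
distinct eigenvalues. In this basis, after rescaling, the pair is the standard one
(`exists_conj_standard`), and its centralizer is finite because an element of it is determined by
two `n`-th roots of unity. Conversely, a finite centralizer forces all matrices commuting with `X`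
and `Y` to be scalar; averaging a rank-one matrix over conjugation by `X ^ a Y ^ b` then shows that
the order of `ω` is at least `n` (`isPrimitiveRoot_of_finite_centralizer`). Primitive roots give
`φ(n)` orbits, and the flip inverts `ω`.

For unipotent `u`, the matrices commuting with a Jordan form are a split extension of a product of
matrix algebras, one for each block size, by a nil ideal (`LeviDatum`). The units with scalar
reduction give the unipotent radical, and the splitting gives one reductive part. If two block sizes
occur, a torus `ℂˣ` survives in the center of any reductive part and rules out elliptic pairs
(`ellSub_eq_empty`).

If all blocks have one size, an arbitrary closed complement must be shown conjugate to the standard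
`PGL_r` (`exists_conj_of_closed_complement`). The complement is a section of `GL_r`. Averaging over
the finite group of signed permutation matrices makes it standard there; then it is standard on
torsion diagonal matrices, by closedness on the whole torus, and finally on transvections, where the
torus action and the Weyl elements leave no choice.

The classes that contribute are the rectangular ones, one for each divisor `r` of `n`, so the count
is the sum of `φ(r)` over `r ∣ n`, which is `n`. -/

theorem mk_eq_mk_iff_smul {n : ℕ} {g h : GL (Fin n) ℂ} :
    mk g = mk h ↔ ∃ c : ℂˣ, (h : Matrix (Fin n) (Fin n) ℂ) = (c : ℂ) • (g : Matrix _ _ ℂ) := by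
  rw [mk_eq_mk_iff]
  refine exists_congr fun c => ?_
  rw [Units.ext_iff, Units.val_mul, GeneralLinearGroup.coe_scalar, eq_comm]
  simp [← Matrix.smul_eq_mul_diagonal]

theorem mk_eq_one_iff_smul {n : ℕ} {g : GL (Fin n) ℂ} :
    mk g = 1 ↔ ∃ c : ℂˣ, (g : Matrix (Fin n) (Fin n) ℂ) = (c : ℂ) • (1 : Matrix _ _ ℂ) := by
  rw [eq_comm, ← map_one mk, mk_eq_mk_iff_smul, Units.val_one]

theorem commute_mk_iff {n : ℕ} {X Y : GL (Fin n) ℂ} :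
    mk X * mk Y = mk Y * mk X ↔
      ∃ c : ℂˣ, X.1 * Y.1 = (c : ℂ) • (Y.1 * X.1) := by
  rw [eq_comm, ← map_mul, ← map_mul, mk_eq_mk_iff_smul]
  simp

theorem exists_lift_smul {n : ℕ} (g : GL (Fin n) ℂ) (c : ℂˣ) :
    ∃ h : GL (Fin n) ℂ, (h : Matrix (Fin n) (Fin n) ℂ) = (c : ℂ) • (g : Matrix _ _ ℂ) ∧
      mk h = mk g :=
  ⟨g * .scalar _ c, by simp [GeneralLinearGroup.coe_scalar, ← Matrix.smul_eq_mul_diagonal],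
    by simp⟩

/-- An element of finite order of `PGL_n(ℂ)` is semisimple. -/
theorem isSemisimpleElt_of_pow_eq_one {n k : ℕ} (hk : k ≠ 0) {x : PGL(n, ℂ)} (hx : x ^ k = 1) :
    IsSemisimpleElt x := by
  obtain ⟨g, rfl⟩ := mk_surjective x
  rw [← map_pow, mk_eq_one_iff_smul] at hx
  obtain ⟨c, hc⟩ := hx
  refine ⟨g, rfl, Module.End.isSemisimple_of_squarefree_aeval_eq_zero
    (p := Polynomial.X ^ k - Polynomial.C (c : ℂ)) ?_ ?_⟩
  · exact (Polynomial.separable_X_pow_sub_C (c : ℂ) (by exact_mod_cast hk) c.ne_zero).squarefree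
  · have : Matrix.toLin' ((g : Matrix (Fin n) (Fin n) ℂ) ^ k) = (c : ℂ) • 1 := by
      rw [← Units.val_pow_eq_pow_val, hc]
      simp [Module.End.one_eq_id]
    rw [Matrix.toLin'_pow] at this
    simp [this, Algebra.algebraMap_eq_smul_one]

/-! ### Pairs of matrices which commute up to a root of unity -/

section WeylPairs

variable {n : ℕ}

theorem pow_mul_of_mul_eq_smul {X Y : Matrix (Fin n) (Fin n) ℂ} {ω : ℂ}
    (h : X * Y = ω • (Y * X)) (k : ℕ) : X * Y ^ k = ω ^ k • (Y ^ k * X) := by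
  induction k with
  | zero => simp
  | succ k ih =>
    rw [pow_succ, ← mul_assoc, ih, smul_mul_assoc, mul_assoc, h, mul_smul_comm, smul_smul,
      ← mul_assoc, pow_succ]

theorem mul_pow_of_mul_eq_smul {X Y : Matrix (Fin n) (Fin n) ℂ} {ω : ℂ}
    (h : X * Y = ω • (Y * X)) (k : ℕ) : X ^ k * Y = ω ^ k • (Y * X ^ k) := by
  induction k with
  | zero => simp
  | succ k ih =>
    rw [pow_succ, mul_assoc, h, mul_smul_comm, ← mul_assoc, ih, smul_mul_assoc, smul_smul,
      mul_assoc, ← pow_succ, ← pow_succ']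

/-- `Y` permutes the eigenspaces of `X`, multiplying the eigenvalue by `ω` each time. -/
theorem pow_mulVec_of_mul_eq_smul {X Y : Matrix (Fin n) (Fin n) ℂ} {ω μ : ℂ}
    (h : X * Y = ω • (Y * X)) {v : Fin n → ℂ} (hv : X *ᵥ v = μ • v) (k : ℕ) :
    X *ᵥ (Y ^ k *ᵥ v) = (ω ^ k * μ) • (Y ^ k *ᵥ v) := by
  rw [mulVec_mulVec, pow_mul_of_mul_eq_smul h, smul_mulVec, ← mulVec_mulVec, hv, mulVec_smul,
    smul_smul]

theorem exists_mulVec_eq_smul [NeZero n] (X : GL (Fin n) ℂ) :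
    ∃ (μ : ℂˣ) (v : Fin n → ℂ), v ≠ 0 ∧ (X : Matrix (Fin n) (Fin n) ℂ) *ᵥ v = (μ : ℂ) • v := by
  obtain ⟨μ, hμ⟩ := Module.End.exists_eigenvalue (Matrix.toLin' (X : Matrix (Fin n) (Fin n) ℂ))
  obtain ⟨v, hv⟩ := hμ.exists_hasEigenvector
  have h1 : (X : Matrix (Fin n) (Fin n) ℂ) *ᵥ v = μ • v := by simpa using hv.apply_eq_smul
  have hμ0 : μ ≠ 0 := by
    rintro rfl
    apply hv.2
    have := congrArg (fun w => ((X⁻¹ : GL (Fin n) ℂ) : Matrix (Fin n) (Fin n) ℂ) *ᵥ w) h1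
    simpa [mulVec_mulVec, ← Units.val_mul] using this
  exact ⟨Units.mk0 μ hμ0, v, hv.2, h1⟩

theorem pow_mulVec_ne_zero (Y : GL (Fin n) ℂ) {v : Fin n → ℂ} (hv : v ≠ 0) (k : ℕ) :
    (Y : Matrix (Fin n) (Fin n) ℂ) ^ k *ᵥ v ≠ 0 := by
  intro h
  apply hv
  have := congrArg (fun w => (((Y ^ k)⁻¹ : GL (Fin n) ℂ) : Matrix (Fin n) (Fin n) ℂ) *ᵥ w) h
  rw [← Units.val_pow_eq_pow_val] at this
  simpa only [mulVec_mulVec, ← Units.val_mul, inv_mul_cancel, Units.val_one, one_mulVec,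
    mulVec_zero] using this

/-- Eigenvectors for the eigenvalues `ω ^ j * μ`, which are distinct for `j < n` because `ω` is
primitive. -/
theorem linearIndependent_pow_mulVec {X : Matrix (Fin n) (Fin n) ℂ} {Y : GL (Fin n) ℂ} {ω : ℂ}
    (hω : IsPrimitiveRoot ω n) (h : X * Y.1 = ω • (Y.1 * X)) {μ : ℂˣ}
    {v : Fin n → ℂ} (hv0 : v ≠ 0) (hv : X *ᵥ v = (μ : ℂ) • v) :
    LinearIndependent ℂ fun j : Fin n => (Y : Matrix (Fin n) (Fin n) ℂ) ^ (j : ℕ) *ᵥ v := by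
  refine Module.End.eigenvectors_linearIndependent' (Matrix.toLin' X)
    (fun j : Fin n => ω ^ (j : ℕ) * μ) ?_ _ fun j => ⟨?_, pow_mulVec_ne_zero Y hv0 j⟩
  · intro i j hij
    exact Fin.ext (hω.pow_inj i.2 j.2 (mul_right_cancel₀ μ.ne_zero hij))
  · rw [Module.End.mem_eigenspace_iff, toLin'_apply, pow_mulVec_of_mul_eq_smul h hv]

/-- A Schur lemma. The `μ`-eigenspace of `X` is the line through `v`, so `Z` acts on `v` by a
scalar; commuting with `Y` propagates this scalar to the spanning vectors `Y ^ j v`. -/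
theorem eq_smul_one_of_commute [NeZero n] {X Y : GL (Fin n) ℂ} {ω : ℂ}
    (hω : IsPrimitiveRoot ω n) (h : X.1 * Y.1 = ω • (Y.1 * X.1))
    {Z : Matrix (Fin n) (Fin n) ℂ} (hX : Commute Z X.1) (hY : Commute Z Y.1) :
    ∃ c : ℂ, Z = c • 1 := by
  obtain ⟨μ, v, hv0, hv⟩ := exists_mulVec_eq_smul X
  have hli := linearIndependent_pow_mulVec hω h hv0 hv
  have hspan := hli.span_eq_top_of_card_eq_finrank' (by simp)
  obtain ⟨c, hc⟩ := (Submodule.mem_span_range_iff_exists_fun ℂ).1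
    (hspan ▸ Submodule.mem_top : Z *ᵥ v ∈ _)
  have h1 : ∑ j : Fin n, (c j * (ω ^ (j : ℕ) * μ - μ)) •
      ((Y : Matrix (Fin n) (Fin n) ℂ) ^ (j : ℕ) *ᵥ v) = 0 := by
    have e1 : (X : Matrix (Fin n) (Fin n) ℂ) *ᵥ (Z *ᵥ v) = (μ : ℂ) • (Z *ᵥ v) := by
      rw [mulVec_mulVec, ← hX.eq, ← mulVec_mulVec, hv, mulVec_smul]
    rw [← hc, mulVec_sum, Finset.smul_sum, ← sub_eq_zero, ← Finset.sum_sub_distrib] at e1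
    rw [← e1]
    refine Finset.sum_congr rfl fun j _ => ?_
    rw [mulVec_smul, pow_mulVec_of_mul_eq_smul h hv, smul_smul, smul_smul, ← sub_smul]
    ring_nf
  have h2 := Fintype.linearIndependent_iff.1 hli _ h1
  have h3 : ∀ j : Fin n, j ≠ 0 → c j = 0 := by
    intro j hj
    rcases mul_eq_zero.1 (h2 j) with h | h
    · exact h
    · exfalso
      have : ω ^ (j : ℕ) = 1 := mul_right_cancel₀ μ.ne_zero (by rw [one_mul]; exact sub_eq_zero.1 h)
      exact hj (Fin.ext (Nat.eq_zero_of_dvd_of_lt (hω.dvd_of_pow_eq_one _ this) j.2))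
  have hZv : Z *ᵥ v = c 0 • v := by
    rw [← hc, Finset.sum_eq_single 0 (fun j _ hj => by rw [h3 j hj, zero_smul]) (by simp)]
    simp
  refine ⟨c 0, Matrix.toLin'.injective ?_⟩
  refine LinearMap.ext_on_range hspan fun j => ?_
  simp only [toLin'_apply, mulVec_mulVec]
  rw [(hY.pow_right j).eq, ← mulVec_mulVec, hZv, mulVec_smul, smul_mul_assoc, one_mul, smul_mulVec]

/-- If `X Y = ω Y X` with `ω` a primitive `n`-th root of unity, then `Y ^ n` is scalar. -/
theorem mk_pow_eq_one_right [NeZero n] {X Y : GL (Fin n) ℂ} {ω : ℂ} (hω : IsPrimitiveRoot ω n)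
    (h : X.1 * Y.1 = ω • (Y.1 * X.1)) :
    mk Y ^ n = 1 := by
  have hX : Commute ((Y : Matrix (Fin n) (Fin n) ℂ) ^ n) X.1 := by
    have := pow_mul_of_mul_eq_smul h n
    rw [hω.pow_eq_one, one_smul] at this
    exact this.symm
  obtain ⟨c, hc⟩ := eq_smul_one_of_commute hω h hX ((Commute.refl _).pow_left n)
  have hc0 : c ≠ 0 := by
    rintro rfl
    have := (Y ^ n).isUnit
    rw [Units.val_pow_eq_pow_val, hc, zero_smul] at this
    exact not_isUnit_zero this
  rw [← map_pow, mk_eq_one_iff_smul]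
  exact ⟨Units.mk0 c hc0, by simpa using hc⟩

theorem mul_eq_inv_smul {X Y : Matrix (Fin n) (Fin n) ℂ} {ω : ℂ} (hω : ω ≠ 0)
    (h : X * Y = ω • (Y * X)) : Y * X = ω⁻¹ • (X * Y) := by
  rw [h, smul_smul, inv_mul_cancel₀ hω, one_smul]

theorem mk_pow_eq_one_left [NeZero n] {X Y : GL (Fin n) ℂ} {ω : ℂ} (hω : IsPrimitiveRoot ω n)
    (h : X.1 * Y.1 = ω • (Y.1 * X.1)) :
    mk X ^ n = 1 :=
  mk_pow_eq_one_right hω.inv (mul_eq_inv_smul (hω.ne_zero (NeZero.ne n)) h)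

theorem coe_delta_rep (z : ℂˣ) :
    ((Units.map (Matrix.diagonalRingHom (Fin n) ℂ).toMonoidHom
      (MulEquiv.piUnits.symm fun j : Fin n => z ^ (j : ℕ)) : GL (Fin n) ℂ) :
        Matrix (Fin n) (Fin n) ℂ) = diagonal fun j : Fin n => (z : ℂ) ^ (j : ℕ) := by
  ext i j
  simp [Matrix.diagonal_apply]

theorem mul_permMatrix_finRotate_col (Q : Matrix (Fin n) (Fin n) ℂ) (j : Fin n) :
    (Q * (((finRotate n)⁻¹).permMatrix ℂ)).col j = Q.col (finRotate n j) := by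
  ext i
  rw [Equiv.Perm.permMatrix, PEquiv.mul_toMatrix_toPEquiv]
  rfl

theorem val_finRotate [NeZero n] (j : Fin n) : (finRotate n j : ℕ) = (j + 1) % n := by
  rw [finRotate_apply, Fin.val_add, Fin.val_one']
  simp

/-- A pair with `X Y = ω Y X`, where `ω` is a primitive `n`-th root of unity, is conjugate to the
pair of the diagonal matrix of the powers of `ω` and the cyclic permutation matrix. -/
theorem exists_conj_standard [NeZero n] {X Y : GL (Fin n) ℂ} {ω : ℂˣ} (hω : IsPrimitiveRoot ω n)
    (h : X.1 * Y.1 = (ω : ℂ) • (Y.1 * X.1)) :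
    ∃ q : PGL(n, ℂ), q * Delta n ω * q⁻¹ = mk X ∧ q * wdot n * q⁻¹ = mk Y := by
  have hω' : IsPrimitiveRoot (ω : ℂ) n := IsPrimitiveRoot.coe_units_iff.2 hω
  obtain ⟨μ, v, hv0, hv⟩ := exists_mulVec_eq_smul X
  obtain ⟨c, hc⟩ := mk_eq_one_iff_smul.1 ((map_pow mk Y n).trans (mk_pow_eq_one_right hω' h))
  -- Rescaling `Y` by an `n`-th root of `c⁻¹` makes its `n`-th power exactly `1`, so that the chain
  -- `Y' ^ j v` closes up at `j = n` as the cyclic permutation requires.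
  obtain ⟨γ, hγ⟩ := IsAlgClosed.exists_pow_nat_eq (c⁻¹ : ℂ) (NeZero.pos n)
  have hγ0 : γ ≠ 0 := by
    rintro rfl
    rw [zero_pow (NeZero.ne n)] at hγ
    exact inv_ne_zero c.ne_zero hγ.symm
  obtain ⟨Y', hY', hmk⟩ := exists_lift_smul Y (Units.mk0 γ hγ0)
  rw [Units.val_mk0] at hY'
  have hY'n : (Y' : Matrix (Fin n) (Fin n) ℂ) ^ n = 1 := by
    rw [Units.val_pow_eq_pow_val] at hc
    rw [hY', smul_pow, hc, hγ, smul_smul, inv_mul_cancel₀ c.ne_zero, one_smul]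
  have h' : X.1 * Y'.1 = (ω : ℂ) • (Y'.1 * X.1) := by
    rw [hY', mul_smul_comm, h, smul_mul_assoc, smul_comm]
  have hli := linearIndependent_pow_mulVec hω' h' hv0 hv
  set Q : Matrix (Fin n) (Fin n) ℂ :=
    (Matrix.of fun j : Fin n => (Y' : Matrix (Fin n) (Fin n) ℂ) ^ (j : ℕ) *ᵥ v)ᵀ with hQ
  have hcol : ∀ j, Q.col j = (Y' : Matrix (Fin n) (Fin n) ℂ) ^ (j : ℕ) *ᵥ v := fun j => rfl
  have hmulcol : ∀ (A : Matrix (Fin n) (Fin n) ℂ) j, (A * Q).col j = A *ᵥ Q.col j :=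
    fun A j => rfl
  obtain ⟨q, hq⟩ : IsUnit Q := Matrix.linearIndependent_cols_iff_isUnit.1 hli
  have e1 : (X : Matrix (Fin n) (Fin n) ℂ) * Q =
      (μ : ℂ) • (Q * diagonal fun j : Fin n => (ω : ℂ) ^ (j : ℕ)) := by
    refine Matrix.ext_col fun j => ?_
    rw [hmulcol, hcol, pow_mulVec_of_mul_eq_smul h' hv]
    ext i
    simp only [Matrix.col_apply, Matrix.smul_apply, Matrix.mul_diagonal, Pi.smul_apply, smul_eq_mul]
    change _ * Q i j = _
    ring
  have e2 : (Y' : Matrix (Fin n) (Fin n) ℂ) * Q = Q * ((finRotate n)⁻¹).permMatrix ℂ := by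
    refine Matrix.ext_col fun j => ?_
    rw [hmulcol, mul_permMatrix_finRotate_col, hcol, hcol, mulVec_mulVec, ← pow_succ',
      val_finRotate, ← pow_eq_pow_mod _ hY'n]
  refine ⟨mk q, ?_, ?_⟩
  · rw [mul_inv_eq_iff_eq_mul, Delta, ← map_mul, ← map_mul, mk_eq_mk_iff_smul]
    exact ⟨μ, by rw [Units.val_mul, Units.val_mul, hq, e1, coe_delta_rep]⟩
  · rw [mul_inv_eq_iff_eq_mul, wdot, ← hmk, ← map_mul, ← map_mul]
    congr 1
    refine Units.ext ?_
    rw [Units.val_mul, Units.val_mul, hq, e2]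
    rfl

end WeylPairs
end EllipticPGL

namespace EllipticPGL
open Matrix Matrix.ProjGenLinGroup

/-! ### Finiteness of the centralizer and primitivity of the commutator -/

section EllipticPairs

variable {n : ℕ}

/-- Compare determinants: a scalar `c` contributes `c ^ n`. -/
theorem pow_eq_one_of_mul_eq_smul {X Y : GL (Fin n) ℂ} {c : ℂ} (h : X.1 * Y.1 = c • (Y.1 * X.1)) :
    c ^ n = 1 := by
  have h1 := congrArg Matrix.det h
  rw [det_smul, det_mul, det_mul, Fintype.card_fin, mul_comm Y.1.det] at h1
  have h2 : X.1.det * Y.1.det ≠ 0 := mul_ne_zero (X.1.isUnit_iff_isUnit_det.1 X.isUnit).ne_zero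
    (Y.1.isUnit_iff_isUnit_det.1 Y.isUnit).ne_zero
  exact mul_right_cancel₀ h2 (by rw [← h1, one_mul])

theorem mem_centralizer_pair {H : Type*} [Group H] {x y z : H} :
    z ∈ Subgroup.centralizer {x, y} ↔ x * z = z * x ∧ y * z = z * y := by
  simp [Subgroup.mem_centralizer_iff]

/-- If the centralizer of a pair in `PGL_n(ℂ)` is finite, then the matrices commuting with both
representatives are scalar. -/
theorem eq_smul_one_of_finite_centralizer {X Y : GL (Fin n) ℂ}
    (hfin : (Subgroup.centralizer {mk X, mk Y} : Set PGL(n, ℂ)).Finite)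
    {Z : Matrix (Fin n) (Fin n) ℂ} (hX : Commute Z X.1) (hY : Commute Z Y.1) :
    ∃ c : ℂ, Z = c • 1 := by
  by_contra! hZ
  -- For `t` outside the finite spectrum, `t - Z` is invertible and commutes with `X` and `Y`. When
  -- `Z` is not scalar these units are pairwise non-proportional, which gives infinitely many
  -- elements of the centralizer.
  have hunit : ∀ t : ((spectrum ℂ Z)ᶜ : Set ℂ), ∃ g : GL (Fin n) ℂ, g.1 = t.1 • 1 - Z := by
    intro t
    obtain ⟨g, hg⟩ := spectrum.notMem_iff.1 t.2
    exact ⟨g, by rw [hg, Algebra.algebraMap_eq_smul_one]⟩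
  choose g hg using hunit
  have hcomm : ∀ (A : GL (Fin n) ℂ), Commute Z A.1 → ∀ t, mk A * mk (g t) = mk (g t) * mk A := by
    intro A hA t
    rw [← map_mul, ← map_mul]
    congr 1
    refine Units.ext ?_
    rw [Units.val_mul, Units.val_mul, hg]
    exact (((Commute.one_left _).smul_left t.1).sub_left hA).symm.eq
  have hmaps : ∀ t, mk (g t) ∈ (Subgroup.centralizer {mk X, mk Y} : Set PGL(n, ℂ)) := fun t =>
    mem_centralizer_pair.2 ⟨hcomm X hX t, hcomm Y hY t⟩
  have hinj : Function.Injective fun t => mk (g t) := by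
    intro t t' h
    obtain ⟨c, hc⟩ := mk_eq_mk_iff_smul.1 h
    rw [hg, hg, smul_sub, smul_smul] at hc
    have hc1 : (c : ℂ) = 1 := by
      by_contra hne
      refine hZ ((c - 1 : ℂ)⁻¹ * (c * t - t')) ?_
      have : ((c : ℂ) - 1) • Z = ((c : ℂ) * t - t') • (1 : Matrix (Fin n) (Fin n) ℂ) := by
        rw [sub_smul, sub_smul, one_smul]
        rw [sub_eq_sub_iff_add_eq_add] at hc ⊢
        rw [add_comm, hc, add_comm]
      rw [mul_smul, ← this, smul_smul, inv_mul_cancel₀ (sub_ne_zero.2 hne), one_smul]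
    rw [hc1, one_mul, one_smul, sub_left_inj, ← sub_eq_zero, ← sub_smul, smul_eq_zero,
      sub_eq_zero] at hc
    rcases hc with hc | hc
    · exact Subtype.ext hc.symm
    · exact (hZ 0 (by rw [zero_smul, ← mul_one Z, hc, mul_zero])).elim
  have hinf : Infinite ((spectrum ℂ Z)ᶜ : Set ℂ) :=
    (Matrix.finite_spectrum Z).infinite_compl.to_subtype
  exact (Set.infinite_of_injective_forall_mem hinj hmaps) hfin

/-- Conjugation by an invertible matrix as an automorphism of the algebra of matrices. -/
def conjAlgEquiv {ι : Type*} [Fintype ι] [DecidableEq ι] (X : GL ι ℂ) :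
    Matrix ι ι ℂ ≃ₐ[ℂ] Matrix ι ι ℂ :=
  MulSemiringAction.toAlgEquiv ℂ (Matrix ι ι ℂ) (ConjAct.toConjAct X)

theorem conjAlgEquiv_apply {ι : Type*} [Fintype ι] [DecidableEq ι] (X : GL ι ℂ)
    (T : Matrix ι ι ℂ) : conjAlgEquiv X T = X.1 * T * X⁻¹.1 := rfl

theorem conjAlgEquiv_mul {ι : Type*} [Fintype ι] [DecidableEq ι] (X Y : GL ι ℂ)
    (T : Matrix ι ι ℂ) : conjAlgEquiv (X * Y) T = conjAlgEquiv X (conjAlgEquiv Y T) := by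
  simp only [conjAlgEquiv_apply, _root_.mul_inv_rev, Units.val_mul, mul_assoc]

theorem conjAlgEquiv_eq_of_mk_eq {X Y : GL (Fin n) ℂ} (h : mk X = mk Y) :
    conjAlgEquiv X = conjAlgEquiv Y := by
  obtain ⟨u, rfl⟩ := mk_eq_mk_iff.1 h
  ext1 T
  rw [conjAlgEquiv_mul]
  congr 1
  rw [conjAlgEquiv_apply, ← map_inv, GeneralLinearGroup.coe_scalar, GeneralLinearGroup.coe_scalar,
    (Matrix.scalar_commute (u : ℂ) (fun _ => Commute.all _ _) T).eq, mul_assoc, ← map_mul]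
  simp

theorem commute_of_conjAlgEquiv_eq {X : GL (Fin n) ℂ} {T : Matrix (Fin n) (Fin n) ℂ}
    (h : conjAlgEquiv X T = T) : Commute T X.1 := by
  rw [conjAlgEquiv_apply] at h
  have := congrArg (· * X.1) h
  simp only [mul_assoc, ← Units.val_mul, inv_mul_cancel, Units.val_one, mul_one] at this
  exact this.symm

/-- The commutator of the representatives of a pair with finite centralizer is a primitive
`n`-th root of unity. -/
theorem isPrimitiveRoot_of_finite_centralizer [NeZero n] {X Y : GL (Fin n) ℂ} {ω : ℂ}
    (h : X.1 * Y.1 = ω • (Y.1 * X.1))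
    (hfin : (Subgroup.centralizer {mk X, mk Y} : Set PGL(n, ℂ)).Finite) :
    IsPrimitiveRoot ω n := by
  have hωn := pow_eq_one_of_mul_eq_smul h
  set d := orderOf ω with hd
  have hd0 : 0 < d := orderOf_pos_iff.2 (isOfFinOrder_iff_pow_eq_one.2 ⟨n, NeZero.pos n, hωn⟩)
  suffices hle : n ≤ d by
    have : d = n := le_antisymm (Nat.le_of_dvd (NeZero.pos n) (orderOf_dvd_of_pow_eq_one hωn)) hle
    rw [← this]
    exact IsPrimitiveRoot.orderOf ω
  have hω0 : ω ≠ 0 := by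
    rintro rfl
    rw [zero_pow (NeZero.ne n)] at hωn
    exact zero_ne_one hωn
  -- `X ^ d` and `Y ^ d` commute with both `X` and `Y` since `ω ^ d = 1`. Hence they are scalar, and
  -- conjugation by `X` and by `Y` has order dividing `d`.
  have hpow : ∀ (A : GL (Fin n) ℂ), Commute (A.1 ^ d) X.1 → Commute (A.1 ^ d) Y.1 →
      mk (A ^ d) = mk 1 := by
    intro A h1 h2
    obtain ⟨c, hc⟩ := eq_smul_one_of_finite_centralizer hfin h1 h2
    have hc0 : c ≠ 0 := by
      rintro rfl
      have := (A ^ d).isUnit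
      rw [Units.val_pow_eq_pow_val, hc, zero_smul] at this
      exact not_isUnit_zero this
    rw [map_one, mk_eq_one_iff_smul]
    exact ⟨Units.mk0 c hc0, by simpa using hc⟩
  have hωd : ω ^ d = 1 := pow_orderOf_eq_one ω
  have hXd : mk (X ^ d) = mk 1 := by
    refine hpow X ((Commute.refl _).pow_left d) ?_
    have := mul_pow_of_mul_eq_smul h d
    rwa [hωd, one_smul] at this
  have hYd : mk (Y ^ d) = mk 1 := by
    refine hpow Y ?_ ((Commute.refl _).pow_left d)
    have := pow_mul_of_mul_eq_smul h d
    rw [hωd, one_smul] at this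
    exact this.symm
  obtain ⟨μ, v, hv0, hv⟩ := exists_mulVec_eq_smul X
  obtain ⟨i, hi⟩ := Function.ne_iff.1 hv0
  -- A rank-one matrix with image the line through `v` and with trace `v i ≠ 0`.
  let T : Matrix (Fin n) (Fin n) ℂ := vecMulVec v (Pi.single i (1 : ℂ))
  let φ : Module.End ℂ (Matrix (Fin n) (Fin n) ℂ) := (conjAlgEquiv X).toLinearMap
  let ψ : Module.End ℂ (Matrix (Fin n) (Fin n) ℂ) := (conjAlgEquiv Y).toLinearMap
  have hconjpow : ∀ (A : GL (Fin n) ℂ) (k : ℕ) (S : Matrix (Fin n) (Fin n) ℂ),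
      ((conjAlgEquiv A).toLinearMap ^ k : Module.End ℂ (Matrix (Fin n) (Fin n) ℂ)) S =
        conjAlgEquiv (A ^ k) S := by
    intro A k S
    induction k generalizing S with
    | zero => simp [conjAlgEquiv_apply]
    | succ k ih => rw [pow_succ, Module.End.mul_apply, ih, pow_succ, conjAlgEquiv_mul]; rfl
  have hone : ∀ (A : GL (Fin n) ℂ), mk (A ^ d) = mk 1 →
      ((conjAlgEquiv A).toLinearMap ^ d : Module.End ℂ (Matrix (Fin n) (Fin n) ℂ)) = 1 := by
    intro A hA
    ext1 S
    rw [hconjpow, conjAlgEquiv_eq_of_mk_eq hA]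
    simp [conjAlgEquiv_apply]
  have hcommφψ : Commute φ ψ := by
    refine LinearMap.ext fun S => ?_
    change conjAlgEquiv X (conjAlgEquiv Y S) = conjAlgEquiv Y (conjAlgEquiv X S)
    rw [← conjAlgEquiv_mul, ← conjAlgEquiv_mul]
    congr 1
    refine conjAlgEquiv_eq_of_mk_eq ?_
    rw [map_mul, map_mul, commute_mk_iff]
    exact ⟨Units.mk0 ω hω0, h⟩
  -- `Φ * Ψ` sums over the `d * d` conjugations by `X ^ a Y ^ b`. Its value on `T` is invariant
  -- under both conjugations, hence a scalar matrix, and its trace `d ^ 2 * v i` shows that the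
  -- scalar is nonzero.
  let Φ := ∑ a ∈ Finset.range d, φ ^ a
  let Ψ := ∑ b ∈ Finset.range d, ψ ^ b
  have hΦ : φ * Φ = Φ := by
    have := mul_geom_sum φ d
    rw [hone X hXd, sub_self, sub_mul, one_mul, sub_eq_zero] at this
    exact this
  have hΨ : ψ * Ψ = Ψ := by
    have := mul_geom_sum ψ d
    rw [hone Y hYd, sub_self, sub_mul, one_mul, sub_eq_zero] at this
    exact this
  have hψΦ : ψ * Φ = Φ * ψ := by
    simp only [Φ, Finset.mul_sum, Finset.sum_mul]
    exact Finset.sum_congr rfl fun a _ => (hcommφψ.pow_left a).eq.symm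
  obtain ⟨c, hc⟩ : ∃ c : ℂ, (Φ * Ψ) T = c • 1 := by
    refine eq_smul_one_of_finite_centralizer hfin (commute_of_conjAlgEquiv_eq ?_)
      (commute_of_conjAlgEquiv_eq ?_)
    · exact LinearMap.congr_fun (show φ * (Φ * Ψ) = Φ * Ψ by rw [← mul_assoc, hΦ]) T
    · exact LinearMap.congr_fun
        (show ψ * (Φ * Ψ) = Φ * Ψ by rw [← mul_assoc, hψΦ, mul_assoc, hΨ]) T
  have hsum : (Φ * Ψ) T = ∑ a ∈ Finset.range d, ∑ b ∈ Finset.range d,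
      conjAlgEquiv (X ^ a) (conjAlgEquiv (Y ^ b) T) := by
    simp only [Φ, Ψ, Finset.sum_mul_sum, LinearMap.sum_apply, Module.End.mul_apply]
    refine Finset.sum_congr rfl fun a _ => Finset.sum_congr rfl fun b _ => ?_
    rw [hconjpow, hconjpow]
  have htr : ∀ (A : GL (Fin n) ℂ) S, (conjAlgEquiv A S).trace = S.trace := by
    intro A S
    rw [conjAlgEquiv_apply, Matrix.trace_mul_cycle, ← Units.val_mul, inv_mul_cancel]
    simp
  have hc0 : c ≠ 0 := by
    rintro rfl
    rw [zero_smul, hsum] at hc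
    have := congrArg Matrix.trace hc
    simp only [Matrix.trace_sum, htr, Finset.sum_const, Finset.card_range, Matrix.trace_zero, T,
      Matrix.trace_vecMulVec, dotProduct_single, mul_one, nsmul_eq_mul, mul_eq_zero,
      Nat.cast_eq_zero, hd0.ne', false_or] at this
    exact hi this
  -- The image of each conjugate of `T` is the line through `X ^ a Y ^ b v`, which is the line
  -- through `Y ^ b v`. Their sum is an invertible scalar, so the `d` vectors `Y ^ b v` span the
  -- space and `n ≤ d`.
  have hspan : Submodule.span ℂ (Set.range fun b : Fin d => Y.1 ^ (b : ℕ) *ᵥ v) = ⊤ := by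
    rw [eq_top_iff]
    rintro w -
    have hw : w = c⁻¹ • ((Φ * Ψ) T *ᵥ w) := by
      rw [hc, smul_mulVec, one_mulVec, smul_smul, inv_mul_cancel₀ hc0, one_smul]
    rw [hw, hsum, sum_mulVec]
    refine Submodule.smul_mem _ _ (Submodule.sum_mem _ fun a _ => ?_)
    rw [sum_mulVec]
    refine Submodule.sum_mem _ fun b hb => ?_
    rw [← conjAlgEquiv_mul, conjAlgEquiv_apply, mul_assoc, Units.val_mul, mul_assoc]
    simp only [T, vecMulVec_mul, mul_vecMulVec, vecMulVec_mulVec, Units.val_pow_eq_pow_val]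
    have hpw : ∀ a : ℕ, X.1 ^ a *ᵥ (Y.1 ^ b *ᵥ v) ∈
        Submodule.span ℂ (Set.range fun b : Fin d => Y.1 ^ (b : ℕ) *ᵥ v) := by
      intro a
      induction a with
      | zero =>
        rw [pow_zero, one_mulVec]
        exact Submodule.subset_span ⟨⟨b, Finset.mem_range.1 hb⟩, rfl⟩
      | succ a ih =>
        rw [pow_succ, ← mulVec_mulVec, pow_mulVec_of_mul_eq_smul h hv, mulVec_smul]
        exact Submodule.smul_mem _ _ ih
    rw [op_smul_eq_smul]
    exact Submodule.smul_mem _ _ (hpw a)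
  simpa using finrank_le_of_span_eq_top hspan

/-- An element of the centralizer is determined by its commutator scalars with `X` and `Y`: if two
lifts have the same scalars, their quotient commutes with `X` and `Y` and is scalar. Both scalars
are `n`-th roots of unity. -/
theorem finite_centralizer_of_isPrimitiveRoot [NeZero n] {X Y : GL (Fin n) ℂ} {ω : ℂ}
    (hω : IsPrimitiveRoot ω n) (h : X.1 * Y.1 = ω • (Y.1 * X.1)) :
    (Subgroup.centralizer {mk X, mk Y} : Set PGL(n, ℂ)).Finite := by
  have key : ∀ z : PGL(n, ℂ), ∃ a b : ℂ, z ∈ Subgroup.centralizer {mk X, mk Y} →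
      ∃ Z : GL (Fin n) ℂ, mk Z = z ∧ X.1 * Z.1 = a • (Z.1 * X.1) ∧ Y.1 * Z.1 = b • (Z.1 * Y.1) := by
    intro z
    by_cases hz : z ∈ Subgroup.centralizer {mk X, mk Y}
    · obtain ⟨Z, rfl⟩ := mk_surjective z
      rw [mem_centralizer_pair, commute_mk_iff, commute_mk_iff] at hz
      obtain ⟨⟨a, ha⟩, b, hb⟩ := hz
      exact ⟨a, b, fun _ => ⟨Z, rfl, ha, hb⟩⟩
    -- Dummy values off the centralizer, so that `a` and `b` are total functions.
    · exact ⟨0, 0, fun h => (hz h).elim⟩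
  choose a b hab using key
  have hroots : {c : ℂ | c ^ n = 1}.Finite := by
    refine (Polynomial.nthRootsFinset n (1 : ℂ)).finite_toSet.subset fun c hc => ?_
    exact (Polynomial.mem_nthRootsFinset (NeZero.pos n) 1).2 hc
  refine Set.Finite.of_injOn (f := fun z => (a z, b z)) (fun z hz => ?_) (fun z hz z' hz' e => ?_)
    (hroots.prod hroots)
  · obtain ⟨Z, -, h1, h2⟩ := hab z hz
    exact ⟨pow_eq_one_of_mul_eq_smul h1, pow_eq_one_of_mul_eq_smul h2⟩
  · obtain ⟨Z, hZ, h1, h2⟩ := hab z hz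
    obtain ⟨Z', hZ', h1', h2'⟩ := hab z' hz'
    have e1 : a z = a z' := congrArg Prod.fst e
    have e2 : b z = b z' := congrArg Prod.snd e
    rw [← e1] at h1'
    rw [← e2] at h2'
    have hcomm : ∀ (A : GL (Fin n) ℂ) (t : ℂ), A.1 * Z.1 = t • (Z.1 * A.1) →
        A.1 * Z'.1 = t • (Z'.1 * A.1) → Commute (Z⁻¹ * Z').1 A.1 := by
      intro A t hA hA'
      have ht : t ≠ 0 := by
        rintro rfl
        rw [zero_smul, ← Units.val_mul] at hA
        have := (A * Z).isUnit
        rw [hA] at this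
        exact not_isUnit_zero this
      have h3 : Z⁻¹.1 * A.1 = t • (A.1 * Z⁻¹.1) := by
        have := congrArg (fun M => Z⁻¹.1 * M * Z⁻¹.1) hA
        simp only [mul_smul_comm, smul_mul_assoc] at this
        rw [← mul_assoc Z⁻¹.1 Z.1, mul_assoc, mul_assoc A.1, ← Units.val_mul Z, ← Units.val_mul _ Z,
          mul_inv_cancel, inv_mul_cancel, Units.val_one, mul_one, one_mul] at this
        exact this
      have h4 : Z'.1 * A.1 = t⁻¹ • (A.1 * Z'.1) := mul_eq_inv_smul ht hA'
      rw [Commute, SemiconjBy, Units.val_mul, mul_assoc, h4, mul_smul_comm, ← mul_assoc, h3,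
        smul_mul_assoc, smul_smul, inv_mul_cancel₀ ht, one_smul, mul_assoc]
    obtain ⟨c, hc⟩ := eq_smul_one_of_commute hω h (hcomm X _ h1 h1') (hcomm Y _ h2 h2')
    have hc0 : c ≠ 0 := by
      rintro rfl
      have := (Z⁻¹ * Z').isUnit
      rw [hc, zero_smul] at this
      exact not_isUnit_zero this
    have : mk (Z⁻¹ * Z') = 1 := mk_eq_one_iff_smul.2 ⟨Units.mk0 c hc0, hc⟩
    rw [map_mul, map_inv, hZ, hZ', inv_mul_eq_one] at this
    exact this

end EllipticPairs
end EllipticPGL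

namespace EllipticPGL
open Matrix Matrix.ProjGenLinGroup

/-! ### The commutator as a complete invariant, and the orbits -/

section StandardUnion

variable {n : ℕ}

/-- `x, y ∈ PGL_n(ℂ)` have representatives `X, Y` with `X Y = ω Y X`. -/
def HasCommutator (x y : PGL(n, ℂ)) (ω : ℂˣ) : Prop :=
  ∃ X Y : GL (Fin n) ℂ, mk X = x ∧ mk Y = y ∧ X.1 * Y.1 = (ω : ℂ) • (Y.1 * X.1)

/-- Rescaling the lifts multiplies both sides of the relation by the same factor, so any choice of
lifts may be used. -/
theorem hasCommutator_mk_iff {X Y : GL (Fin n) ℂ} {ω : ℂˣ} :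
    HasCommutator (mk X) (mk Y) ω ↔ X.1 * Y.1 = (ω : ℂ) • (Y.1 * X.1) := by
  refine ⟨?_, fun h => ⟨X, Y, rfl, rfl, h⟩⟩
  rintro ⟨X', Y', hX, hY, h⟩
  obtain ⟨a, ha⟩ := mk_eq_mk_iff_smul.1 hX
  obtain ⟨b, hb⟩ := mk_eq_mk_iff_smul.1 hY
  rw [ha, hb, smul_mul_smul_comm, smul_mul_smul_comm, h, smul_comm, mul_comm (b : ℂ)]

theorem HasCommutator.unique [NeZero n] {x y : PGL(n, ℂ)} {ω ω' : ℂˣ} (h : HasCommutator x y ω)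
    (h' : HasCommutator x y ω') : ω = ω' := by
  obtain ⟨X, rfl⟩ := mk_surjective x
  obtain ⟨Y, rfl⟩ := mk_surjective y
  rw [hasCommutator_mk_iff] at h h'
  rw [h] at h'
  exact Units.ext (smul_left_injective ℂ (m := Y.1 * X.1)
    (by rw [← Units.val_mul]; exact (Y * X).isUnit.ne_zero) h')

theorem HasCommutator.swap {x y : PGL(n, ℂ)} {ω : ℂˣ} (h : HasCommutator x y ω) :
    HasCommutator y x ω⁻¹ := by
  obtain ⟨X, Y, hX, hY, h⟩ := h
  exact ⟨Y, X, hY, hX, by simpa using mul_eq_inv_smul ω.ne_zero h⟩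

theorem HasCommutator.pow_right {x y : PGL(n, ℂ)} {ω : ℂˣ} (h : HasCommutator x y ω) (k : ℕ) :
    HasCommutator x (y ^ k) (ω ^ k) := by
  obtain ⟨X, Y, hX, hY, h⟩ := h
  refine ⟨X, Y ^ k, hX, by rw [map_pow, hY], ?_⟩
  simpa using pow_mul_of_mul_eq_smul h k

theorem HasCommutator.conj {x y : PGL(n, ℂ)} {ω : ℂˣ} (h : HasCommutator x y ω) (q : PGL(n, ℂ)) :
    HasCommutator (q * x * q⁻¹) (q * y * q⁻¹) ω := by
  obtain ⟨X, Y, rfl, rfl, h⟩ := h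
  obtain ⟨Q, rfl⟩ := mk_surjective q
  refine ⟨Q * X * Q⁻¹, Q * Y * Q⁻¹, by simp, by simp, ?_⟩
  have := congrArg (conjAlgEquiv Q) h
  rwa [map_mul, map_smul, map_mul] at this

/-- The cyclic matrix moves the basis vector of weight `ζ ^ j` to the one of weight `ζ ^ (j + 1)`;
the wrap-around column is where `ζ ^ n = 1` enters. -/
theorem hasCommutator_delta_wdot [NeZero n] {ζ : ℂˣ} (hζ : ζ ^ n = 1) :
    HasCommutator (Delta n ζ) (wdot n) ζ := by
  refine ⟨_, _, rfl, rfl, ?_⟩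
  rw [coe_delta_rep]
  change _ * ((finRotate n)⁻¹).permMatrix ℂ = _ • (((finRotate n)⁻¹).permMatrix ℂ * _)
  refine Matrix.ext_col fun j => ?_
  rw [mul_permMatrix_finRotate_col]
  ext i
  simp only [col_apply, Matrix.smul_apply, mul_diagonal, smul_eq_mul, Equiv.Perm.permMatrix,
    PEquiv.toMatrix_apply, Equiv.toPEquiv_apply, diagonal_apply, Option.mem_some_iff]
  by_cases hij : i = finRotate n j
  · subst hij
    have : (ζ : ℂ) ^ ((j + 1 : ℕ) % n) = (ζ : ℂ) ^ (j + 1 : ℕ) :=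
      (pow_eq_pow_mod _ (by rw [← Units.val_pow_eq_pow_val, hζ, Units.val_one])).symm
    rw [if_pos rfl, if_pos (show (finRotate n)⁻¹ _ = j from (finRotate n).symm_apply_apply j),
      val_finRotate, this, pow_succ', one_mul]
  · have : (finRotate n)⁻¹ i ≠ j := fun h => hij (by rw [← h]; simp)
    simp only [hij, this, if_false]
    simp

/-- Conjugation preserves the commutator, and two pairs with the same primitive commutator are both
conjugate to the standard pair for `ω`. -/
theorem pairOrbit_eq_hasCommutator [NeZero n] {x y : PGL(n, ℂ)} {ω : ℂˣ}
    (hω : IsPrimitiveRoot ω n) (h : HasCommutator x y ω) :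
    pairOrbit (x, y) = {p | HasCommutator p.1 p.2 ω} := by
  ext ⟨x', y'⟩
  constructor
  · rintro ⟨q, hq⟩
    obtain ⟨q, rfl⟩ := ConjAct.toConjAct.surjective q
    rw [← hq]
    exact h.conj q
  · rintro ⟨X', Y', rfl, rfl, h'⟩
    obtain ⟨X, Y, rfl, rfl, h⟩ := h
    obtain ⟨q, h1, h2⟩ := exists_conj_standard hω h
    obtain ⟨q', h1', h2'⟩ := exists_conj_standard hω h'
    refine ⟨ConjAct.toConjAct (q' * q⁻¹), ?_⟩
    refine Prod.ext ?_ ?_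
    · change q' * q⁻¹ * mk X * (q' * q⁻¹)⁻¹ = mk X'
      rw [← h1, ← h1']
      group
    · change q' * q⁻¹ * mk Y * (q' * q⁻¹)⁻¹ = mk Y'
      rw [← h2, ← h2']
      group

/-- Semisimplicity costs nothing: a primitive commutator forces both `n`-th powers to be trivial.
Leaving `ss` abstract lets the result be reused for subgroups, where semisimplicity is tested in a
larger group. -/
theorem mem_ellipticPairs_iff [NeZero n] {ss : PGL(n, ℂ) → Prop} (hss : ∀ x, x ^ n = 1 → ss x)
    {p : PGL(n, ℂ) × PGL(n, ℂ)} :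
    p ∈ ellipticPairs ss ↔ ∃ ω : ℂˣ, IsPrimitiveRoot ω n ∧ HasCommutator p.1 p.2 ω := by
  obtain ⟨x, y⟩ := p
  obtain ⟨X, rfl⟩ := mk_surjective x
  obtain ⟨Y, rfl⟩ := mk_surjective y
  constructor
  · rintro ⟨-, -, hcomm, hfin⟩
    obtain ⟨ω, hω⟩ := commute_mk_iff.1 hcomm
    exact ⟨ω, IsPrimitiveRoot.coe_units_iff.1 (isPrimitiveRoot_of_finite_centralizer hω hfin),
      hasCommutator_mk_iff.2 hω⟩
  · rintro ⟨ω, hω, h⟩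
    have h := hasCommutator_mk_iff.1 h
    have hω := IsPrimitiveRoot.coe_units_iff.2 hω
    exact ⟨hss _ (mk_pow_eq_one_left hω h), hss _ (mk_pow_eq_one_right hω h),
      commute_mk_iff.2 ⟨ω, h⟩, finite_centralizer_of_isPrimitiveRoot hω h⟩

theorem isPrimitiveRoot_iff_exists_zmod_unit [NeZero n] {ζ ω : ℂˣ} (hζ : IsPrimitiveRoot ζ n) :
    IsPrimitiveRoot ω n ↔ ∃ k : (ZMod n)ˣ, ζ ^ (k : ZMod n).val = ω := by
  constructor
  · intro hω
    obtain ⟨i, hi, hcop, h⟩ := (IsPrimitiveRoot.coe_units_iff.2 hζ).isPrimitiveRoot_iff.1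
      (IsPrimitiveRoot.coe_units_iff.2 hω)
    refine ⟨ZMod.unitOfCoprime i hcop, Units.ext ?_⟩
    rw [ZMod.coe_unitOfCoprime, ZMod.val_natCast, Nat.mod_eq_of_lt hi, Units.val_pow_eq_pow_val, h]
  · rintro ⟨k, rfl⟩
    exact hζ.pow_of_coprime _ (ZMod.val_coe_unit_coprime k)

theorem pow_val_neg [NeZero n] {ζ : ℂˣ} (hζ : ζ ^ n = 1) (k : ZMod n) :
    ζ ^ (-k).val = (ζ ^ k.val)⁻¹ := by
  rw [eq_inv_iff_mul_eq_one, ← pow_add]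
  obtain ⟨m, hm⟩ : n ∣ (-k).val + k.val := by
    rw [← ZMod.natCast_eq_zero_iff]
    simp
  rw [hm, pow_mul, hζ, one_pow]

/-- The classification of elliptic pairs in `PGL_n(ℂ)`, for any notion of semisimplicity that
contains the elements whose `n`-th power is trivial. -/
theorem isStandardUnion_ellipticPairs (hn : 0 < n) {ss : PGL(n, ℂ) → Prop}
    (hss : ∀ x, x ^ n = 1 → ss x) {ζ : ℂˣ} (hζ : IsPrimitiveRoot ζ n) :
    IsStandardUnion (ellipticPairs ss) n (Delta n ζ) (wdot n) := by
  have : NeZero n := ⟨hn.ne'⟩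
  -- Each orbit is a level set of the commutator, so the union, the disjointness and the flip become
  -- statements about powers of `ζ`.
  have horb : ∀ k : (ZMod n)ˣ, pairOrbit (Delta n ζ, wdot n ^ (k : ZMod n).val) =
      {p | HasCommutator p.1 p.2 (ζ ^ (k : ZMod n).val)} := fun k =>
    pairOrbit_eq_hasCommutator ((isPrimitiveRoot_iff_exists_zmod_unit hζ).2 ⟨k, rfl⟩)
      ((hasCommutator_delta_wdot hζ.pow_eq_one).pow_right _)
  have hmem : ∀ k : (ZMod n)ˣ, (Delta n ζ, wdot n ^ (k : ZMod n).val) ∈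
      pairOrbit (Delta n ζ, wdot n ^ (k : ZMod n).val) := fun k => MulAction.mem_orbit_self _
  have hunion : ellipticPairs ss =
      ⋃ k : (ZMod n)ˣ, pairOrbit (Delta n ζ, wdot n ^ (k : ZMod n).val) := by
    ext p
    rw [mem_ellipticPairs_iff hss, Set.mem_iUnion]
    constructor
    · rintro ⟨ω, hω, h⟩
      obtain ⟨k, rfl⟩ := (isPrimitiveRoot_iff_exists_zmod_unit hζ).1 hω
      exact ⟨k, by rw [horb]; exact h⟩
    · rintro ⟨k, hk⟩
      rw [horb] at hk
      exact ⟨_, (isPrimitiveRoot_iff_exists_zmod_unit hζ).2 ⟨k, rfl⟩, hk⟩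
  have hdisj : Pairwise fun k l : (ZMod n)ˣ =>
      Disjoint (pairOrbit (Delta n ζ, wdot n ^ (k : ZMod n).val))
        (pairOrbit (Delta n ζ, wdot n ^ (l : ZMod n).val)) := by
    intro k l hkl
    rw [Set.disjoint_left, horb, horb]
    intro p hp hp'
    refine hkl (Units.ext (ZMod.val_injective n ?_))
    exact hζ.pow_inj (ZMod.val_lt _) (ZMod.val_lt _) (hp.unique hp')
  have horbits : pairOrbits (ellipticPairs ss) =
      Set.range fun k : (ZMod n)ˣ => pairOrbit (Delta n ζ, wdot n ^ (k : ZMod n).val) := by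
    ext O
    constructor
    · rintro ⟨p, hp, rfl⟩
      rw [hunion, Set.mem_iUnion] at hp
      obtain ⟨k, hk⟩ := hp
      exact ⟨k, (MulAction.orbit_eq_iff.2 hk).symm⟩
    · rintro ⟨k, rfl⟩
      exact ⟨_, by rw [hunion]; exact Set.mem_iUnion.2 ⟨k, hmem k⟩, rfl⟩
  refine ⟨hunion, hdisj, ?_, fun k => ?_⟩
  · rw [horbits]
    refine ⟨Set.finite_range _, ?_⟩
    rw [← Nat.card_coe_set_eq, Nat.card_range_of_injective, Nat.card_eq_fintype_card,
      ZMod.card_units_eq_totient]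
    intro k l hkl
    by_contra hne
    exact Set.disjoint_left.1 (hdisj hne) (hmem k) (hkl.subset (hmem k))
  · rw [horb, horb, Units.val_neg, pow_val_neg hζ.pow_eq_one, Set.image_swap_eq_preimage_swap]
    ext p
    exact ⟨fun h => HasCommutator.swap h, fun h => by simpa using HasCommutator.swap h⟩

theorem pairOrbit_map {H K : Type*} [Group H] [Group K] (φ : H ≃* K) (x : H × H) :
    pairOrbit (φ x.1, φ x.2) = Prod.map φ φ '' pairOrbit x := by
  ext p
  constructor
  · rintro ⟨q, rfl⟩
    obtain ⟨q, rfl⟩ := ConjAct.toConjAct.surjective q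
    refine ⟨_, ⟨ConjAct.toConjAct (φ.symm q), rfl⟩, ?_⟩
    simp [ConjAct.toConjAct_smul, Prod.map]
  · rintro ⟨_, ⟨q, rfl⟩, rfl⟩
    obtain ⟨q, rfl⟩ := ConjAct.toConjAct.surjective q
    refine ⟨ConjAct.toConjAct (φ q), ?_⟩
    simp [ConjAct.toConjAct_smul, Prod.map]

/-- The semisimplicity predicate is pulled back along `φ`, so the pairs in a reductive part can be
studied in `PGL_r` although semisimplicity is measured in `PGL_n`. -/
theorem image_ellipticPairs {H K : Type*} [Group H] [Group K] (φ : H ≃* K) (ss : K → Prop) :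
    ellipticPairs ss = Prod.map φ φ '' ellipticPairs (fun x => ss (φ x)) := by
  have hcent : ∀ x y : H, (Subgroup.centralizer {φ x, φ y} : Set K) =
      φ '' (Subgroup.centralizer {x, y} : Set H) := by
    intro x y
    ext z
    obtain ⟨z, rfl⟩ := φ.surjective z
    rw [φ.injective.mem_set_image]
    simp only [SetLike.mem_coe, mem_centralizer_pair, ← map_mul, φ.injective.eq_iff]
  ext ⟨x, y⟩
  obtain ⟨x, rfl⟩ := φ.surjective x
  obtain ⟨y, rfl⟩ := φ.surjective y
  rw [show (φ x, φ y) = Prod.map φ φ (x, y) from rfl,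
    (φ.injective.prodMap φ.injective).mem_set_image]
  simp only [ellipticPairs, Set.mem_ofPred_eq, Prod.map, hcent, ← map_mul, φ.injective.eq_iff,
    Set.finite_image_iff φ.injective.injOn]

theorem IsStandardUnion.map {H K : Type*} [Group H] [Group K] (φ : H ≃* K) {Y : Set (H × H)}
    {m : ℕ} {s w : H} (h : IsStandardUnion Y m s w) :
    IsStandardUnion (Prod.map φ φ '' Y) m (φ s) (φ w) := by
  have horb : ∀ k : ℕ, pairOrbit (φ s, φ w ^ k) = Prod.map φ φ '' pairOrbit (s, w ^ k) := by
    intro k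
    rw [← pairOrbit_map, ← map_pow]
  have hinj : Function.Injective (Prod.map φ φ) := φ.injective.prodMap φ.injective
  refine ⟨?_, fun k l hkl => ?_, ?_, fun k => ?_⟩
  · rw [h.eq_iUnion, Set.image_iUnion]
    simp only [horb]
  · simp only [horb]
    exact (Set.disjoint_image_iff hinj).2 (h.disjoint hkl)
  · have : pairOrbits (Prod.map φ φ '' Y) = Set.image (Prod.map φ φ) '' pairOrbits Y := by
      rw [pairOrbits, pairOrbits, Set.image_image, Set.image_image]
      exact Set.image_congr' fun x => pairOrbit_map φ x
    rw [this]
    exact ⟨h.card_orbits.1.image _, by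
      rw [Set.ncard_image_of_injective _ hinj.image_injective, h.card_orbits.2]⟩
  · rw [horb, horb, ← h.flip k, Set.image_image, Set.image_image]
    rfl

end StandardUnion
end EllipticPGL

namespace EllipticPGL
open Matrix

/-! ### Conjugacy of closed complements -/

section Levi

variable {C : Type*} [Ring C] [Algebra ℂ C]

/-- Two commuting elements with the same power which differ by a nilpotent element are equal. -/
theorem eq_of_pow_eq_one_of_isNilpotent_sub {X Y : Cˣ} {N : ℕ} (hN : N ≠ 0) (hXY : Commute X Y)
    (hX : X ^ N = 1) (hY : Y ^ N = 1) (hnil : IsNilpotent (X.1 - Y.1)) : X = Y := by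
  set U : Cˣ := X * Y⁻¹ with hU
  have hUN : U.1 ^ N = 1 := by
    have : U ^ N = 1 := by rw [hU, (hXY.inv_right).mul_pow, hX, inv_pow, hY, inv_one, one_mul]
    rw [← Units.val_pow_eq_pow_val, this, Units.val_one]
  have hU1 : IsNilpotent (U.1 - 1) := by
    have h1 : U.1 - 1 = (X.1 - Y.1) * Y⁻¹.1 := by
      rw [sub_mul, ← Units.val_mul, ← Units.val_mul, mul_inv_cancel, Units.val_one]
    rw [h1]
    have hc : Commute X.1 Y⁻¹.1 := (hXY.inv_right).units_val
    have hc' : Commute Y.1 Y⁻¹.1 := ((Commute.refl Y).inv_right).units_val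
    exact (hc.sub_left hc').isNilpotent_mul_right hnil
  -- The geometric sum is `N` plus a multiple of the nilpotent `U - 1`, hence a unit. Its product
  -- with `U - 1` is `U ^ N - 1 = 0`, so `U = 1`.
  have hsum : (∑ k ∈ Finset.range N, U.1 ^ k) =
      algebraMap ℂ C N + (∑ k ∈ Finset.range N, ∑ l ∈ Finset.range k, U.1 ^ l) * (U.1 - 1) := by
    rw [Finset.sum_mul]
    simp_rw [geom_sum_mul]
    simp
  have hunit : IsUnit (∑ k ∈ Finset.range N, U.1 ^ k) := by
    rw [hsum]
    refine IsNilpotent.isUnit_add_left_of_commute ?_ ?_ (Algebra.commutes _ _).symm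
    · refine Commute.isNilpotent_mul_left ?_ hU1
      refine Commute.sum_left _ _ _ fun k _ => Commute.sum_left _ _ _ fun l _ => ?_
      exact ((Commute.refl _).pow_left l).sub_right (Commute.one_right _)
    · exact (IsUnit.mk0 (N : ℂ) (by exact_mod_cast hN)).map (algebraMap ℂ C)
  have h0 : (∑ k ∈ Finset.range N, U.1 ^ k) * (U.1 - 1) = 0 := by
    rw [geom_sum_mul, hUN, sub_self]
  have hUone : U = 1 := Units.ext (sub_eq_zero.1 (hunit.mul_right_eq_zero.1 h0))
  rwa [hU, mul_inv_eq_one] at hUone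

/-- Two homomorphisms from a finite group which agree modulo a nil ideal are conjugate. -/
theorem exists_conj_of_finite {F : Type*} [Group F] [Finite F] {D : Type*} [Ring D] [Algebra ℂ D]
    (π : C →ₐ[ℂ] D) (hnil : ∀ x, π x = 0 → IsNilpotent x) (ρ₁ ρ₂ : F →* Cˣ)
    (h : ∀ f, π (ρ₁ f) = π (ρ₂ f)) :
    ∃ c : Cˣ, (∃ a : ℂ, π c.1 = algebraMap ℂ D a) ∧ ∀ f, ρ₁ f * c = c * ρ₂ f := by
  have := Fintype.ofFinite F
  -- The averaging intertwiner: each term reduces to `1`, so `c` is the nonzero integer `|F|` plus a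
  -- nilpotent, and reindexing the sum gives the intertwining relation.
  let c : C := ∑ f : F, (ρ₁ f * (ρ₂ f)⁻¹ : Cˣ).1
  have hπc : π c = algebraMap ℂ D (Fintype.card F) := by
    have : ∀ f : F, π (ρ₁ f * (ρ₂ f)⁻¹ : Cˣ).1 = 1 := by
      intro f
      rw [Units.val_mul, map_mul, h, ← map_mul, ← Units.val_mul, mul_inv_cancel, Units.val_one,
        map_one]
    simp only [c, map_sum, this]
    simp
  have hc : IsUnit c := by
    have h1 : IsNilpotent (c - algebraMap ℂ C (Fintype.card F)) := by
      refine hnil _ ?_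
      rw [map_sub, hπc, AlgHom.commutes, sub_self]
    have h2 := h1.isUnit_add_left_of_commute
      ((IsUnit.mk0 (Fintype.card F : ℂ) (by exact_mod_cast Fintype.card_ne_zero)).map
        (algebraMap ℂ C)) (Algebra.commutes _ _).symm
    rwa [add_sub_cancel] at h2
  obtain ⟨u, hu⟩ := hc
  refine ⟨u, ⟨_, hu ▸ hπc⟩, fun f => Units.ext ?_⟩
  rw [Units.val_mul, Units.val_mul, hu, Finset.mul_sum, Finset.sum_mul,
    ← Equiv.sum_comp (Equiv.mulLeft f) fun g => (ρ₁ g * (ρ₂ g)⁻¹ : Cˣ).1 * (ρ₂ f).1]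
  refine Finset.sum_congr rfl fun g _ => ?_
  rw [← Units.val_mul, ← Units.val_mul, Equiv.coe_mulLeft, map_mul, map_mul]
  congr 1
  group

/-- In the Peirce decomposition for `e` and `f = 1 - e`, the element `T z` is the conjugate of `X`
by `1 + (z - 1) e`: it scales the block `e X f` by `z`, the block `f X e` by `z⁻¹`, and fixes the
diagonal blocks. The hypotheses are instances of additivity in `z`; they force the diagonal blocks
to be the identities and `f X e` to vanish, leaving only `X = 1 + e X f`. -/
theorem peirce_of_scaling {e X : C} (he : e * e = e) (T : ℂ → C)
    (hT : ∀ z : ℂ, z ≠ 0 → T z = (1 + (z - 1) • e) * X * (1 + (z⁻¹ - 1) • e))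
    (h2 : X * X = T 2) (h3 : X * T 2 = T 3) (hneg : T (-1) * X = 1) :
    e * (X - 1) = X - 1 ∧ (X - 1) * (1 - e) = X - 1 := by
  have he' : ∀ a : C, e * (e * a) = e * a := fun a => by rw [← mul_assoc, he]
  obtain ⟨f, hf⟩ : ∃ f : C, f = 1 - e := ⟨_, rfl⟩
  have hef : e * f = 0 := by rw [hf, mul_sub, he, mul_one, sub_self]
  have hfe : f * e = 0 := by rw [hf, sub_mul, he, one_mul, sub_self]
  have hfe' : ∀ a : C, f * (e * a) = 0 := fun a => by rw [← mul_assoc, hfe, zero_mul]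
  rw [hT 3 (by norm_num), hT 2 (by norm_num)] at h3
  rw [hT 2 (by norm_num)] at h2
  rw [hT (-1) (by norm_num)] at hneg
  norm_num at h2 h3 hneg
  have a1 : e * (X * (X * e)) = e * (X * e) := by
    have := congrArg (fun M => e * M * e) h2
    simp only [mul_add, add_mul, mul_assoc, he, he', mul_one, one_mul, smul_mul_assoc,
      mul_smul_comm, mul_neg, neg_mul] at this
    rw [this]
    module
  have a2 : e * (X * (e * (X * e))) = e * (X * e) := by
    have := congrArg (fun M => e * M * e) h3
    simp only [mul_add, add_mul, mul_assoc, he, he', mul_one, one_mul, smul_mul_assoc,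
      mul_smul_comm, mul_neg, neg_mul, a1] at this
    linear_combination (norm := module) (2 : ℂ) • this
  have a3 : e * (X * e) = e := by
    have := congrArg (fun M => e * M * e) hneg
    simp only [mul_add, add_mul, mul_assoc, he, he', mul_one, one_mul, smul_mul_assoc,
      mul_smul_comm, mul_neg, neg_mul, a1, a2] at this
    linear_combination (norm := module) this
  have b0 : f * (X * (X * f)) = f * (X * f) := by
    have := congrArg (fun M => f * M * f) h2
    simpa only [mul_add, add_mul, mul_assoc, hef, hfe', mul_one, one_mul, smul_mul_assoc,
      mul_smul_comm, mul_neg, neg_mul, smul_zero, neg_zero, mul_zero, add_zero, zero_add] using this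
  have b1 : f * (X * (e * (X * f))) = 0 := by
    have := congrArg (fun M => f * M * f) h3
    simp only [mul_add, add_mul, mul_assoc, hef, hfe', mul_one, one_mul, smul_mul_assoc,
      mul_smul_comm, mul_neg, neg_mul, smul_zero, neg_zero, mul_zero, add_zero, b0] at this
    simpa using this
  have b2 : f * (X * f) = f * f := by
    have := congrArg (fun M => f * M * f) hneg
    simpa only [mul_add, add_mul, mul_assoc, hfe', mul_one, one_mul, smul_mul_assoc,
      mul_smul_comm, mul_neg, neg_mul, smul_zero, neg_zero, add_zero, b0, b1] using this
  have hff : f * f = f := by nth_rw 2 [hf]; rw [mul_sub, hfe, mul_one, sub_zero]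
  rw [hff] at b2
  -- The block `f X e` has weight `-1`: it is halved in `T 2`, whereas with identity diagonal blocks
  -- it doubles in `X * X`. Hence it is zero.
  have c1 : f * (X * (X * e)) = (1 / 2 : ℂ) • (f * (X * e)) := by
    have := congrArg (fun M => f * M * e) h2
    simp only [mul_add, add_mul, mul_assoc, he, hfe', mul_one, one_mul, smul_mul_assoc,
      mul_smul_comm, mul_neg, neg_mul, add_zero] at this
    rw [this]
    module
  have c2 : f * (X * (X * e)) = f * (X * e) + f * (X * e) := by
    calc f * (X * (X * e)) = f * (X * ((e + f) * (X * e))) := by rw [hf]; simp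
      _ = f * X * (e * (X * e)) + f * (X * f) * (X * e) := by
        simp only [add_mul, mul_add, mul_assoc]
      _ = _ := by rw [a3, b2, mul_assoc]
  have c3 : f * (X * e) = 0 := by
    have : (3 / 2 : ℂ) • (f * (X * e)) = 0 := by
      linear_combination (norm := module) c1 - c2
    exact (smul_eq_zero.1 this).resolve_left (by norm_num)
  have hfX : f * X = f := by
    calc f * X = f * (X * e) + f * (X * f) := by rw [← mul_add, ← mul_add, hf]; simp
      _ = f := by rw [c3, b2, zero_add]
  have hXe : X * e = e := by
    calc X * e = e * (X * e) + f * (X * e) := by rw [← add_mul, hf]; simp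
      _ = e := by rw [c3, a3, add_zero]
  constructor
  · have : e = 1 - f := by rw [hf, sub_sub_cancel]
    rw [this, sub_mul, one_mul, mul_sub, hfX, mul_one, sub_self, sub_zero]
  · rw [mul_sub, mul_one, sub_mul X 1 e, hXe, one_mul, sub_self, sub_zero]

/-! ### Homomorphisms from `GL_r` determined by the torus and the Weyl elements -/

/-- The diagonal matrix with the invertible entries `d`. -/
def diagUnit {κ : Type*} [Fintype κ] [DecidableEq κ] : (κ → ℂˣ) →* GL κ ℂ :=
  (Units.map (Matrix.diagonalRingHom κ ℂ).toMonoidHom).comp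
    (MulEquiv.piUnits (M := fun _ : κ => ℂ)).symm.toMonoidHom

/-- The transvection `1 + c E_ij`, `i ≠ j`, as an invertible matrix. -/
def transvectionUnit {κ : Type*} [Fintype κ] [DecidableEq κ] {i j : κ} (h : i ≠ j) (c : ℂ) :
    GL κ ℂ :=
  ⟨transvection i j c, transvection i j (-c),
    by rw [transvection_mul_transvection_same _ _ h]; simp,
    by rw [transvection_mul_transvection_same _ _ h]; simp⟩

variable {κ : Type*} [Fintype κ] [DecidableEq κ]

theorem coe_diagUnit (d : κ → ℂˣ) : (diagUnit d).1 = diagonal fun i => (d i : ℂ) := rfl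

theorem coe_transvectionUnit {i j : κ} (h : i ≠ j) (c : ℂ) :
    (transvectionUnit h c).1 = 1 + single i j c := rfl

theorem transvectionUnit_add {i j : κ} (h : i ≠ j) (a b : ℂ) :
    transvectionUnit h (a + b) = transvectionUnit h a * transvectionUnit h b :=
  Units.ext (transvection_mul_transvection_same _ _ h a b).symm

theorem coe_diagUnit_mulSingle (i : κ) (z : ℂˣ) :
    (diagUnit (Pi.mulSingle i z)).1 = 1 + ((z : ℂ) - 1) • single i i (1 : ℂ) := by
  rw [coe_diagUnit]
  ext k l
  by_cases hkl : k = l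
  · subst hkl
    by_cases hk : k = i
    · subst hk; simp
    · simp [hk, Ne.symm hk]
  · have : ¬ (i = k ∧ i = l) := fun h => hkl (h.1.symm.trans h.2)
    simp [hkl, this]

theorem diagUnit_mul_transvectionUnit {i j : κ} (h : i ≠ j) (d : κ → ℂˣ) (a : ℂ) :
    diagUnit d * transvectionUnit h a =
      transvectionUnit h (d i * a * (d j : ℂ)⁻¹) * diagUnit d := by
  refine Units.ext ?_
  rw [Units.val_mul, Units.val_mul, coe_diagUnit, coe_transvectionUnit, coe_transvectionUnit,
    mul_add, add_mul, mul_one, one_mul]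
  congr 1
  ext k l
  rw [diagonal_mul, mul_diagonal]
  by_cases hkl : i = k ∧ j = l
  · obtain ⟨rfl, rfl⟩ := hkl
    simp
  · simp [hkl]

/-- The matrix `x_ij(1) x_ji(-1) x_ij(1)`, which acts as a rotation on the coordinates `i, j`. -/
def weylUnit {i j : κ} (h : i ≠ j) : GL κ ℂ :=
  transvectionUnit h 1 * transvectionUnit h.symm (-1) * transvectionUnit h 1

theorem coe_weylUnit {i j : κ} (h : i ≠ j) :
    (weylUnit h).1 = 1 - single i i 1 - single j j 1 + single i j 1 - single j i 1 := by
  rw [weylUnit, Units.val_mul, Units.val_mul, coe_transvectionUnit, coe_transvectionUnit]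
  simp only [mul_add, add_mul, mul_one, one_mul, single_mul_single_same,
    single_mul_single_of_ne _ _ _ _ h.symm]
  rw [show (single j i (-1 : ℂ)) = - single j i 1 from (single_neg ..).symm,
    show (single j j (-1 : ℂ)) = - single j j 1 from (single_neg ..).symm,
    show (single i i (-1 : ℂ)) = - single i i 1 from (single_neg ..).symm,
    show (single i j (-1 : ℂ)) = - single i j 1 from (single_neg ..).symm]
  abel

section

variable (ι : Matrix κ κ ℂ →ₐ[ℂ] C) (σ : GL κ ℂ →* Cˣ)

/-- Conjugation by the torus scales the parameter of a transvection, so `peirce_of_scaling` applies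
with the idempotent `E_ii` for the left factor and `1 - E_jj` for the right one. -/
theorem transvection_sub_one_of_diagonal (hdiag : ∀ d, (σ (diagUnit d)).1 = ι (diagUnit d).1)
    {i j : κ} (h : i ≠ j) (a : ℂ) :
    ι (single i i 1) * ((σ (transvectionUnit h a)).1 - 1) = (σ (transvectionUnit h a)).1 - 1 ∧
      ((σ (transvectionUnit h a)).1 - 1) * ι (single j j 1) =
        (σ (transvectionUnit h a)).1 - 1 := by
  have hscale : ∀ d : κ → ℂˣ, (σ (transvectionUnit h (d i * a * (d j : ℂ)⁻¹))).1 =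
      ι (diagUnit d).1 * (σ (transvectionUnit h a)).1 * ι (diagUnit d⁻¹).1 := by
    intro d
    have : diagUnit d * transvectionUnit h a * diagUnit d⁻¹ =
        transvectionUnit h (d i * a * (d j : ℂ)⁻¹) := by
      rw [diagUnit_mul_transvectionUnit, mul_assoc, ← map_mul, mul_inv_cancel, map_one, mul_one]
    rw [← hdiag, ← hdiag, ← Units.val_mul, ← map_mul, ← Units.val_mul, ← map_mul, this]
  have hmul : ∀ x y : ℂ, (σ (transvectionUnit h x)).1 * (σ (transvectionUnit h y)).1 =
      (σ (transvectionUnit h (x + y))).1 := by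
    intro x y
    rw [transvectionUnit_add, map_mul, Units.val_mul]
  have hzero : (σ (transvectionUnit h 0)).1 = 1 := by
    have : transvectionUnit h 0 = 1 := Units.ext (by rw [coe_transvectionUnit]; simp)
    rw [this, map_one, Units.val_one]
  have hidem : ∀ k : κ, ι (single k k 1) * ι (single k k 1) = ι (single k k 1) := by
    intro k
    rw [← map_mul, single_mul_single_same, mul_one]
  constructor
  · refine (peirce_of_scaling (hidem i) (fun z => (σ (transvectionUnit h (z * a))).1) ?_ ?_ ?_
      ?_).1
    · intro z hz
      have := hscale (Pi.mulSingle i (Units.mk0 z hz))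
      rw [← Pi.mulSingle_inv, coe_diagUnit_mulSingle, coe_diagUnit_mulSingle,
        Pi.mulSingle_eq_same, Pi.mulSingle_eq_of_ne h.symm] at this
      simpa only [Units.val_one, inv_one, mul_one, Units.val_inv_eq_inv_val, Units.val_mk0, map_add,
        map_one, map_smul] using this
    · rw [hmul, two_mul]
    · rw [hmul]; congr 4; ring
    · rw [hmul, neg_one_mul, neg_add_cancel, hzero]
  · have hidem' : (1 - ι (single j j 1)) * (1 - ι (single j j 1)) = 1 - ι (single j j 1) := by
      rw [mul_sub, sub_mul, sub_mul, hidem]; simp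
    have := (peirce_of_scaling hidem' (fun z => (σ (transvectionUnit h (z * a))).1)
      (X := (σ (transvectionUnit h a)).1) ?_ ?_ ?_ ?_).2
    · simpa using this
    · intro z hz
      -- The parameter is divided by the `j`-th diagonal entry, so the entry `z⁻¹` produces
      -- multiplication by `z`.
      have := hscale (Pi.mulSingle j (Units.mk0 z hz)⁻¹)
      rw [← Pi.mulSingle_inv, coe_diagUnit_mulSingle, coe_diagUnit_mulSingle,
        Pi.mulSingle_eq_same, Pi.mulSingle_eq_of_ne h] at this
      simp only [Units.val_one, one_mul, Units.val_inv_eq_inv_val, Units.val_mk0, inv_inv, map_add,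
        map_one, map_smul] at this
      rw [mul_comm] at this
      -- Scaling by `z` on the complement of `E_jj` is scaling by `z⁻¹` on `E_jj` up to the central
      -- factor `z`, which cancels under conjugation.
      have e1 : (1 : C) + (z - 1) • (1 - ι (single j j 1)) =
          z • (1 + (z⁻¹ - 1) • ι (single j j 1)) := by
        rw [smul_add, smul_smul, mul_sub, mul_inv_cancel₀ hz]; module
      have e2 : (1 : C) + (z⁻¹ - 1) • (1 - ι (single j j 1)) =
          z⁻¹ • (1 + (z - 1) • ι (single j j 1)) := by
        rw [smul_add, smul_smul, mul_sub, inv_mul_cancel₀ hz]; module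
      rw [e1, e2, smul_mul_assoc, smul_mul_smul_comm, mul_inv_cancel₀ hz, one_smul]
      exact this
    · rw [hmul, two_mul]
    · rw [hmul]; congr 4; ring
    · rw [hmul, neg_one_mul, neg_add_cancel, hzero]

/-- A homomorphism from `GL_r(ℂ)` to the units of an algebra which agrees with an algebra
homomorphism on diagonal matrices and on the elements `weylUnit` agrees with it everywhere. -/
theorem eq_of_eq_diagonal_of_eq_weyl (hdiag : ∀ d, (σ (diagUnit d)).1 = ι (diagUnit d).1)
    (hweyl : ∀ {i j : κ} (h : i ≠ j), (σ (weylUnit h)).1 = ι (weylUnit h).1) (A : GL κ ℂ) :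
    (σ A).1 = ι A.1 := by
  have hone : ∀ {i j : κ} (h : i ≠ j),
      (σ (transvectionUnit h 1)).1 = ι (transvectionUnit h 1).1 := by
    intro i j h
    obtain ⟨q1, q2⟩ := transvection_sub_one_of_diagonal ι σ hdiag h 1
    obtain ⟨p1, p2⟩ := transvection_sub_one_of_diagonal ι σ hdiag h.symm (-1)
    have hw := hweyl h
    rw [weylUnit, map_mul, map_mul, Units.val_mul, Units.val_mul, ← weylUnit, coe_weylUnit] at hw
    set ei := ι (single i i 1)
    set ej := ι (single j j 1)
    -- Here `q` lies in `e_i C e_j` and `p` in `e_j C e_i`. The `(i, i)` block of `(1 + q) (1 + p)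
    -- (1 + q) = ι w` gives `q p = -e_i`, and the `(i, j)` block gives `2 q + q p q = ι E_ij`;
    -- together `q = ι E_ij`.
    obtain ⟨q, hq⟩ : ∃ q, q = (σ (transvectionUnit h 1)).1 - 1 := ⟨_, rfl⟩
    obtain ⟨p, hp⟩ : ∃ p, p = (σ (transvectionUnit h.symm (-1))).1 - 1 := ⟨_, rfl⟩
    rw [← hq] at q1 q2
    rw [← hp] at p1 p2
    have hq' : (σ (transvectionUnit h 1)).1 = 1 + q := by rw [hq]; abel
    have hp' : (σ (transvectionUnit h.symm (-1))).1 = 1 + p := by rw [hp]; abel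
    rw [hq', hp'] at hw
    have hij : ei * ej = 0 := by
      rw [← map_mul, single_mul_single_of_ne _ _ _ _ h, map_zero]
    have hji : ej * ei = 0 := by
      rw [← map_mul, single_mul_single_of_ne _ _ _ _ h.symm, map_zero]
    have hii : ei * ei = ei := by rw [← map_mul, single_mul_single_same, mul_one]
    have qei : q * ei = 0 := by rw [← q2, mul_assoc, hji, mul_zero]
    have eip : ei * p = 0 := by rw [← p1, ← mul_assoc, hij, zero_mul]
    have pej : p * ej = 0 := by rw [← p2, mul_assoc, hij, mul_zero]
    have qq : q * q = 0 := by
      nth_rw 2 [← q1]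
      rw [← mul_assoc, qei, zero_mul]
    have eip' : ∀ x, ei * (p * x) = 0 := fun x => by rw [← mul_assoc, eip, zero_mul]
    have q1' : ∀ x, ei * (q * x) = q * x := fun x => by rw [← mul_assoc, q1]
    have h1 : ei + q * p = 0 := by
      have := congrArg (fun M => ei * M * ei) hw
      simp only [mul_add, add_mul, mul_assoc, q1, q1', qei, eip, eip', qq, p2, mul_one,
        one_mul, mul_zero, add_zero, zero_add, hii] at this
      rw [this]
      simp only [ei, ← map_mul]
      simp [add_mul, sub_mul, h, h.symm]
    have h2 : q + q + q * p * q = ι (single i j 1) := by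
      have := congrArg (fun M => ei * M * ej) hw
      simp only [mul_add, add_mul, mul_assoc, q1, q1', q2, pej, eip, eip', qq, mul_one,
        one_mul, mul_zero, add_zero, zero_add, hij] at this
      rw [add_assoc, mul_assoc, this]
      simp only [ei, ej, ← map_mul]
      simp [add_mul, sub_mul, h]
    rw [hq', coe_transvectionUnit, map_add, map_one, ← h2, eq_neg_of_add_eq_zero_right h1, neg_mul,
      q1]
    abel
  have htrans : ∀ {i j : κ} (h : i ≠ j) (c : ℂ),
      (σ (transvectionUnit h c)).1 = ι (transvectionUnit h c).1 := by
    intro i j h c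
    by_cases hc : c = 0
    · subst hc
      have : transvectionUnit h 0 = 1 := Units.ext (by rw [coe_transvectionUnit]; simp)
      rw [this, map_one, Units.val_one, Units.val_one, map_one]
    -- A torus conjugation carries the transvection with parameter `1` to the one with any nonzero
    -- parameter `c`.
    · have h1 := diagUnit_mul_transvectionUnit h (Pi.mulSingle i (Units.mk0 c hc)) 1
      rw [Pi.mulSingle_eq_same, Pi.mulSingle_eq_of_ne h.symm, Units.val_mk0, Units.val_one, inv_one,
        mul_one, mul_one, ← mul_inv_eq_iff_eq_mul, ← map_inv] at h1
      rw [← h1, map_mul, map_mul, Units.val_mul, Units.val_mul, hdiag, hdiag, hone h, ← map_mul,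
        ← map_mul, ← Units.val_mul, ← Units.val_mul]
  suffices h : ∀ g : GL κ ℂ, g.1 = A.1 → (σ g).1 = ι A.1 from h A rfl
  refine diagonal_transvection_induction_of_det_ne_zero
    (fun M => ∀ g : GL κ ℂ, g.1 = M → (σ g).1 = ι M) A.1
    (A.1.isUnit_iff_isUnit_det.1 A.isUnit).ne_zero ?_ ?_ ?_
  · intro D hD g hg
    rw [det_diagonal, Finset.prod_ne_zero_iff] at hD
    have : g = diagUnit fun i => Units.mk0 (D i) (hD i (Finset.mem_univ i)) :=
      Units.ext (by rw [hg, coe_diagUnit]; rfl)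
    rw [← hg, this, hdiag]
  · intro t g hg
    have : g = transvectionUnit t.hij t.c := Units.ext (by rw [hg]; rfl)
    rw [← hg, this, htrans]
  · intro M N hM hN h1 h2 g hg
    obtain ⟨m, rfl⟩ := M.isUnit_iff_isUnit_det.2 (IsUnit.mk0 _ hM)
    obtain ⟨k, rfl⟩ := N.isUnit_iff_isUnit_det.2 (IsUnit.mk0 _ hN)
    have : g = m * k := Units.ext hg
    rw [this, map_mul, Units.val_mul, h1 m rfl, h2 k rfl, map_mul]

end

/-! ### Signed permutation matrices and rigidity of closed sections -/

/-- The finite group of integral orthogonal matrices, mapped to `GL_r(ℂ)`. -/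
def signedPerm : orthogonalGroup κ ℤ →* GL κ ℂ :=
  MonoidHom.toHomUnits
    ((Int.castRingHom ℂ).mapMatrix.toMonoidHom.comp (orthogonalGroup κ ℤ).subtype)

/-- Each row is an integer vector of norm one, so all entries lie between `-1` and `1`. -/
instance : Finite (orthogonalGroup κ ℤ) := by
  have hbd : ∀ A : orthogonalGroup κ ℤ, ∀ i j, A.1 i j ∈ Set.Icc (-1 : ℤ) 1 := by
    intro A i j
    have h1 := congrFun (congrFun ((mem_orthogonalGroup_iff κ ℤ).1 A.2) i) i
    rw [mul_apply, one_apply_eq] at h1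
    have h2 : A.1 i j * A.1 i j ≤ 1 := by
      rw [← h1]
      exact Finset.single_le_sum (f := fun k => A.1 i k * A.1 i k)
        (fun k _ => mul_self_nonneg _) (Finset.mem_univ j)
    exact ⟨by nlinarith, by nlinarith⟩
  refine Finite.of_injective
    (fun A : orthogonalGroup κ ℤ => fun i j => (⟨A.1 i j, hbd A i j⟩ : Set.Icc (-1 : ℤ) 1)) ?_
  intro A B h
  refine Subtype.ext (Matrix.ext fun i j => ?_)
  exact congrArg Subtype.val (congrFun (congrFun h i) j)

theorem exists_signedPerm_eq {A : GL κ ℂ} {B : Matrix κ κ ℤ} (hB : B * Bᵀ = 1)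
    (hA : A.1 = B.map (Int.castRingHom ℂ)) : ∃ f, signedPerm f = A :=
  ⟨⟨B, (mem_orthogonalGroup_iff κ ℤ).2 hB⟩, Units.ext hA.symm⟩

/-- The reflection `1 - 2 E_ii` puts `E_ii` in the span of `1` and a signed permutation matrix, so
commuting with its image amounts to commuting with `ι E_ii`. -/
theorem exists_signedPerm_eq_neg_one (i : κ) :
    ∃ f, signedPerm f = diagUnit (Pi.mulSingle i (-1)) := by
  refine exists_signedPerm_eq (B := 1 - (2 : ℤ) • single i i 1) ?_ ?_
  · rw [transpose_sub, transpose_one, transpose_smul, transpose_single]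
    simp only [mul_sub, sub_mul, mul_one, one_mul, mul_smul_comm, smul_mul_assoc,
      single_mul_single_same]
    module
  · rw [coe_diagUnit_mulSingle]
    ext k l
    simp [one_apply, single_apply, apply_ite (Int.cast : ℤ → ℂ)]
    split_ifs <;> norm_num

theorem exists_signedPerm_eq_weylUnit {i j : κ} (h : i ≠ j) : ∃ f, signedPerm f = weylUnit h := by
  refine exists_signedPerm_eq
    (B := 1 - single i i 1 - single j j 1 + single i j 1 - single j i 1) ?_ ?_
  · simp only [transpose_sub, transpose_add, transpose_one, transpose_single]
    simp only [mul_add, add_mul, mul_sub, sub_mul, mul_one, one_mul, single_mul_single_same,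
      single_mul_single_of_ne _ _ _ _ h, single_mul_single_of_ne _ _ _ _ h.symm]
    abel
  · rw [coe_weylUnit]
    ext k l
    simp [one_apply, single_apply, apply_ite (Int.cast : ℤ → ℂ)]

theorem infinite_roots_of_unity : {z : ℂ | ∃ N : ℕ, N ≠ 0 ∧ z ^ N = 1}.Infinite := by
  refine Set.infinite_of_injective_forall_mem
    (f := fun N : ℕ => Complex.exp (2 * Real.pi * Complex.I / (N + 1 : ℕ))) ?_ ?_
  · intro M N h
    have h1 := (Complex.isPrimitiveRoot_exp (M + 1) M.succ_ne_zero).eq_orderOf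
    have h2 := (Complex.isPrimitiveRoot_exp (N + 1) N.succ_ne_zero).eq_orderOf
    simp only at h
    rw [h, ← h2] at h1
    exact Nat.succ_injective h1
  · intro N
    exact ⟨N + 1, N.succ_ne_zero, (Complex.isPrimitiveRoot_exp (N + 1) N.succ_ne_zero).pow_eq_one⟩

variable (π : C →ₐ[ℂ] Matrix κ κ ℂ) (ι : Matrix κ κ ℂ →ₐ[ℂ] C)

/-- A section of the reduction modulo a nil ideal is algebraic if its image is closed and it is
standard on signed permutation matrices. -/
theorem section_eq_of_closed (hπι : ∀ A, π (ι A) = A) (hnil : ∀ x, π x = 0 → IsNilpotent x)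
    (σ : GL κ ℂ →* Cˣ) (hσ : ∀ A, π (σ A).1 = A.1)
    (hfin : ∀ f, (σ (signedPerm f)).1 = ι (signedPerm f).1)
    (hclosed : ∀ A B : C, {z : ℂ | ∃ g, (σ g).1 = A + z • B}.Infinite →
      ∀ (z : ℂ) (x : Cˣ), x.1 = A + z • B → ∃ g, σ g = x) (A : GL κ ℂ) :
    (σ A).1 = ι A.1 := by
  have htors : ∀ (i : κ) (z : ℂˣ) (N : ℕ), N ≠ 0 → z ^ N = 1 →
      σ (diagUnit (Pi.mulSingle i z)) = Units.map ι.toMonoidHom (diagUnit (Pi.mulSingle i z)) := by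
    intro i z N hN hz
    have hpow : diagUnit (Pi.mulSingle i z) ^ N = 1 := by
      rw [← map_pow, ← Pi.mulSingle_pow, hz, Pi.mulSingle_one, map_one]
    refine eq_of_pow_eq_one_of_isNilpotent_sub hN ?_ ?_ ?_ (hnil _ ?_)
    -- The image of the torus element commutes with that of the reflection, where `σ` and `ι` agree.
    -- So it commutes with `ι E_ii`, and hence with its own `ι`-image.
    · obtain ⟨f, hf⟩ := exists_signedPerm_eq_neg_one i
      have h1 : Commute (σ (diagUnit (Pi.mulSingle i z))) (σ (signedPerm f)) := by
        rw [hf]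
        exact ((Commute.all (Pi.mulSingle i z : κ → ℂˣ) _).map diagUnit).map σ
      have h2 : Commute (σ (diagUnit (Pi.mulSingle i z))).1 (ι (signedPerm f).1) := by
        rw [← hfin]
        exact h1.units_val
      rw [hf, coe_diagUnit_mulSingle, map_add, map_one, map_smul] at h2
      have h3 : Commute (σ (diagUnit (Pi.mulSingle i z))).1 (ι (single i i 1)) := by
        have := (h2.sub_right (Commute.one_right _)).smul_right (-1 / 2 : ℂ)
        rw [add_sub_cancel_left, smul_smul] at this
        norm_num at this
        exact this
      refine Commute.units_of_val ?_
      change Commute _ (ι (diagUnit (Pi.mulSingle i z)).1)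
      rw [coe_diagUnit_mulSingle, map_add, map_one, map_smul]
      exact (Commute.one_right _).add_right (h3.smul_right _)
    · rw [← map_pow, hpow, map_one]
    · rw [← map_pow, hpow, map_one]
    · rw [map_sub, hσ, sub_eq_zero]
      exact (hπι _).symm
  have hsingle : ∀ (i : κ) (z : ℂˣ),
      (σ (diagUnit (Pi.mulSingle i z))).1 = ι (diagUnit (Pi.mulSingle i z)).1 := by
    intro i z
    have hform : ∀ w : ℂˣ, ι (diagUnit (Pi.mulSingle i w)).1 =
        (1 - ι (single i i 1)) + (w : ℂ) • ι (single i i 1) := by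
      intro w
      rw [coe_diagUnit_mulSingle, map_add, map_one, map_smul]
      module
    -- The one-parameter torus is a line minus a point, and `σ` agrees with `ι` at all roots of
    -- unity on it. Closedness puts the remaining points in the image of `σ`, and `π` identifies
    -- their preimages.
    have hinf : {w : ℂ | ∃ g, (σ g).1 =
        (1 - ι (single i i 1)) + w • ι (single i i 1)}.Infinite := by
      refine infinite_roots_of_unity.mono ?_
      rintro w ⟨N, hN, hw⟩
      have hw0 : w ≠ 0 := by
        rintro rfl
        rw [zero_pow hN] at hw
        exact zero_ne_one hw
      refine ⟨diagUnit (Pi.mulSingle i (Units.mk0 w hw0)), ?_⟩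
      rw [htors i _ N hN (Units.ext (by simpa using hw))]
      exact hform (Units.mk0 w hw0)
    obtain ⟨g, hg⟩ := hclosed _ _ hinf z
      (Units.map ι.toMonoidHom (diagUnit (Pi.mulSingle i z))) (hform z)
    have : g = diagUnit (Pi.mulSingle i z) := by
      refine Units.ext ?_
      rw [← hσ, hg]
      exact hπι _
    rw [← this, hg, this]
    rfl
  refine eq_of_eq_diagonal_of_eq_weyl ι σ (fun d => ?_) (fun h => ?_) A
  · induction d using Pi.mulSingle_induction with
    | one => simp
    | mul d d' h h' => rw [map_mul, map_mul, Units.val_mul, h, h', Units.val_mul, map_mul]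
    | mulSingle i z => exact hsingle i z
  · obtain ⟨f, hf⟩ := exists_signedPerm_eq_weylUnit h
    rw [← hf, hfin]

/-- Two complements of the kernel of the reduction modulo a nil ideal, one of them the standard
one and the other one closed, are conjugate. -/
theorem exists_conj_of_closed_complement (hπι : ∀ A, π (ι A) = A)
    (hnil : ∀ x, π x = 0 → IsNilpotent x) (H : Subgroup Cˣ)
    (hinj : ∀ x ∈ H, π x.1 = 1 → x = 1) (hsurj : ∀ A : GL κ ℂ, ∃ x ∈ H, π x.1 = A.1)
    (hclosed : ∀ A B : C, {z : ℂ | ∃ x ∈ H, x.1 = A + z • B}.Infinite →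
      ∀ (z : ℂ) (x : Cˣ), x.1 = A + z • B → x ∈ H) :
    ∃ c : Cˣ, ∀ x : Cˣ, x ∈ H ↔ ∃ A : GL κ ℂ, x = c * Units.map ι.toMonoidHom A * c⁻¹ := by
  choose s hsH hs using hsurj
  have huniq : ∀ x ∈ H, ∀ y ∈ H, π x.1 = π y.1 → x = y := by
    intro x hx y hy h
    have := hinj (x * y⁻¹) (H.mul_mem hx (H.inv_mem hy)) (by
      rw [Units.val_mul, map_mul, h, ← map_mul, ← Units.val_mul, mul_inv_cancel, Units.val_one,
        map_one])
    exact mul_inv_eq_one.1 this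
  -- Lifts inside `H` are unique, so choosing them is automatically multiplicative.
  let σ : GL κ ℂ →* Cˣ := MonoidHom.mk' s fun A B =>
    huniq _ (hsH _) _ (H.mul_mem (hsH _) (hsH _)) (by
      rw [hs, Units.val_mul, Units.val_mul, map_mul, hs, hs])
  have hσ : ∀ A, π (σ A).1 = A.1 := hs
  obtain ⟨c, ⟨a, ha⟩, hc⟩ := exists_conj_of_finite π hnil (σ.comp signedPerm)
    ((Units.map ι.toMonoidHom).comp (signedPerm (κ := κ))) (fun f => by
      rw [MonoidHom.comp_apply, hσ]
      exact (hπι _).symm)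
  -- Conjugation by `c` makes the section standard on signed permutations. Since `π c` is scalar, it
  -- remains a section.
  let τ : GL κ ℂ →* Cˣ := (MulAut.conj c⁻¹).toMonoidHom.comp σ
  have hτ : ∀ g, τ g = c⁻¹ * σ g * c := fun g => by simp [τ]
  have hH : ∀ x ∈ H, ∃ g, σ g = x := fun x hx =>
    ⟨Units.map π.toMonoidHom x, huniq _ (hsH _) _ hx (hs _)⟩
  have hτι : ∀ A, (τ A).1 = ι A.1 := by
    refine section_eq_of_closed π ι hπι hnil τ (fun A => ?_) (fun f => ?_) fun A B hAB z x hx => ?_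
    · rw [hτ, Units.val_mul, Units.val_mul, map_mul, map_mul, hσ, mul_assoc, ha,
        ← Algebra.commutes, ← ha, ← mul_assoc, ← map_mul, ← Units.val_mul, inv_mul_cancel,
        Units.val_one, map_one, one_mul]
    · rw [hτ, mul_assoc, show σ (signedPerm f) * c = _ from hc f, inv_mul_cancel_left]
      rfl
    · have hmem : c * x * c⁻¹ ∈ H := by
        refine hclosed (c.1 * A * c⁻¹.1) (c.1 * B * c⁻¹.1) (hAB.mono ?_) z _ ?_
        · rintro w ⟨g, hg⟩
          refine ⟨σ g, hsH g, ?_⟩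
          have : σ g = c * τ g * c⁻¹ := by rw [hτ]; group
          rw [this, Units.val_mul, Units.val_mul, hg]
          simp only [mul_add, add_mul, mul_smul_comm, smul_mul_assoc]
        · rw [Units.val_mul, Units.val_mul, hx]
          simp only [mul_add, add_mul, mul_smul_comm, smul_mul_assoc]
      obtain ⟨g, hg⟩ := hH _ hmem
      refine ⟨g, ?_⟩
      rw [hτ, hg]
      group
  have hconj : ∀ A, σ A = c * Units.map ι.toMonoidHom A * c⁻¹ := by
    intro A
    have : Units.map ι.toMonoidHom A = τ A := Units.ext (hτι A).symm
    rw [this, hτ]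
    group
  refine ⟨c, fun x => ⟨fun hx => ?_, ?_⟩⟩
  · obtain ⟨g, rfl⟩ := hH x hx
    exact ⟨g, hconj g⟩
  · rintro ⟨A, rfl⟩
    rw [← hconj]
    exact hsH A

end Levi
end EllipticPGL

namespace EllipticPGL
open Matrix Matrix.ProjGenLinGroup

/-! ### Unipotent matrices and closed subsets -/

theorem trace_eq_card_of_isNilpotent_sub_one {κ : Type*} [Fintype κ] [DecidableEq κ]
    {M : Matrix κ κ ℂ} (h : IsNilpotent (M - 1)) : M.trace = Fintype.card κ := by
  have := (Matrix.isNilpotent_trace_of_isNilpotent h).eq_zero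
  rwa [trace_sub, trace_one, sub_eq_zero] at this

/-- The characteristic polynomial of the nilpotent matrix `1 - M` is a power of `X`; its value at
`1` is `det M`. -/
theorem det_eq_one_of_isNilpotent_sub_one {κ : Type*} [Fintype κ] [DecidableEq κ]
    {M : Matrix κ κ ℂ} (h : IsNilpotent (M - 1)) : M.det = 1 := by
  have h1 : IsNilpotent (1 - M) := by rw [← neg_sub]; exact h.neg
  have h2 := (Matrix.isNilpotent_charpoly_sub_pow_of_isNilpotent h1).eq_zero
  rw [sub_eq_zero] at h2
  have h3 := Matrix.eval_charpoly (1 - M) 1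
  rw [h2] at h3
  simpa using h3.symm

/-- A subspace is cut out by the linear forms that annihilate it. -/
theorem isZariskiClosed_of_submodule {n : ℕ} {S : Set PGL(n, ℂ)}
    (W : Submodule ℂ (Matrix (Fin n) (Fin n) ℂ)) (h : ∀ g : GL (Fin n) ℂ, mk g ∈ S ↔ g.1 ∈ W) :
    IsZariskiClosed S := by
  let poly : Module.Dual ℂ (Matrix (Fin n) (Fin n) ℂ) → MvPolynomial (Fin n × Fin n) ℂ := fun f =>
    ∑ i, ∑ j, MvPolynomial.C (f (single i j 1)) * MvPolynomial.X (i, j)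
  have hpoly : ∀ f (M : Matrix (Fin n) (Fin n) ℂ),
      MvPolynomial.eval (fun ij : Fin n × Fin n => M ij.1 ij.2) (poly f) = f M := by
    intro f M
    conv_rhs => rw [matrix_eq_sum_single M]
    simp only [poly, map_sum, map_mul, MvPolynomial.eval_C, MvPolynomial.eval_X]
    refine Finset.sum_congr rfl fun i _ => Finset.sum_congr rfl fun j _ => ?_
    rw [show single i j (M i j) = M i j • single i j (1 : ℂ) by simp, map_smul, smul_eq_mul,
      mul_comm]
  refine ⟨poly '' W.dualAnnihilator, fun g => ?_⟩
  rw [h, Set.forall_mem_image, ← Subspace.forall_mem_dualAnnihilator_apply_eq_zero_iff W]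
  simp only [hpoly]
  rfl

/-- A line of matrices which meets a closed set in infinitely many points lies in it. -/
theorem IsZariskiClosed.mem_of_infinite {n : ℕ} {S : Set PGL(n, ℂ)} (hS : IsZariskiClosed S)
    {A B : Matrix (Fin n) (Fin n) ℂ}
    (hinf : {z : ℂ | ∃ g : GL (Fin n) ℂ, mk g ∈ S ∧ g.1 = A + z • B}.Infinite)
    {g : GL (Fin n) ℂ} {z : ℂ} (hg : g.1 = A + z • B) : mk g ∈ S := by
  obtain ⟨I, hI⟩ := hS
  rw [hI]
  intro p hp
  -- The restriction of `p` to the line, a polynomial in one variable with infinitely many roots.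
  let q : Polynomial ℂ := MvPolynomial.aeval
    (fun ij : Fin n × Fin n =>
      Polynomial.C (A ij.1 ij.2) + Polynomial.X * Polynomial.C (B ij.1 ij.2))
    p
  have hq : ∀ w : ℂ, q.eval w =
      MvPolynomial.eval (fun ij : Fin n × Fin n => (A + w • B) ij.1 ij.2) p := by
    intro w
    clear hp
    induction p using MvPolynomial.induction_on with
    | C c => simp [q]
    | add p₁ p₂ h₁ h₂ => simp only [q, map_add, Polynomial.eval_add] at *; rw [h₁, h₂]
    | mul_X p ij h =>
      simp only [q, map_mul, Polynomial.eval_mul] at *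
      rw [h]
      simp only [MvPolynomial.aeval_X, MvPolynomial.eval_X, Polynomial.eval_add, Polynomial.eval_C,
        Polynomial.eval_mul, Polynomial.eval_X, Matrix.add_apply, Matrix.smul_apply, smul_eq_mul]
  have hq0 : q = 0 := by
    refine Polynomial.eq_zero_of_infinite_isRoot q (hinf.mono ?_)
    rintro w ⟨g', hg', hw⟩
    have := (hI g').1 hg' p hp
    rw [Set.mem_ofPred_eq, Polynomial.IsRoot, hq, ← hw]
    exact this
  rw [hg, ← hq, hq0, Polynomial.eval_zero]

/-! ### Reductive parts of centralizers -/

section Levi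

/-- The block diagonal matrices, for the blocks given by the fibres of `a`. -/
def blockSub {κ : Type*} [Fintype κ] [DecidableEq κ] (a : κ → ℕ) : Subalgebra ℂ (Matrix κ κ ℂ) where
  carrier := {M | ∀ j l, a j ≠ a l → M j l = 0}
  mul_mem' {M N} hM hN j l h := by
    rw [mul_apply]
    refine Finset.sum_eq_zero fun k _ => ?_
    by_cases hk : a j = a k
    · rw [hN k l (hk ▸ h), mul_zero]
    · rw [hM j k hk, zero_mul]
  add_mem' {M N} hM hN j l h := by rw [Matrix.add_apply, hM j l h, hN j l h, add_zero]
  algebraMap_mem' c j l h := by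
    rw [algebraMap_matrix_apply, if_neg fun e => h (congrArg a e)]

/-- A presentation of the centralizer of `g` in the algebra of matrices as a split extension of
the algebra of block diagonal matrices by a nil ideal. -/
structure LeviDatum {n : ℕ} (g : GL (Fin n) ℂ) {κ : Type*} [Fintype κ] [DecidableEq κ]
    (a : κ → ℕ) where
  ofSplit ::
  /-- The reduction modulo the nil ideal. -/
  red : Subalgebra.centralizer ℂ {g.1} →ₐ[ℂ] blockSub a
  /-- The splitting. -/
  emb : blockSub a →ₐ[ℂ] Subalgebra.centralizer ℂ {g.1}
  red_emb : ∀ b, red (emb b) = b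
  isNilpotent_of_red : ∀ x, red x = 0 → IsNilpotent x

variable {n : ℕ} {g : GL (Fin n) ℂ}

/-- The map from the invertible matrices commuting with `g` to `PGL_n(ℂ)`. -/
def centralizerToPGL (g : GL (Fin n) ℂ) : (Subalgebra.centralizer ℂ {g.1})ˣ →* PGL(n, ℂ) :=
  mk.comp (Units.map (Subalgebra.centralizer ℂ {g.1}).val.toMonoidHom)

theorem exists_unit_centralizer {x : GL (Fin n) ℂ} (hx : x.1 ∈ Subalgebra.centralizer ℂ {g.1}) :
    ∃ y : (Subalgebra.centralizer ℂ {g.1})ˣ, y.1.1 = x.1 ∧ centralizerToPGL g y = mk x := by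
  have hx' : x⁻¹.1 ∈ Subalgebra.centralizer ℂ {g.1} := by
    rw [Subalgebra.mem_centralizer_iff] at hx ⊢
    intro y hy
    exact (Commute.units_inv_right (hx y hy : Commute y x.1)).eq
  refine ⟨⟨⟨x.1, hx⟩, ⟨x⁻¹.1, hx'⟩, ?_, ?_⟩, rfl, ?_⟩
  · exact Subtype.ext (by simp)
  · exact Subtype.ext (by simp)
  · exact congrArg mk (Units.ext rfl)

theorem centralizerToPGL_eq_iff {x y : (Subalgebra.centralizer ℂ {g.1})ˣ} :
    centralizerToPGL g x = centralizerToPGL g y ↔ ∃ c : ℂˣ, y.1 = (c : ℂ) • x.1 := by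
  rw [centralizerToPGL, MonoidHom.comp_apply, MonoidHom.comp_apply, mk_eq_mk_iff_smul]
  refine exists_congr fun c => ?_
  rw [Subtype.ext_iff]
  rfl

/-- The commutator scalar is `1`: conjugating `g` by `x` gives `c g`, and the trace `n` of a
unipotent matrix is nonzero. Thus centralizing in `PGL_n` means commuting as matrices. -/
theorem mem_centralizer_of_commute_mk (hn : 0 < n) (hg : IsNilpotent (g.1 - 1)) {x : GL (Fin n) ℂ}
    (h : mk g * mk x = mk x * mk g) : x.1 ∈ Subalgebra.centralizer ℂ {g.1} := by
  obtain ⟨c, hc⟩ := commute_mk_iff.1 h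
  have h1 : x⁻¹.1 * (g.1 * x.1) = (c : ℂ) • g.1 := by
    rw [hc, mul_smul_comm, ← mul_assoc, ← Units.val_mul, inv_mul_cancel, Units.val_one, one_mul]
  have h2 := congrArg trace h1
  rw [trace_mul_comm, mul_assoc, ← Units.val_mul x, mul_inv_cancel, Units.val_one, mul_one,
    trace_smul, trace_eq_card_of_isNilpotent_sub_one hg, Fintype.card_fin, smul_eq_mul] at h2
  have hc1 : (c : ℂ) = 1 :=
    (mul_right_cancel₀ (b := (n : ℂ)) (by exact_mod_cast hn.ne') (by rw [← h2, one_mul]))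
  rw [hc1, one_smul] at hc
  rw [Subalgebra.mem_centralizer_iff]
  rintro y rfl
  exact hc

theorem range_centralizerToPGL (hn : 0 < n) (hg : IsNilpotent (g.1 - 1)) :
    (centralizerToPGL g).range = Subgroup.centralizer {mk g} := by
  ext y
  rw [Subgroup.mem_centralizer_singleton_iff]
  constructor
  · rintro ⟨x, rfl⟩
    rw [centralizerToPGL, MonoidHom.comp_apply, ← map_mul, ← map_mul]
    congr 1
    refine Units.ext ?_
    exact ((Subalgebra.mem_centralizer_iff ℂ).1 x.1.2 g.1 rfl).symm
  · intro h
    obtain ⟨x, rfl⟩ := mk_surjective y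
    obtain ⟨z, -, hz⟩ := exists_unit_centralizer (mem_centralizer_of_commute_mk hn hg h.symm)
    exact ⟨z, hz⟩

variable {κ : Type*} [Fintype κ] [DecidableEq κ] {a : κ → ℕ} (L : LeviDatum g a)

namespace LeviDatum

/-- The invertible matrices commuting with `g` whose reduction is scalar. -/
def scalarRed : Subgroup (Subalgebra.centralizer ℂ {g.1})ˣ :=
  (Units.map (algebraMap ℂ (blockSub a)).toMonoidHom).range.comap (Units.map L.red.toMonoidHom)

theorem mem_scalarRed {x : (Subalgebra.centralizer ℂ {g.1})ˣ} :
    x ∈ L.scalarRed ↔ ∃ c : ℂˣ, L.red x.1 = algebraMap ℂ _ (c : ℂ) := by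
  refine exists_congr fun c => ?_
  rw [Units.ext_iff, eq_comm]
  rfl

/-- The unipotent radical of the centralizer. -/
def radical : Subgroup PGL(n, ℂ) := L.scalarRed.map (centralizerToPGL g)

/-- The standard reductive part of the centralizer. -/
def levi : Subgroup PGL(n, ℂ) :=
  (Units.map L.emb.toMonoidHom).range.map (centralizerToPGL g)

/-- `scalarRed` already contains the scalars, so membership can be tested on any lift. -/
theorem centralizerToPGL_mem_radical {x : (Subalgebra.centralizer ℂ {g.1})ˣ} :
    centralizerToPGL g x ∈ L.radical ↔ x ∈ L.scalarRed := by
  refine ⟨?_, fun h => ⟨x, h, rfl⟩⟩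
  rintro ⟨y, hy, hyx⟩
  obtain ⟨c, hc⟩ := centralizerToPGL_eq_iff.1 hyx
  obtain ⟨d, hd⟩ := L.mem_scalarRed.1 hy
  refine L.mem_scalarRed.2 ⟨c * d, ?_⟩
  rw [hc, map_smul, hd, Units.val_mul, map_mul, Algebra.smul_def]

theorem centralizerToPGL_mem_levi {x : (Subalgebra.centralizer ℂ {g.1})ˣ} :
    centralizerToPGL g x ∈ L.levi ↔ x.1 ∈ L.emb.range := by
  constructor
  · rintro ⟨_, ⟨b, rfl⟩, hyx⟩
    obtain ⟨c, hc⟩ := centralizerToPGL_eq_iff.1 hyx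
    rw [hc]
    exact L.emb.range.smul_mem ⟨b.1, rfl⟩ _
  · rintro ⟨b, hb⟩
    have : L.emb (L.red x.1) = x.1 := by rw [← hb]; exact congrArg L.emb (L.red_emb b)
    exact ⟨x, ⟨Units.map L.red.toMonoidHom x, Units.ext this⟩, rfl⟩

theorem radical_le (hn : 0 < n) (hg : IsNilpotent (g.1 - 1)) :
    L.radical ≤ Subgroup.centralizer {mk g} := by
  rw [← range_centralizerToPGL hn hg]
  exact Subgroup.map_le_range _ _

theorem levi_le (hn : 0 < n) (hg : IsNilpotent (g.1 - 1)) :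
    L.levi ≤ Subgroup.centralizer {mk g} := by
  rw [← range_centralizerToPGL hn hg]
  exact Subgroup.map_le_range _ _

theorem conj_mem_radical (hn : 0 < n) (hg : IsNilpotent (g.1 - 1)) {z r : PGL(n, ℂ)}
    (hz : z ∈ Subgroup.centralizer {mk g}) (hr : r ∈ L.radical) : z * r * z⁻¹ ∈ L.radical := by
  rw [← range_centralizerToPGL hn hg] at hz
  obtain ⟨x, rfl⟩ := hz
  obtain ⟨y, hy, rfl⟩ := hr
  rw [← map_inv, ← map_mul, ← map_mul, L.centralizerToPGL_mem_radical, mem_scalarRed]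
  obtain ⟨c, hc⟩ := L.mem_scalarRed.1 hy
  refine ⟨c, ?_⟩
  rw [Units.val_mul, Units.val_mul, map_mul, map_mul, hc, ← Algebra.commutes, mul_assoc, ← map_mul,
    ← Units.val_mul, mul_inv_cancel, Units.val_one, map_one, mul_one]

theorem isUnipotentElt_of_mem_radical {y : PGL(n, ℂ)} (hy : y ∈ L.radical) : IsUnipotentElt y := by
  obtain ⟨x, hx, rfl⟩ := hy
  obtain ⟨c, hc⟩ := L.mem_scalarRed.1 hx
  obtain ⟨h, hh, hmk⟩ := exists_lift_smul
    (Units.map (Subalgebra.centralizer ℂ {g.1}).val.toMonoidHom x) c⁻¹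
  refine ⟨h, hmk, ?_⟩
  have hnil := L.isNilpotent_of_red (((c⁻¹ : ℂˣ) : ℂ) • x.1 - 1) (by
    rw [map_sub, map_smul, hc, map_one, Algebra.algebraMap_eq_smul_one, smul_smul, ← Units.val_mul,
      inv_mul_cancel, Units.val_one, one_smul, sub_self])
  have := hnil.map (Subalgebra.centralizer ℂ {g.1}).val
  rw [hh]
  exact this

theorem isZariskiClosed_radical (hn : 0 < n) (hg : IsNilpotent (g.1 - 1)) :
    IsZariskiClosed (L.radical : Set PGL(n, ℂ)) := by
  refine isZariskiClosed_of_submodule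
    (((Subalgebra.toSubmodule (⊥ : Subalgebra ℂ (blockSub a))).comap L.red.toLinearMap).map
      (Subalgebra.centralizer ℂ {g.1}).val.toLinearMap) fun x => ?_
  constructor
  · intro hx
    have hx' := L.radical_le hn hg hx
    rw [Subgroup.mem_centralizer_singleton_iff] at hx'
    obtain ⟨z, hz1, hz2⟩ := exists_unit_centralizer (mem_centralizer_of_commute_mk hn hg hx'.symm)
    rw [← hz2, SetLike.mem_coe, centralizerToPGL_mem_radical, mem_scalarRed] at hx
    obtain ⟨c, hc⟩ := hx
    refine ⟨z.1, ?_, hz1⟩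
    exact Algebra.mem_bot.2 ⟨c, hc.symm⟩
  · rintro ⟨y, hy, hyx⟩
    obtain ⟨z, hz1, hz2⟩ := exists_unit_centralizer (x := x) (g := g) (hyx ▸ y.2)
    have hzy : z.1 = y := Subtype.ext (hz1.trans hyx.symm)
    obtain ⟨c, hc⟩ := Algebra.mem_bot.1 hy
    rw [← hz2, SetLike.mem_coe, centralizerToPGL_mem_radical, mem_scalarRed, hzy]
    -- The value `c = 0` can occur for a unit only if the reduced algebra is trivial, and then `1`
    -- serves as the scalar.
    by_cases hc0 : c = 0
    · have h0 : L.red y = 0 := by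
        rw [hc0, map_zero] at hc
        exact hc.symm
      have hunit : IsUnit (L.red y) := hzy ▸ z.isUnit.map L.red
      rw [h0, isUnit_zero_iff] at hunit
      exact ⟨1, by rw [h0, hunit, Units.val_one, map_one]⟩
    · exact ⟨Units.mk0 c hc0, hc.symm⟩

end LeviDatum

end Levi

end EllipticPGL

namespace EllipticPGL
open Matrix Matrix.ProjGenLinGroup
section Levi
variable {n : ℕ} {g : GL (Fin n) ℂ}
variable {κ : Type*} [Fintype κ] [DecidableEq κ] {a : κ → ℕ} (L : LeviDatum g a)

namespace LeviDatum

theorem isZariskiClosed_levi (hn : 0 < n) (hg : IsNilpotent (g.1 - 1)) :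
    IsZariskiClosed (L.levi : Set PGL(n, ℂ)) := by
  refine isZariskiClosed_of_submodule
    ((Subalgebra.toSubmodule L.emb.range).map
      (Subalgebra.centralizer ℂ {g.1}).val.toLinearMap) fun x => ?_
  constructor
  · intro hx
    have hx' := L.levi_le hn hg hx
    rw [Subgroup.mem_centralizer_singleton_iff] at hx'
    obtain ⟨z, hz1, hz2⟩ := exists_unit_centralizer (mem_centralizer_of_commute_mk hn hg hx'.symm)
    rw [← hz2, SetLike.mem_coe, centralizerToPGL_mem_levi] at hx
    exact ⟨z.1, hx, hz1⟩
  · rintro ⟨y, hy, hyx⟩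
    obtain ⟨z, hz1, hz2⟩ := exists_unit_centralizer (x := x) (g := g) (hyx ▸ y.2)
    have hzy : z.1 = y := Subtype.ext (hz1.trans hyx.symm)
    rw [← hz2, SetLike.mem_coe, centralizerToPGL_mem_levi, hzy]
    exact hy

/-- An element in the image of the splitting is recovered from its reduction; a scalar reduction
makes it scalar. -/
theorem levi_inf_radical : L.levi ⊓ L.radical = ⊥ := by
  rw [eq_bot_iff]
  rintro _ ⟨⟨_, ⟨b, rfl⟩, rfl⟩, hr⟩
  replace hr := L.mem_scalarRed.1 (L.centralizerToPGL_mem_radical.1 hr)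
  obtain ⟨c, hc⟩ := hr
  have hb : b.1 = algebraMap ℂ _ (c : ℂ) := (L.red_emb b.1).symm.trans hc
  rw [Subgroup.mem_bot, ← map_one (centralizerToPGL g), eq_comm, centralizerToPGL_eq_iff]
  refine ⟨c, ?_⟩
  rw [Units.val_one, ← Algebra.algebraMap_eq_smul_one]
  exact (congrArg L.emb hb).trans (AlgHom.commutes _ _)

/-- Write `x = y * (y⁻¹ * x)` with `y` the split lift of the reduction of `x`; the second factor
reduces to `1`. -/
theorem levi_sup_radical (hn : 0 < n) (hg : IsNilpotent (g.1 - 1)) :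
    L.levi ⊔ L.radical = Subgroup.centralizer {mk g} := by
  refine le_antisymm (sup_le (L.levi_le hn hg) (L.radical_le hn hg)) ?_
  rw [← range_centralizerToPGL hn hg]
  rintro _ ⟨x, rfl⟩
  set y := Units.map L.emb.toMonoidHom (Units.map L.red.toMonoidHom x) with hy
  rw [← mul_inv_cancel_left y x, map_mul]
  refine Subgroup.mul_mem_sup ⟨y, ⟨_, rfl⟩, rfl⟩ ?_
  rw [centralizerToPGL_mem_radical, mem_scalarRed]
  refine ⟨1, ?_⟩
  have : L.red x.1 = L.red y.1 := (L.red_emb _).symm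
  rw [Units.val_mul, map_mul, this, ← map_mul, ← Units.val_mul, inv_mul_cancel, Units.val_one,
    Units.val_one, map_one, map_one]

end LeviDatum

/-! ### Maximality of the unipotent radical -/

/-- If the traces of `b h b h⁻¹`, for the transvections `h` in the direction `E_jl`, are
multiples of the size by roots of unity of bounded order, then the entry `b_lj` vanishes. -/
theorem entry_eq_zero_of_trace (hn : n ≠ 0) {b : Matrix κ κ ℂ} {j l : κ}
    (h : ∀ s : ℂ, ∃ c : ℂ, c ^ n = 1 ∧
      (b * (1 + single j l s) * b * (1 + single j l (-s))).trace = c * Fintype.card κ) :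
    b l j = 0 := by
  by_contra hb
  -- The trace in question is `tr (b * b) - s ^ 2 * b_lj ^ 2`. This `s` makes it twice the size, so
  -- `c = 2`, which is not a root of unity.
  obtain ⟨s, hs⟩ := IsAlgClosed.exists_pow_nat_eq
    (((b * b).trace - 2 * Fintype.card κ) / (b l j) ^ 2) (n := 2) (by norm_num)
  obtain ⟨c, hc, htr⟩ := h s
  have e1 : single j l s = s • single j l (1 : ℂ) := by rw [smul_single, smul_eq_mul, mul_one]
  have e2 : single j l (-s) = (-s) • single j l (1 : ℂ) := by rw [smul_single, smul_eq_mul, mul_one]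
  have e3 : (b * single j l 1 * b).trace = (b * b * single j l 1).trace := by
    rw [trace_mul_comm, ← mul_assoc]
  have e4 : (b * single j l 1 * b * single j l 1).trace = b l j ^ 2 := by
    have : single j l (1 : ℂ) * b * single j l 1 = b l j • single j l 1 := by
      rw [single_mul_mul_single, smul_single]
      simp
    rw [mul_assoc b, mul_assoc b, this, mul_smul_comm, trace_smul, trace_mul_single]
    simp [sq]
  have : (b * b).trace - s ^ 2 * b l j ^ 2 = c * Fintype.card κ := by
    rw [← htr, e1, e2]
    simp only [mul_add, add_mul, mul_one, mul_smul_comm, smul_mul_assoc, trace_add, trace_smul, e3,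
      e4, smul_eq_mul]
    ring
  rw [hs, div_mul_cancel₀ _ (pow_ne_zero 2 hb), sub_sub_cancel] at this
  have hcard : (Fintype.card κ : ℂ) ≠ 0 := by
    exact_mod_cast (Fintype.card_pos_iff.2 ⟨j⟩).ne'
  rw [← mul_right_cancel₀ hcard this] at hc
  have : (2 : ℕ) ^ n = 1 := by exact_mod_cast hc
  exact absurd this (Nat.one_lt_two_pow hn).ne'

namespace LeviDatum

/-- For a unipotent representative `z` of an element of `U` and a transvection `e` in the standard
part, normality puts `z * (e * z * e⁻¹)` in `U`, so it is unipotent up to a scalar; determinants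
make the scalar an `n`-th root of unity. The trace criterion then kills the off-diagonal entries of
the reduction of `z`, and a diagonal unipotent matrix is `1`. -/
theorem le_radical_of_normal (hn : 0 < n) (hg : IsNilpotent (g.1 - 1)) {U : Subgroup PGL(n, ℂ)}
    (hU : U ≤ Subgroup.centralizer {mk g})
    (hnormal : (U.subgroupOf (Subgroup.centralizer {mk g})).Normal)
    (hunip : ∀ x ∈ U, IsUnipotentElt x) : U ≤ L.radical := by
  intro y hy
  obtain ⟨x, rfl, hx⟩ := hunip y hy
  have hxmem := hU hy
  rw [Subgroup.mem_centralizer_singleton_iff] at hxmem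
  obtain ⟨z, hz1, hz2⟩ := exists_unit_centralizer (mem_centralizer_of_commute_mk hn hg hxmem.symm)
  have hred : ∀ w : (Subalgebra.centralizer ℂ {g.1})ˣ, IsNilpotent (w.1.1 - 1) →
      IsNilpotent ((L.red w.1).1 - 1) := by
    intro w hw
    have h1 : IsNilpotent (w.1 - 1) := by
      obtain ⟨k, hk⟩ := hw
      exact ⟨k, Subtype.ext (by simpa using hk)⟩
    have := (h1.map L.red).map (blockSub a).val
    simpa using this
  have hz : IsNilpotent (z.1.1 - 1) := hz1 ▸ hx
  have hoff : ∀ j l, j ≠ l → (L.red z.1).1 l j = 0 := by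
    intro j l hjl
    by_cases ha : a l = a j
    swap
    · exact (L.red z.1).2 l j ha
    refine entry_eq_zero_of_trace hn.ne' (b := (L.red z.1).1) fun s => ?_
    have hmem : ∀ t : ℂ, 1 + single j l t ∈ blockSub a := by
      intro t
      refine (blockSub a).add_mem (blockSub a).one_mem fun p q hpq => ?_
      have : ¬ (j = p ∧ l = q) := by
        rintro ⟨rfl, rfl⟩
        exact hpq ha.symm
      simp [this]
    have hmul : ∀ t : ℂ, (1 + single j l t) * (1 + single j l (-t)) = (1 : Matrix κ κ ℂ) := by
      intro t
      exact (transvection_mul_transvection_same _ _ hjl t (-t)).trans (by simp)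
    let h : (blockSub a)ˣ := ⟨⟨_, hmem s⟩, ⟨_, hmem (-s)⟩, Subtype.ext (hmul s),
      Subtype.ext (by simpa using hmul (-s))⟩
    set e := Units.map L.emb.toMonoidHom h with he
    have hU' : mk x * (centralizerToPGL g e * mk x * (centralizerToPGL g e)⁻¹) ∈ U := by
      refine U.mul_mem hy ?_
      have hmemZ : centralizerToPGL g e ∈ Subgroup.centralizer {mk g} := by
        rw [← range_centralizerToPGL hn hg]
        exact ⟨e, rfl⟩
      exact hnormal.conj_mem ⟨mk x, hU hy⟩ hy ⟨_, hmemZ⟩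
    obtain ⟨v, hv, hvnil⟩ := hunip _ hU'
    rw [← hz2, ← map_inv, ← map_mul, ← map_mul, ← map_mul] at hv
    obtain ⟨c, hc⟩ := mk_eq_mk_iff_smul.1 hv
    have hc' : (z * (e * z * e⁻¹)).1.1 = (c : ℂ) • v.1 := hc
    refine ⟨c, ?_, ?_⟩
    · have := congrArg det hc'
      rw [det_smul, det_eq_one_of_isNilpotent_sub_one hvnil, Fintype.card_fin, mul_one] at this
      rw [← this]
      have h1 : det z.1.1 = 1 := det_eq_one_of_isNilpotent_sub_one hz
      have h2 : det e.1.1 * det (e⁻¹).1.1 = 1 := by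
        rw [← det_mul]
        have : e.1.1 * (e⁻¹).1.1 = 1 := congrArg Subtype.val e.mul_inv
        rw [this, det_one]
      change det (z.1.1 * (e.1.1 * z.1.1 * (e⁻¹).1.1)) = 1
      rw [det_mul, det_mul, det_mul, h1, one_mul, mul_one, h2]
    · have hvmem : v.1 ∈ Subalgebra.centralizer ℂ {g.1} := by
        have : v.1 = ((c⁻¹ : ℂˣ) : ℂ) • (z * (e * z * e⁻¹)).1.1 := by
          rw [hc', smul_smul, ← Units.val_mul, inv_mul_cancel, Units.val_one, one_smul]
        rw [this]
        exact Subalgebra.smul_mem _ (z * (e * z * e⁻¹)).1.2 _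
      obtain ⟨v', hv', -⟩ := exists_unit_centralizer hvmem
      have h1 : (z * (e * z * e⁻¹)).1 = (c : ℂ) • v'.1 := Subtype.ext (by rw [hc', ← hv']; rfl)
      have h2 := congrArg (fun w => (L.red w).1) h1
      have h3 : L.red e.1 = h.1 := L.red_emb _
      have h4 : L.red (e⁻¹).1 = (h⁻¹).1 := L.red_emb _
      simp only [Units.val_mul, map_mul, map_smul, h3, h4] at h2
      have h5 := congrArg trace h2
      have h6 : trace ((c : ℂ) • (L.red v'.1).1) = c * Fintype.card κ := by
        rw [trace_smul, trace_eq_card_of_isNilpotent_sub_one (hred v' (hv' ▸ hvnil)), smul_eq_mul]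
      rw [← h6]
      refine Eq.trans ?_ h5
      simp only [mul_assoc]
      rfl
  have hdiag : L.red z.1 = 1 := by
    have h1 : (L.red z.1).1 - 1 = diagonal fun j => (L.red z.1).1 j j - 1 := by
      ext p q
      by_cases hpq : p = q
      · subst hpq; simp
      · simp [hpq, hoff q p (Ne.symm hpq)]
    obtain ⟨k, hk⟩ := hred z hz
    refine Subtype.ext (sub_eq_zero.1 ?_)
    rw [h1, diagonal_pow] at hk
    rw [OneMemClass.coe_one, h1]
    ext p q
    by_cases hpq : p = q
    · subst hpq
      have := congrFun (congrFun hk p) p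
      simp only [diagonal_apply_eq, Pi.pow_apply, Matrix.zero_apply] at this ⊢
      exact IsReduced.eq_zero _ ⟨k, this⟩
    · simp [hpq]
  rw [← hz2, centralizerToPGL_mem_radical, mem_scalarRed]
  exact ⟨1, by rw [hdiag, Units.val_one, map_one]⟩

theorem isUnipotentRadical_radical (hn : 0 < n) (hg : IsNilpotent (g.1 - 1)) :
    IsUnipotentRadical (Subgroup.centralizer {mk g}) L.radical := by
  refine ⟨⟨L.radical_le hn hg, ⟨fun r hr z => ?_⟩, L.isZariskiClosed_radical hn hg,
    fun x hx => L.isUnipotentElt_of_mem_radical hx⟩, fun U hU => ?_⟩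
  · exact L.conj_mem_radical hn hg z.2 hr
  · exact L.le_radical_of_normal hn hg hU.1 hU.2.1 hU.2.2.2

theorem isReductivePart_levi (hn : 0 < n) (hg : IsNilpotent (g.1 - 1)) :
    IsReductivePart (mk g) L.levi :=
  ⟨L.isZariskiClosed_levi hn hg, L.radical, L.isUnipotentRadical_radical hn hg,
    L.levi_inf_radical, L.levi_sup_radical hn hg⟩

end LeviDatum
end Levi
end EllipticPGL

namespace EllipticPGL
open Matrix Matrix.ProjGenLinGroup
section Levi
variable {n : ℕ} {g : GL (Fin n) ℂ}

namespace LeviDatum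

/-! ### Arbitrary reductive parts -/

section
variable {κ : Type*} [Fintype κ] [DecidableEq κ] {a : κ → ℕ} (L : LeviDatum g a)

theorem inf_sup_of_isReductivePart (hn : 0 < n) (hg : IsNilpotent (g.1 - 1))
    {Γ : Subgroup PGL(n, ℂ)} (hΓ : IsReductivePart (mk g) Γ) :
    Γ ⊓ L.radical = ⊥ ∧ Γ ⊔ L.radical = Subgroup.centralizer {mk g} := by
  obtain ⟨-, R, hR, h1, h2⟩ := hΓ
  rw [IsGreatest.unique (L.isUnipotentRadical_radical hn hg) hR]
  exact ⟨h1, h2⟩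

/-- Every element of the centralizer of `u` is the product of an element of the reductive part and
one of the unipotent radical. -/
theorem exists_mul_of_isReductivePart (hn : 0 < n) (hg : IsNilpotent (g.1 - 1))
    {Γ : Subgroup PGL(n, ℂ)} (hΓ : IsReductivePart (mk g) Γ) {z : PGL(n, ℂ)}
    (hz : z ∈ Subgroup.centralizer {mk g}) : ∃ γ ∈ Γ, ∃ ρ ∈ L.radical, γ * ρ = z := by
  obtain ⟨-, hsup⟩ := L.inf_sup_of_isReductivePart hn hg hΓ
  have hle : Γ ≤ Subgroup.centralizer {mk g} := hsup ▸ le_sup_left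
  rw [← hsup, Subgroup.sup_eq_closure] at hz
  induction hz using Subgroup.closure_induction with
  | mem x hx =>
    rcases hx with hx | hx
    · exact ⟨x, hx, 1, one_mem _, mul_one x⟩
    · exact ⟨1, one_mem _, x, hx, one_mul x⟩
  | one => exact ⟨1, one_mem _, 1, one_mem _, one_mul 1⟩
  | mul x y _ _ ihx ihy =>
    obtain ⟨γ, hγ, ρ, hρ, rfl⟩ := ihx
    obtain ⟨γ', hγ', ρ', hρ', rfl⟩ := ihy
    refine ⟨γ * γ', Γ.mul_mem hγ hγ', γ'⁻¹ * ρ * γ' * ρ', L.radical.mul_mem ?_ hρ', by group⟩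
    have := L.conj_mem_radical hn hg (inv_mem (hle hγ')) hρ
    rwa [inv_inv] at this
  | inv x _ ihx =>
    obtain ⟨γ, hγ, ρ, hρ, rfl⟩ := ihx
    exact ⟨γ⁻¹, inv_mem hγ, γ * ρ⁻¹ * γ⁻¹, L.conj_mem_radical hn hg (hle hγ) (inv_mem hρ),
      by group⟩

/-- If not all blocks have the same size, the reductive part has an infinite center, hence no
elliptic pairs. -/
theorem ellSub_eq_empty (L : LeviDatum g a) (hn : 0 < n) (hg : IsNilpotent (g.1 - 1))
    {Γ : Subgroup PGL(n, ℂ)}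
    (hΓ : IsReductivePart (mk g) Γ) {j l : κ} (hjl : a j ≠ a l) : ellSub Γ = ∅ := by
  rw [Set.eq_empty_iff_forall_notMem]
  rintro ⟨x, y⟩ ⟨-, -, -, hfin⟩
  obtain ⟨hinf, hsup⟩ := L.inf_sup_of_isReductivePart hn hg hΓ
  have hle : Γ ≤ Subgroup.centralizer {mk g} := hsup ▸ le_sup_left
  -- The torus element equal to `t` on the blocks of size `a j` and to `1` on the others; it is
  -- central among block diagonal matrices.
  have hcoh : ∀ t : ℂˣ, ∃ h : (blockSub a)ˣ,
      h.1.1 = diagonal fun p => if a p = a j then (t : ℂ) else 1 := by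
    intro t
    have key : ∀ s s' : ℂˣ, s * s' = 1 →
        (diagonal fun p => if a p = a j then (s : ℂ) else 1) *
          (diagonal fun p => if a p = a j then (s' : ℂ) else 1) = (1 : Matrix κ κ ℂ) := by
      intro s s' h
      rw [diagonal_mul_diagonal, ← diagonal_one]
      congr 1
      ext p
      split_ifs
      · rw [← Units.val_mul, h, Units.val_one]
      · rw [one_mul]
    have hm : ∀ s : ℂˣ, (diagonal fun p => if a p = a j then (s : ℂ) else 1) ∈ blockSub a :=
      fun s p q hpq => diagonal_apply_ne _ fun h => hpq (congrArg a h)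
    exact ⟨⟨⟨_, hm t⟩, ⟨_, hm t⁻¹⟩, Subtype.ext (key _ _ (mul_inv_cancel t)),
      Subtype.ext (key _ _ (inv_mul_cancel t))⟩, rfl⟩
  choose h hh using hcoh
  have hcentral : ∀ t (b : blockSub a), (h t).1 * b = b * (h t).1 := by
    intro t b
    refine Subtype.ext ?_
    change (h t).1.1 * b.1 = b.1 * (h t).1.1
    rw [hh]
    ext p q
    rw [diagonal_mul, mul_diagonal]
    by_cases hpq : a p = a q
    · rw [hpq, mul_comm]
    · rw [b.2 p q hpq, mul_zero, zero_mul]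
  let z : ℂˣ → (Subalgebra.centralizer ℂ {g.1})ˣ := fun t => Units.map L.emb.toMonoidHom (h t)
  have hz : ∀ t, L.red (z t).1 = (h t).1 := fun t => L.red_emb _
  have hzmem : ∀ t, centralizerToPGL g (z t) ∈ Subgroup.centralizer {mk g} := fun t => by
    rw [← range_centralizerToPGL hn hg]; exact ⟨_, rfl⟩
  choose γ hγ ρ hρ hγρ using fun t => L.exists_mul_of_isReductivePart hn hg hΓ (hzmem t)
  -- the components `γ t` are central in `Γ`
  have hcomm : ∀ t, ∀ w ∈ Γ, w * γ t = γ t * w := by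
    intro t w hw
    have hwZ := hle hw
    rw [← range_centralizerToPGL hn hg] at hwZ
    obtain ⟨v, rfl⟩ := hwZ
    -- The split lift `z t` commutes with everything modulo the radical. So does its component `γ
    -- t`, and commutators inside `Γ` that lie in the radical are trivial.
    have h1 : (centralizerToPGL g v * centralizerToPGL g (z t) * (centralizerToPGL g v)⁻¹ *
        (centralizerToPGL g (z t))⁻¹) ∈ L.radical := by
      rw [← map_inv, ← map_inv, ← map_mul, ← map_mul, ← map_mul, centralizerToPGL_mem_radical,
        mem_scalarRed]
      refine ⟨1, ?_⟩
      rw [Units.val_one, map_one, Units.val_mul, Units.val_mul, Units.val_mul, map_mul, map_mul,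
        map_mul, hz, ← hcentral, mul_assoc (h t).1, ← map_mul, ← Units.val_mul, mul_inv_cancel,
        Units.val_one, map_one, mul_one, ← hz, ← map_mul, ← Units.val_mul, mul_inv_cancel,
        Units.val_one, map_one]
    set v' := centralizerToPGL g v
    have h2 : v' * γ t * v'⁻¹ * (γ t)⁻¹ ∈ L.radical := by
      have e : v' * γ t * v'⁻¹ * (γ t)⁻¹ = (v' * centralizerToPGL g (z t)) * (ρ t)⁻¹ *
          (v' * centralizerToPGL g (z t))⁻¹ * (v' * centralizerToPGL g (z t) * v'⁻¹ *
            (centralizerToPGL g (z t))⁻¹) *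
              (centralizerToPGL g (z t) * ρ t * (centralizerToPGL g (z t))⁻¹) := by
        rw [← hγρ]
        group
      rw [e]
      exact mul_mem (mul_mem (L.conj_mem_radical hn hg (mul_mem (hle hw) (hzmem t))
        (inv_mem (hρ t))) h1) (L.conj_mem_radical hn hg (hzmem t) (hρ t))
    have h3 : v' * γ t * v'⁻¹ * (γ t)⁻¹ ∈ Γ ⊓ L.radical :=
      ⟨Γ.mul_mem (Γ.mul_mem (Γ.mul_mem hw (hγ t)) (Γ.inv_mem hw)) (Γ.inv_mem (hγ t)), h2⟩
    rw [hinf, Subgroup.mem_bot, mul_inv_eq_one, mul_inv_eq_iff_eq_mul] at h3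
    exact h3
  have hinj : Function.Injective fun t => (⟨γ t, hγ t⟩ : Γ) := by
    intro t t' htt
    have hγt : γ t = γ t' := congrArg Subtype.val htt
    have h1 : centralizerToPGL g ((z t)⁻¹ * z t') ∈ L.radical := by
      rw [map_mul, map_inv, ← hγρ, ← hγρ, hγt]
      have : (γ t' * ρ t)⁻¹ * (γ t' * ρ t') = (ρ t)⁻¹ * ρ t' := by group
      rw [this]
      exact mul_mem (inv_mem (hρ t)) (hρ t')
    obtain ⟨c, hc⟩ := L.mem_scalarRed.1 (L.centralizerToPGL_mem_radical.1 h1)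
    -- If `γ t = γ t'`, the two torus elements are proportional. The entry at `l`, which is `1` in
    -- both, forces the factor to be `1`, and the entry at `j` then gives `t = t'`.
    have h2 : (h t').1 = (c : ℂ) • (h t).1 := by
      rw [← hz, ← hz, ← mul_inv_cancel_left (z t) (z t'), Units.val_mul, map_mul, hc,
        ← Algebra.commutes, Algebra.smul_def]
    have h3 : (h t').1.1 = (c : ℂ) • (h t).1.1 := congrArg Subtype.val h2
    rw [hh, hh] at h3
    have hl := congrFun (congrFun h3 l) l
    have hj := congrFun (congrFun h3 j) j
    simp only [diagonal_apply_eq, Matrix.smul_apply, if_neg hjl.symm, if_true, smul_eq_mul,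
      mul_one] at hl hj
    rw [← hl, one_mul] at hj
    exact Units.ext hj.symm
  have : Infinite ℂˣ := by
    refine Infinite.of_injective (fun k : ℕ =>
      Units.mk0 ((k : ℂ) + 1) (by exact_mod_cast k.succ_ne_zero))
      fun k k' hk => ?_
    have := congrArg Units.val hk
    simpa using this
  refine Set.infinite_of_injective_forall_mem hinj (fun t => ?_) hfin
  exact mem_centralizer_pair.2 ⟨Subtype.ext (hcomm t x x.2), Subtype.ext (hcomm t y y.2)⟩

end

theorem exists_equiv_of_ker {r : ℕ} {G : Type*} [Group G] (f : GL (Fin r) ℂ →* G)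
    (hf : Function.Surjective f) (hker : ∀ A, f A = 1 ↔ mk A = 1) :
    ∃ φ : PGL(r, ℂ) ≃* G, ∀ A, φ (mk A) = f A := by
  have hk : f.ker = Subgroup.center (GL (Fin r) ℂ) := by
    ext A
    rw [MonoidHom.mem_ker, hker, mk_eq_one]
  exact ⟨(QuotientGroup.quotientMulEquivOfEq hk.symm).trans
    (QuotientGroup.quotientKerEquivOfSurjective f hf), fun A => rfl⟩

/-- If all blocks have the same size, the reductive part is a projective general linear group,
embedded by a conjugate of the standard embedding. -/
theorem exists_equiv_of_rect (hn : 0 < n) (hg : IsNilpotent (g.1 - 1)) {r i : ℕ} (hr : 0 < r)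
    (L : LeviDatum g fun _ : Fin r => i) {Γ : Subgroup PGL(n, ℂ)}
    (hΓ : IsReductivePart (mk g) Γ) :
    ∃ (c : GL (Fin n) ℂ) (φ : PGL(r, ℂ) ≃* Γ), ∀ (A : GL (Fin r) ℂ) (B : GL (Fin n) ℂ),
      B.1 = (L.emb ⟨A.1, fun _ _ h => (h rfl).elim⟩).1 →
        (φ (mk A) : PGL(n, ℂ)) = mk (c * B * c⁻¹) := by
  obtain ⟨hinf, hsup⟩ := L.inf_sup_of_isReductivePart hn hg hΓ
  have hle : Γ ≤ Subgroup.centralizer {mk g} := hsup ▸ le_sup_left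
  have htop : (blockSub fun _ : Fin r => i) = ⊤ :=
    eq_top_iff.2 fun M _ _ _ h => (h rfl).elim
  let E : Matrix (Fin r) (Fin r) ℂ ≃ₐ[ℂ] blockSub fun _ : Fin r => i :=
    Subalgebra.topEquiv.symm.trans (Subalgebra.equivOfEq _ _ htop.symm)
  let π : Subalgebra.centralizer ℂ {g.1} →ₐ[ℂ] Matrix (Fin r) (Fin r) ℂ :=
    (blockSub fun _ : Fin r => i).val.comp L.red
  let ι : Matrix (Fin r) (Fin r) ℂ →ₐ[ℂ] Subalgebra.centralizer ℂ {g.1} := L.emb.comp E.toAlgHom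
  have hπι : ∀ A, π (ι A) = A := fun A => congrArg Subtype.val (L.red_emb (E A))
  have hnil : ∀ x, π x = 0 → IsNilpotent x := fun x hx =>
    L.isNilpotent_of_red x (Subtype.ext hx)
  have hrad : ∀ x : (Subalgebra.centralizer ℂ {g.1})ˣ, centralizerToPGL g x ∈ L.radical ↔
      ∃ c : ℂˣ, π x.1 = algebraMap ℂ _ (c : ℂ) := by
    intro x
    rw [L.centralizerToPGL_mem_radical, L.mem_scalarRed]
    exact exists_congr fun c => Subtype.ext_iff
  have hscalar : ∀ x : (Subalgebra.centralizer ℂ {g.1})ˣ, centralizerToPGL g x = 1 ↔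
      ∃ c : ℂˣ, x.1 = algebraMap ℂ _ (c : ℂ) := by
    intro x
    rw [eq_comm, ← map_one (centralizerToPGL g), centralizerToPGL_eq_iff]
    simp only [Units.val_one, Algebra.algebraMap_eq_smul_one]
  have : NeZero r := ⟨hr.ne'⟩
  obtain ⟨c, hc⟩ : ∃ c : (Subalgebra.centralizer ℂ {g.1})ˣ, ∀ x, x ∈ Γ.comap (centralizerToPGL g) ↔
      ∃ A, x = c * Units.map ι.toMonoidHom A * c⁻¹ := by
    -- The full preimage of `Γ` is used, so it contains all scalars. Reduction is injective on it
    -- because `Γ` meets the radical trivially, and surjective because the two generate the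
    -- centralizer.
    refine exists_conj_of_closed_complement π ι hπι hnil (Γ.comap (centralizerToPGL g)) ?_ ?_ ?_
    · intro x hx hx1
      have h1 : centralizerToPGL g x ∈ Γ ⊓ L.radical :=
        ⟨hx, (hrad x).2 ⟨1, by rw [hx1, Units.val_one, map_one]⟩⟩
      rw [hinf, Subgroup.mem_bot, hscalar] at h1
      obtain ⟨d, hd⟩ := h1
      rw [hd, AlgHom.commutes] at hx1
      have hd1 : (d : ℂ) = 1 := (algebraMap ℂ (Matrix (Fin r) (Fin r) ℂ)).injective
        (by rw [hx1, map_one])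
      exact Units.ext (by rw [hd, hd1, map_one, Units.val_one])
    · intro A
      have hmem : centralizerToPGL g (Units.map ι.toMonoidHom A) ∈ Subgroup.centralizer {mk g} := by
        rw [← range_centralizerToPGL hn hg]; exact ⟨_, rfl⟩
      obtain ⟨γ, hγ, ρ, hρ, h⟩ := L.exists_mul_of_isReductivePart hn hg hΓ hmem
      have hγZ := hle hγ
      rw [← range_centralizerToPGL hn hg] at hγZ
      obtain ⟨x, rfl⟩ := hγZ
      have h1 : centralizerToPGL g (x⁻¹ * Units.map ι.toMonoidHom A) ∈ L.radical := by
        rw [map_mul, map_inv, ← h, inv_mul_cancel_left]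
        exact hρ
      obtain ⟨d, hd⟩ := (hrad _).1 h1
      -- `x` has the prescribed reduction only up to a scalar; multiplying by `s` corrects this and
      -- does not change the image in `PGL_n`.
      let s : (Subalgebra.centralizer ℂ {g.1})ˣ := Units.map (algebraMap ℂ _).toMonoidHom d
      refine ⟨x * s, ?_, ?_⟩
      · change centralizerToPGL g (x * s) ∈ Γ
        rw [map_mul, (hscalar s).2 ⟨d, rfl⟩, mul_one]
        exact hγ
      · have h2 : π s.1 = algebraMap ℂ _ (d : ℂ) := AlgHom.commutes _ _
        rw [Units.val_mul, map_mul, h2, ← hd, ← map_mul, ← Units.val_mul, mul_inv_cancel_left]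
        exact hπι _
    · intro A B hAB z x hx
      change mk _ ∈ (Γ : Set PGL(n, ℂ))
      refine hΓ.1.mem_of_infinite (A := A.1) (B := B.1) (z := z) (hAB.mono ?_)
        (congrArg Subtype.val hx)
      rintro w ⟨y, hy, hyw⟩
      exact ⟨_, hy, congrArg Subtype.val hyw⟩
  let f : GL (Fin r) ℂ →* Γ :=
    ((centralizerToPGL g).comp ((MulAut.conj c).toMonoidHom.comp
      (Units.map ι.toMonoidHom))).codRestrict Γ fun A => (hc _).2 ⟨A, rfl⟩
  have hf : ∀ A, (f A : PGL(n, ℂ)) =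
      centralizerToPGL g (c * Units.map ι.toMonoidHom A * c⁻¹) := fun A => rfl
  have hsurj : Function.Surjective f := by
    rintro ⟨y, hy⟩
    have hyZ := hle hy
    rw [← range_centralizerToPGL hn hg] at hyZ
    obtain ⟨x, rfl⟩ := hyZ
    obtain ⟨A, hA⟩ := (hc x).1 hy
    exact ⟨A, Subtype.ext (by rw [hf, ← hA])⟩
  have hker : ∀ A, f A = 1 ↔ mk A = 1 := by
    intro A
    rw [Subtype.ext_iff, hf, OneMemClass.coe_one, map_mul, map_mul, map_inv, mul_inv_eq_one,
      mul_eq_left, hscalar, mk_eq_one_iff_smul]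
    refine exists_congr fun d => ?_
    rw [← Algebra.algebraMap_eq_smul_one]
    constructor
    · intro h
      have h1 : ι A.1 = algebraMap ℂ _ (d : ℂ) := h
      rw [← hπι A.1, h1, AlgHom.commutes]
    · intro h
      change ι A.1 = _
      rw [h, AlgHom.commutes]
  obtain ⟨φ, hφ⟩ := exists_equiv_of_ker f hsurj hker
  refine ⟨Units.map (Subalgebra.centralizer ℂ {g.1}).val.toMonoidHom c, φ, fun A B hB => ?_⟩
  have : Units.map (Subalgebra.centralizer ℂ {g.1}).val.toMonoidHom
      (Units.map ι.toMonoidHom A) = B := Units.ext hB.symm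
  rw [hφ, hf, ← this, ← map_inv, ← map_mul, ← map_mul]
  rfl

end LeviDatum
end Levi
end EllipticPGL

namespace EllipticPGL
open Matrix Matrix.ProjGenLinGroup

/-! ### The centralizer of a matrix in Jordan form -/

section Jordan

variable {κ : Type*} [DecidableEq κ] {a : κ → ℕ}

/-- The unipotent matrix in Jordan form with blocks of sizes `a j`. -/
abbrev jordanMatrix (a : κ → ℕ) : Matrix (Σ j, Fin (a j)) (Σ j, Fin (a j)) ℂ :=
  blockDiagonal' fun j => jordanBlock (a j)

theorem jordanMatrix_apply (x y : Σ j, Fin (a j)) :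
    jordanMatrix a x y = (1 : Matrix _ _ ℂ) x y +
      if x.1 = y.1 ∧ (x.2 : ℕ) + 1 = y.2 then 1 else 0 := by
  obtain ⟨j, k⟩ := x
  obtain ⟨l, m⟩ := y
  by_cases hjl : j = l
  · subst hjl
    rw [jordanMatrix, blockDiagonal'_apply_eq, one_apply]
    by_cases hkm : k = m
    · subst hkm
      simp [jordanBlock]
    · simp [jordanBlock, hkm]
  · have : (⟨j, k⟩ : Σ j, Fin (a j)) ≠ ⟨l, m⟩ := fun h => hjl (congrArg Sigma.fst h)
    rw [jordanMatrix, blockDiagonal'_apply_ne _ _ _ hjl, one_apply_ne this]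
    simp [hjl]

variable [Fintype κ]

theorem sum_shift_right (X : Matrix (Σ j, Fin (a j)) (Σ j, Fin (a j)) ℂ) (x : Σ j, Fin (a j))
    (j : κ) (k : ℕ) (hk : k < a j) :
    (X * jordanMatrix a) x ⟨j, ⟨k, hk⟩⟩ = X x ⟨j, ⟨k, hk⟩⟩ +
      if h : 0 < k then X x ⟨j, ⟨k - 1, by omega⟩⟩ else 0 := by
  simp only [mul_apply, jordanMatrix_apply, mul_add, Finset.sum_add_distrib]
  congr 1
  · simp [one_apply]
  · split_ifs with h
    · rw [Finset.sum_eq_single ⟨j, ⟨k - 1, by omega⟩⟩]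
      · rw [if_pos ⟨rfl, by simp; omega⟩, mul_one]
      · rintro ⟨l, m⟩ - hne
        rw [if_neg, mul_zero]
        rintro ⟨rfl, h'⟩
        exact hne (by congr 1; ext; simp at h' ⊢; omega)
      · simp
    · refine Finset.sum_eq_zero fun y _ => ?_
      rw [if_neg, mul_zero]
      rintro ⟨-, h'⟩
      omega

theorem sum_shift_left (X : Matrix (Σ j, Fin (a j)) (Σ j, Fin (a j)) ℂ) (y : Σ j, Fin (a j))
    (j : κ) (k : ℕ) (hk : k < a j) :
    (jordanMatrix a * X) ⟨j, ⟨k, hk⟩⟩ y = X ⟨j, ⟨k, hk⟩⟩ y +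
      if h : k + 1 < a j then X ⟨j, ⟨k + 1, h⟩⟩ y else 0 := by
  simp only [mul_apply, jordanMatrix_apply, add_mul, Finset.sum_add_distrib]
  congr 1
  · simp [one_apply]
  · split_ifs with h
    · rw [Finset.sum_eq_single ⟨j, ⟨k + 1, h⟩⟩]
      · rw [if_pos ⟨rfl, rfl⟩, one_mul]
      · rintro ⟨l, m⟩ - hne
        rw [if_neg, zero_mul]
        rintro ⟨rfl, h'⟩
        exact hne (by congr 1; ext; simp at h' ⊢; omega)
      · simp
    · refine Finset.sum_eq_zero fun y _ => ?_
      rw [if_neg, zero_mul]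
      obtain ⟨l, m, hm⟩ := y
      rintro ⟨h1, h'⟩
      simp only at h1 h'
      subst h1
      omega

variable {X : Matrix (Σ j, Fin (a j)) (Σ j, Fin (a j)) ℂ}

/-- The identity parts of the Jordan matrix cancel, leaving commutation with the shifts; a shift out
of the block contributes `0`. Each block is therefore constant along diagonals. -/
theorem shift_eq_of_commute (hX : jordanMatrix a * X = X * jordanMatrix a) (j l : κ) (k m : ℕ)
    (hk : k < a j) (hm : m < a l) :
    (if h : k + 1 < a j then X ⟨j, ⟨k + 1, h⟩⟩ ⟨l, ⟨m, hm⟩⟩ else 0) =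
      if h : 0 < m then X ⟨j, ⟨k, hk⟩⟩ ⟨l, ⟨m - 1, by omega⟩⟩ else 0 := by
  have := congrFun (congrFun hX ⟨j, ⟨k, hk⟩⟩) ⟨l, ⟨m, hm⟩⟩
  rwa [sum_shift_left, sum_shift_right, add_right_inj] at this

theorem entry_succ_of_commute (hX : jordanMatrix a * X = X * jordanMatrix a) (j l : κ) (k m : ℕ)
    (hk : k + 1 < a j) (hm : m + 1 < a l) :
    X ⟨j, ⟨k + 1, hk⟩⟩ ⟨l, ⟨m + 1, hm⟩⟩ = X ⟨j, ⟨k, by omega⟩⟩ ⟨l, ⟨m, by omega⟩⟩ := by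
  have := shift_eq_of_commute hX j l k (m + 1) (by omega) hm
  rw [dif_pos hk, dif_pos (Nat.succ_pos m)] at this
  exact this

/-- Follow the diagonal back to the first column, which vanishes below its top entry. -/
theorem entry_eq_zero_of_lt (hX : jordanMatrix a * X = X * jordanMatrix a) (j l : κ) (k m : ℕ)
    (hk : k < a j) (hm : m < a l) (hmk : m < k) : X ⟨j, ⟨k, hk⟩⟩ ⟨l, ⟨m, hm⟩⟩ = 0 := by
  induction m generalizing k with
  | zero =>
    obtain ⟨k, rfl⟩ := Nat.exists_eq_succ_of_ne_zero hmk.ne'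
    have := shift_eq_of_commute hX j l k 0 (by omega) hm
    rwa [dif_pos hk, dif_neg (lt_irrefl 0)] at this
  | succ m ih =>
    obtain ⟨k, rfl⟩ := Nat.exists_eq_succ_of_ne_zero (show k ≠ 0 by omega)
    exact (entry_succ_of_commute hX j l k m hk hm).trans (ih k (by omega) (by omega) (by omega))

/-- Follow the diagonal forward to the last row, which vanishes before its last entry. -/
theorem entry_eq_zero_of_lt_sub (hX : jordanMatrix a * X = X * jordanMatrix a) (j l : κ) (k m : ℕ)
    (hk : k < a j) (hm : m < a l) (h : a j - k < a l - m) :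
    X ⟨j, ⟨k, hk⟩⟩ ⟨l, ⟨m, hm⟩⟩ = 0 := by
  obtain ⟨d, hd⟩ : ∃ d, a j = k + 1 + d := ⟨a j - (k + 1), by omega⟩
  induction d generalizing k m with
  | zero =>
    have := shift_eq_of_commute hX j l k (m + 1) hk (by omega)
    rw [dif_neg (by omega), dif_pos (Nat.succ_pos m)] at this
    exact this.symm
  | succ d ih =>
    rw [← entry_succ_of_commute hX j l k m (by omega) (by omega)]
    exact ih (k + 1) (m + 1) _ _ (by omega) (by omega)

theorem entry_diag_of_commute (hX : jordanMatrix a * X = X * jordanMatrix a) (j l : κ) (k : ℕ)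
    (hk : k < a j) (hk' : k < a l) :
    X ⟨j, ⟨k, hk⟩⟩ ⟨l, ⟨k, hk'⟩⟩ = X ⟨j, ⟨0, by omega⟩⟩ ⟨l, ⟨0, by omega⟩⟩ := by
  induction k with
  | zero => rfl
  | succ k ih => rw [entry_succ_of_commute hX, ih]

/-- A matrix whose non-zero entries strictly increase a bounded weight is nilpotent. -/
theorem isNilpotent_of_weight {I : Type*} [Fintype I] [DecidableEq I] {Y : Matrix I I ℂ}
    (wt : I → ℤ) (h : ∀ x y, Y x y ≠ 0 → wt y < wt x) : IsNilpotent Y := by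
  have hpow : ∀ (k : ℕ) x y, (Y ^ k) x y ≠ 0 → wt y + k ≤ wt x := by
    intro k
    induction k with
    | zero =>
      intro x y hxy
      rw [pow_zero, one_apply] at hxy
      have : x = y := by by_contra hne; exact hxy (if_neg hne)
      simp [this]
    | succ k ih =>
      intro x y hxy
      rw [pow_succ, mul_apply] at hxy
      obtain ⟨z, -, hz⟩ := Finset.exists_ne_zero_of_sum_ne_zero hxy
      have h1 := ih x z (left_ne_zero_of_mul hz)
      have h2 := h z y (right_ne_zero_of_mul hz)
      push_cast
      omega
  obtain ⟨B, hB⟩ : ∃ B : ℕ, ∀ x, |wt x| ≤ B := by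
    refine ⟨∑ x, (wt x).natAbs, fun x => ?_⟩
    rw [Int.abs_eq_natAbs]
    exact_mod_cast Finset.single_le_sum (f := fun x => (wt x).natAbs) (fun _ _ => Nat.zero_le _)
      (Finset.mem_univ x)
  refine ⟨2 * B + 1, Matrix.ext fun x y => ?_⟩
  by_contra hne
  have h1 := hpow _ x y hne
  have h2 := abs_le.1 (hB x)
  have h3 := abs_le.1 (hB y)
  push_cast at h1
  omega

/-- The reduction of a matrix commuting with a matrix in Jordan form: the leading coefficients of
the blocks between Jordan blocks of the same size. -/
def jordanRed (ha : ∀ j, 0 < a j) :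
    Subalgebra.centralizer ℂ {jordanMatrix a} →ₐ[ℂ] blockSub a :=
  have hcomm : ∀ X : Subalgebra.centralizer ℂ {jordanMatrix a},
      jordanMatrix a * X.1 = X.1 * jordanMatrix a := fun X =>
    (Subalgebra.mem_centralizer_iff ℂ).1 X.2 _ rfl
  AlgHom.ofLinearMap
    { toFun := fun X => ⟨Matrix.of fun j l =>
          if a j = a l then X.1 ⟨j, ⟨0, ha j⟩⟩ ⟨l, ⟨0, ha l⟩⟩ else 0, fun j l h => if_neg h⟩
      map_add' := fun X Y => by
        ext j l
        by_cases h : a j = a l <;> simp [h]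
      map_smul' := fun c X => by
        ext j l
        by_cases h : a j = a l <;> simp [h] }
    (by
      ext j l
      by_cases h : j = l
      · subst h; simp
      · have : (⟨j, ⟨0, ha j⟩⟩ : Σ j, Fin (a j)) ≠ ⟨l, ⟨0, ha l⟩⟩ := fun e =>
          h (congrArg Sigma.fst e)
        simp [h, one_apply_ne this])
    (fun X Y => by
      refine Subtype.ext (Matrix.ext fun j l => ?_)
      change (if a j = a l then (X.1 * Y.1) _ _ else 0) = ∑ p,
        (if a j = a p then X.1 ⟨j, ⟨0, ha j⟩⟩ ⟨p, ⟨0, ha p⟩⟩ else 0) *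
          (if a p = a l then Y.1 ⟨p, ⟨0, ha p⟩⟩ ⟨l, ⟨0, ha l⟩⟩ else 0)
      by_cases hjl : a j = a l
      · rw [if_pos hjl, mul_apply, Fintype.sum_sigma]
        refine Finset.sum_congr rfl fun p _ => ?_
        -- Only the top entries of the intermediate blocks contribute, since `Y` vanishes below the
        -- diagonal. For an intermediate block of another size, `X` vanishes if it is larger and `Y`
        -- if it is smaller.
        rw [Finset.sum_eq_single (⟨0, ha p⟩ : Fin (a p))]
        · by_cases hp : a j = a p
          · rw [if_pos hp, if_pos (hp ▸ hjl)]
          · rw [if_neg hp, zero_mul]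
            rcases lt_or_gt_of_ne hp with hlt | hlt
            · rw [entry_eq_zero_of_lt_sub (hcomm X) j p 0 0 _ _ (by omega), zero_mul]
            · rw [entry_eq_zero_of_lt_sub (hcomm Y) p l 0 0 _ _ (by omega), mul_zero]
        · rintro ⟨k, hk⟩ - hne
          rw [entry_eq_zero_of_lt (hcomm Y) p l k 0 hk (ha l), mul_zero]
          exact Nat.pos_of_ne_zero fun h => hne (Fin.ext h)
        · simp
      · rw [if_neg hjl]
        refine (Finset.sum_eq_zero fun p _ => ?_).symm
        by_cases hp : a j = a p
        · rw [if_neg fun h => hjl (hp.trans h), mul_zero]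
        · rw [if_neg hp, zero_mul])

/-- The block diagonal matrices act on the Jordan blocks of equal size by permuting their
coefficients linearly. -/
def jordanEmb (a : κ → ℕ) : blockSub a →ₐ[ℂ] Subalgebra.centralizer ℂ {jordanMatrix a} :=
  AlgHom.ofLinearMap
    { toFun := fun M => ⟨Matrix.of fun x y => if (x.2 : ℕ) = y.2 then M.1 x.1 y.1 else 0, by
        rw [Subalgebra.mem_centralizer_iff]
        rintro _ rfl
        ext ⟨j, k, hk⟩ ⟨l, m, hm⟩
        rw [sum_shift_left, sum_shift_right, add_right_inj]
        by_cases hjl : a j = a l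
        · simp only [of_apply]
          split_ifs <;> first | rfl | omega
        · simp [M.2 j l hjl]⟩
      map_add' := fun M N => by
        ext x y
        by_cases h : (x.2 : ℕ) = y.2 <;> simp [h]
      map_smul' := fun c M => by
        ext x y
        by_cases h : (x.2 : ℕ) = y.2 <;> simp [h] }
    (by
      ext ⟨j, k⟩ ⟨l, m⟩
      by_cases hjl : j = l
      · subst hjl
        by_cases hkm : k = m
        · subst hkm; simp
        · simp [one_apply, hkm, Fin.val_inj]
      · have : (⟨j, k⟩ : Σ j, Fin (a j)) ≠ ⟨l, m⟩ := fun h => hjl (congrArg Sigma.fst h)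
        simp [hjl, one_apply_ne this])
    (fun M N => by
      refine Subtype.ext (Matrix.ext fun x y => ?_)
      obtain ⟨j, k, hk⟩ := x
      obtain ⟨l, m, hm⟩ := y
      change (if k = m then (M.1 * N.1) j l else 0) =
        ∑ p : Σ j, Fin (a j), (if k = p.2 then M.1 j p.1 else 0) *
          (if (p.2 : ℕ) = m then N.1 p.1 l else 0)
      rw [Fintype.sum_sigma]
      by_cases hkm : k = m
      · subst hkm
        rw [if_pos rfl, mul_apply]
        refine Finset.sum_congr rfl fun p _ => ?_
        by_cases hp : a j = a p
        · rw [Finset.sum_eq_single (⟨k, hp ▸ hk⟩ : Fin (a p))]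
          · simp
          · rintro ⟨q, hq⟩ - hne
            rw [if_neg fun h => hne (Fin.ext h.symm), zero_mul]
          · simp
        · simp [M.2 j p hp]
      · rw [if_neg hkm]
        refine (Finset.sum_eq_zero fun p _ => Finset.sum_eq_zero fun q _ => ?_).symm
        by_cases h1 : k = q
        · rw [if_neg fun h => hkm (h1.trans h), mul_zero]
        · rw [if_neg h1, zero_mul])

theorem jordanRed_apply (ha : ∀ j, 0 < a j) (Y : Subalgebra.centralizer ℂ {jordanMatrix a})
    (j l : κ) : (jordanRed ha Y).1 j l =
      if a j = a l then Y.1 ⟨j, ⟨0, ha j⟩⟩ ⟨l, ⟨0, ha l⟩⟩ else 0 := rfl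

theorem jordanEmb_apply (M : blockSub a) (x y : Σ j, Fin (a j)) :
    (jordanEmb a M).1 x y = if (x.2 : ℕ) = y.2 then M.1 x.1 y.1 else 0 := rfl

theorem jordanRed_jordanEmb (ha : ∀ j, 0 < a j) (M : blockSub a) :
    jordanRed ha (jordanEmb a M) = M := by
  refine Subtype.ext (Matrix.ext fun j l => ?_)
  rw [jordanRed_apply, jordanEmb_apply]
  by_cases h : a j = a l
  · simp [h]
  · simp [h, M.2 j l h]

/-- A nonzero entry has `k ≤ m` and `a l - m ≤ a j - k`; adding these, the weight `a - 2 k` cannot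
increase from row to column. Equality of weights forces `k = m` and `a j = a l`, where the entry is
one of the reduction. -/
theorem isNilpotent_of_jordanRed_eq_zero (ha : ∀ j, 0 < a j)
    (Y : Subalgebra.centralizer ℂ {jordanMatrix a}) (hY : jordanRed ha Y = 0) : IsNilpotent Y := by
  have hcomm : jordanMatrix a * Y.1 = Y.1 * jordanMatrix a :=
    (Subalgebra.mem_centralizer_iff ℂ).1 Y.2 _ rfl
  have h0 : IsNilpotent Y.1 := by
    refine isNilpotent_of_weight (fun x => (a x.1 : ℤ) - 2 * (x.2 : ℕ)) ?_
    rintro ⟨j, k, hk⟩ ⟨l, m, hm⟩ hne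
    have h1 : k ≤ m := by
      by_contra hlt
      exact hne (entry_eq_zero_of_lt hcomm j l k m hk hm (by omega))
    have h2 : a l - m ≤ a j - k := by
      by_contra hlt
      exact hne (entry_eq_zero_of_lt_sub hcomm j l k m hk hm (by omega))
    by_contra hlt
    simp only at hlt
    have h3 : k = m := by omega
    subst h3
    have h4 : a j = a l := by omega
    rw [entry_diag_of_commute hcomm] at hne
    have := jordanRed_apply ha Y j l
    rw [hY, if_pos h4] at this
    exact hne this.symm
  obtain ⟨k, hk⟩ := h0
  exact ⟨k, Subtype.ext (by simpa using hk)⟩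

theorem isNilpotent_jordanMatrix_sub_one (a : κ → ℕ) : IsNilpotent (jordanMatrix a - 1) := by
  refine isNilpotent_of_weight (fun x => - ((x.2 : ℕ) : ℤ)) fun x y h => ?_
  rw [Matrix.sub_apply, jordanMatrix_apply, add_sub_cancel_left] at h
  have : x.1 = y.1 ∧ (x.2 : ℕ) + 1 = y.2 := by
    by_contra hne
    exact h (if_neg hne)
  omega

end Jordan
end EllipticPGL

namespace EllipticPGL
open Matrix Matrix.ProjGenLinGroup

/-! ### Existence of the Jordan form of a nilpotent endomorphism -/

open Polynomial in
/-- A nilpotent endomorphism decomposes the space into cyclic summands. -/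
theorem exists_cyclic_generators {V : Type*} [AddCommGroup V] [Module ℂ V] [FiniteDimensional ℂ V]
    (f : Module.End ℂ V) (hf : IsNilpotent f) :
    ∃ (d : ℕ) (k : Fin d → ℕ) (v : Fin d → V),
      (∀ x, ∃ q : Fin d → ℂ[X], x = ∑ i, aeval f (q i) (v i)) ∧
      ∀ q : Fin d → ℂ[X], ∑ i, aeval f (q i) (v i) = 0 ↔ ∀ i, X ^ k i ∣ q i := by
  obtain ⟨m, hm⟩ := hf
  -- Regard the space as a `ℂ[X]`-module with `X` acting by `f`; nilpotency makes it torsion for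
  -- powers of `X`, and the structure theorem splits it into cyclic summands.
  have htors : Module.IsTorsion' (Module.AEval' f) (Submonoid.powers (X : ℂ[X])) := by
    rw [Submodule.isTorsion'_powers_iff]
    intro v
    obtain ⟨v, rfl⟩ := (Module.AEval'.of f).surjective v
    refine ⟨m, ?_⟩
    rw [Module.AEval'.X_pow_smul_of, hm]
    simp
  obtain ⟨d, k, ⟨T⟩⟩ := Module.torsion_by_prime_power_decomposition (p := (X : ℂ[X]))
    Polynomial.irreducible_X htors
  let T' := T.trans (DirectSum.linearEquivFunOnFintype ℂ[X] (Fin d) _)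
  let v : Fin d → Module.AEval' f := fun i =>
    T'.symm (Pi.single i (Submodule.Quotient.mk (1 : ℂ[X])))
  have hT : ∀ q : Fin d → ℂ[X], T' (∑ i, q i • v i) = fun i => Submodule.Quotient.mk (q i) := by
    intro q
    rw [map_sum]
    ext i
    rw [Finset.sum_apply, Finset.sum_eq_single i]
    · rw [map_smul, LinearEquiv.apply_symm_apply, Pi.smul_apply, Pi.single_eq_same,
        ← Submodule.Quotient.mk_smul, smul_eq_mul, mul_one]
    · intro j _ hj
      rw [map_smul, LinearEquiv.apply_symm_apply, Pi.smul_apply, Pi.single_eq_of_ne hj.symm,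
        smul_zero]
    · simp
  have hof : ∀ q : Fin d → ℂ[X], (Module.AEval'.of f).symm (∑ i, q i • v i) =
      ∑ i, aeval f (q i) ((Module.AEval'.of f).symm (v i)) := by
    intro q
    rw [map_sum]
    exact Finset.sum_congr rfl fun i _ => Module.AEval.of_symm_smul _ _ _
  refine ⟨d, k, fun i => (Module.AEval'.of f).symm (v i), fun x => ?_, fun q => ?_⟩
  · choose q hq using fun i => Submodule.Quotient.mk_surjective _ (T' (Module.AEval'.of f x) i)
    refine ⟨q, ?_⟩
    rw [← hof, LinearEquiv.eq_symm_apply]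
    refine T'.injective ?_
    rw [hT]
    exact (funext hq).symm
  · rw [← hof, LinearEquiv.map_eq_zero_iff, ← LinearEquiv.map_eq_zero_iff T', hT, funext_iff]
    refine forall_congr' fun i => ?_
    rw [Pi.zero_apply, Submodule.Quotient.mk_eq_zero]
    exact Ideal.mem_span_singleton

open Polynomial in
/-- A nilpotent endomorphism has a basis of Jordan chains. -/
theorem exists_jordan_basis {V : Type*} [AddCommGroup V] [Module ℂ V] [FiniteDimensional ℂ V]
    (f : Module.End ℂ V) (hf : IsNilpotent f) :
    ∃ (d : ℕ) (k : Fin d → ℕ) (b : Module.Basis (Σ i, Fin (k i)) ℂ V),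
      ∀ i (s : ℕ) (hs : s < k i), f (b ⟨i, ⟨s, hs⟩⟩) =
        if h : 0 < s then b ⟨i, ⟨s - 1, by omega⟩⟩ else 0 := by
  obtain ⟨d, k, v, hspan, hrel⟩ := exists_cyclic_generators f hf
  have hkill : ∀ i, aeval f (X ^ k i : ℂ[X]) (v i) = 0 := by
    intro i
    have := (hrel (Pi.single i (X ^ k i))).2 fun j => by
      by_cases hj : j = i
      · subst hj; simp
      · simp [hj]
    rwa [Finset.sum_eq_single i (fun j _ hj => by simp [hj]) (by simp), Pi.single_eq_same] at this
  -- Chains are listed backwards, ending at the generator, so that `f` lowers the index as an upper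
  -- triangular Jordan block does.
  let w : (Σ i, Fin (k i)) → V := fun x => (f ^ (k x.1 - 1 - x.2)) (v x.1)
  have hli : LinearIndependent ℂ w := by
    rw [Fintype.linearIndependent_iff]
    intro c hc
    let q : Fin d → ℂ[X] := fun i => ∑ s : Fin (k i), C (c ⟨i, s⟩) * X ^ (k i - 1 - s)
    have h1 : ∑ i, aeval f (q i) (v i) = 0 := by
      rw [← hc, Fintype.sum_sigma]
      refine Finset.sum_congr rfl fun i _ => ?_
      simp only [q, map_sum, LinearMap.sum_apply, map_mul, aeval_C, map_pow, aeval_X]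
      rfl
    have h2 := (hrel q).1 h1
    rintro ⟨i, s⟩
    have h3 := X_pow_dvd_iff.1 (h2 i) (k i - 1 - s) (by omega)
    simp only [q, finsetSum_coeff, coeff_C_mul, coeff_X_pow] at h3
    rw [Finset.sum_eq_single s] at h3
    · simpa using h3
    · intro t _ hts
      have : k i - 1 - (s : ℕ) ≠ k i - 1 - t := fun h => hts (Fin.ext (by omega))
      rw [if_neg this, mul_zero]
    · simp
  have htop : ⊤ ≤ Submodule.span ℂ (Set.range w) := by
    rintro x -
    obtain ⟨q, rfl⟩ := hspan x
    refine Submodule.sum_mem _ fun i _ => ?_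
    rw [aeval_eq_sum_range, LinearMap.sum_apply]
    refine Submodule.sum_mem _ fun t _ => ?_
    rw [LinearMap.smul_apply]
    refine Submodule.smul_mem _ _ ?_
    by_cases ht : t < k i
    · refine Submodule.subset_span ⟨⟨i, ⟨k i - 1 - t, by omega⟩⟩, ?_⟩
      simp only [w]
      congr 2
      omega
    · have : f ^ t = f ^ (t - k i) * f ^ k i := by rw [← pow_add]; congr 1; omega
      have h0 := hkill i
      rw [map_pow, aeval_X] at h0
      rw [this, Module.End.mul_apply, h0, map_zero]
      exact Submodule.zero_mem _
  refine ⟨d, k, Module.Basis.mk hli htop, fun i s hs => ?_⟩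
  simp only [Module.Basis.mk_apply, w]
  rw [← Module.End.mul_apply, ← pow_succ']
  split_ifs with h
  · congr 2
    omega
  · have h0 := hkill i
    rw [map_pow, aeval_X] at h0
    rw [show k i - 1 - s + 1 = k i by omega, h0]

end EllipticPGL

namespace EllipticPGL
open Matrix Matrix.ProjGenLinGroup

/-! ### Jordan types and conjugacy of unipotent elements -/

/-- The cyclic decomposition may contain zero summands; dropping them makes the lengths parts of a
partition. -/
theorem exists_jordan_basis_pos {V : Type*} [AddCommGroup V] [Module ℂ V] [FiniteDimensional ℂ V]
    (f : Module.End ℂ V) (hf : IsNilpotent f) :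
    ∃ (d : ℕ) (k : Fin d → ℕ) (b : Module.Basis (Σ i, Fin (k i)) ℂ V), (∀ i, 0 < k i) ∧
      ∀ i (s : ℕ) (hs : s < k i), f (b ⟨i, ⟨s, hs⟩⟩) =
        if h : 0 < s then b ⟨i, ⟨s - 1, by omega⟩⟩ else 0 := by
  obtain ⟨d, k, b, hb⟩ := exists_jordan_basis f hf
  let ε := (Fintype.equivFin {i // 0 < k i}).symm
  let F : (Σ j, Fin (k (ε j).1)) → Σ i, Fin (k i) := fun x => ⟨(ε x.1).1, x.2⟩
  have hF : Function.Bijective F := by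
    constructor
    · rintro ⟨j, s⟩ ⟨j', s'⟩ h
      have h1 : (ε j).1 = (ε j').1 := congrArg Sigma.fst h
      obtain rfl : j = j' := ε.injective (Subtype.ext h1)
      simpa [F] using h
    · rintro ⟨i, s⟩
      have hi : 0 < k i := s.pos
      obtain ⟨j, hj⟩ := ε.surjective ⟨i, hi⟩
      obtain rfl : (ε j).1 = i := congrArg Subtype.val hj
      exact ⟨⟨j, s⟩, rfl⟩
  refine ⟨_, fun j => k (ε j).1, b.reindex (Equiv.ofBijective F hF).symm, fun j => (ε j).2,
    fun j s hs => ?_⟩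
  simp only [Module.Basis.reindex_apply, Equiv.symm_symm, Equiv.ofBijective_apply]
  exact hb (ε j).1 s hs

theorem exists_hasJordanType {n : ℕ} {u : PGL(n, ℂ)} (hu : IsUnipotentElt u) :
    ∃ p : n.Partition, HasJordanType u p := by
  obtain ⟨g, rfl, hg⟩ := hu
  obtain ⟨d, k, b, hk, hb⟩ := exists_jordan_basis_pos (Matrix.toLin' (g.1 - 1)) (by
    obtain ⟨m, hm⟩ := hg
    exact ⟨m, by rw [← toLin'_pow, hm, map_zero]⟩)
  let e : (Σ i, Fin (k i)) ≃ Fin n := b.indexEquiv (Pi.basisFun ℂ (Fin n))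
  let p : n.Partition :=
    { parts := Multiset.map k Finset.univ.val
      parts_pos := by
        intro i hi
        obtain ⟨j, -, rfl⟩ := Multiset.mem_map.1 hi
        exact hk j
      parts_sum := by
        have := Fintype.card_congr e
        simp only [Fintype.card_sigma, Fintype.card_fin] at this
        exact this }
  -- The columns are the Jordan basis, with rows relabelled through `e`.
  let Q : Matrix (Σ i, Fin (k i)) (Σ i, Fin (k i)) ℂ := Matrix.of fun x y => b y (e x)
  have hP : IsUnit (Matrix.reindex e e Q) := by
    rw [← Matrix.linearIndependent_cols_iff_isUnit]
    have hcol : (Matrix.reindex e e Q).col = b ∘ e.symm := by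
      ext c r
      simp [Q]
    rw [hcol]
    exact b.linearIndependent.comp e.symm e.symm.injective
  obtain ⟨P, hP⟩ := hP
  have hmul : g.1 * P.1 = P.1 * Matrix.reindex e e (jordanMatrix k) := by
    have h1 : Matrix.reindex e e Q * Matrix.reindex e e (jordanMatrix k) =
        Matrix.reindex e e (Q * jordanMatrix k) := by
      simp
    rw [hP, h1]
    ext r c
    obtain ⟨⟨i, s, hs⟩, rfl⟩ := e.surjective c
    have h2 := congrFun (hb i s hs) r
    have h3 : (g.1 * Matrix.reindex e e Q) r (e ⟨i, ⟨s, hs⟩⟩) =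
        (g.1 *ᵥ b ⟨i, ⟨s, hs⟩⟩) r := by
      simp [mul_apply, mulVec, dotProduct, Q]
    have h4 : g.1 *ᵥ b ⟨i, ⟨s, hs⟩⟩ =
        b ⟨i, ⟨s, hs⟩⟩ + Matrix.toLin' (g.1 - 1) (b ⟨i, ⟨s, hs⟩⟩) := by
      rw [toLin'_apply, sub_mulVec, one_mulVec, add_sub_cancel]
    rw [h3, h4, Pi.add_apply, h2, reindex_apply, submatrix_apply, Equiv.symm_apply_apply,
      sum_shift_right]
    simp only [Q, of_apply, Equiv.apply_symm_apply]
    split_ifs <;> rfl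
  refine ⟨p, d, k, e, P, g, rfl, ?_, rfl⟩
  rw [← hmul, mul_assoc, ← Units.val_mul, mul_inv_cancel, Units.val_one, mul_one]

/-- Equal multisets have equal multiplicities, that is, fibres of equal size, which can be matched.
-/
theorem exists_equiv_of_map_univ_eq {m m' : ℕ} {a : Fin m → ℕ} {a' : Fin m' → ℕ}
    (h : Multiset.map a Finset.univ.val = Multiset.map a' Finset.univ.val) :
    ∃ σ : Fin m ≃ Fin m', ∀ j, a' (σ j) = a j := by
  have hcard : ∀ c, Fintype.card {j // a j = c} = Fintype.card {j // a' j = c} := by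
    intro c
    have := congrArg (Multiset.count c) h
    rw [Multiset.count_map, Multiset.count_map] at this
    rw [Fintype.card_subtype, Fintype.card_subtype]
    simpa [Finset.card, eq_comm] using this
  exact ⟨Equiv.ofFiberEquiv fun c => Fintype.equivOfCardEq (hcard c),
    fun j => Equiv.ofFiberEquiv_map _ j⟩

theorem reindex_eq_conj {n : ℕ} (τ : Fin n ≃ Fin n) (M : Matrix (Fin n) (Fin n) ℂ) :
    ∃ Q : GL (Fin n) ℂ, Matrix.reindex τ τ M = Q.1 * M * Q⁻¹.1 := by
  have h : ∀ σ : Fin n ≃ Fin n, σ.toPEquiv.toMatrix * (σ.symm.toPEquiv.toMatrix :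
      Matrix (Fin n) (Fin n) ℂ) = 1 := by
    intro σ
    rw [PEquiv.toMatrix_toPEquiv_mul]
    ext i j
    simp [PEquiv.toMatrix_apply, one_apply, Equiv.toPEquiv_apply]
  refine ⟨⟨τ.symm.toPEquiv.toMatrix, τ.toPEquiv.toMatrix, h τ.symm, h τ⟩, ?_⟩
  change _ = _ * M * τ.toPEquiv.toMatrix
  rw [PEquiv.toMatrix_toPEquiv_mul, PEquiv.mul_toMatrix_toPEquiv]
  rfl

theorem isConj_of_hasJordanType {n : ℕ} {u u' : PGL(n, ℂ)} {p : n.Partition}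
    (h : HasJordanType u p) (h' : HasJordanType u' p) : IsConj u u' := by
  obtain ⟨m, a, e, P, g, ha, hg, rfl⟩ := h
  obtain ⟨m', a', e', P', g', ha', hg', rfl⟩ := h'
  obtain ⟨σ, hσ⟩ := exists_equiv_of_map_univ_eq (ha.trans ha'.symm)
  let τ : (Σ j, Fin (a j)) ≃ Σ j, Fin (a' j) := Equiv.sigmaCongr σ fun j => finCongr (hσ j).symm
  have hτ : ∀ x y, jordanMatrix a' (τ x) (τ y) = jordanMatrix a x y := by
    intro x y
    have h1 : (τ x).1 = (τ y).1 ↔ x.1 = y.1 := σ.injective.eq_iff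
    have h2 : ∀ z, ((τ z).2 : ℕ) = z.2 := fun z => rfl
    simp only [jordanMatrix_apply, one_apply, τ.injective.eq_iff, h1, h2]
  obtain ⟨Q, hQ⟩ := reindex_eq_conj (e.symm.trans (τ.trans e'))
    (Matrix.reindex e e (jordanMatrix a))
  have hQ' : Matrix.reindex e' e' (jordanMatrix a') =
      Q.1 * Matrix.reindex e e (jordanMatrix a) * Q⁻¹.1 := by
    rw [← hQ]
    ext r c
    simp only [reindex_apply, submatrix_apply, Equiv.symm_trans_apply, Equiv.symm_symm,
      Equiv.symm_apply_apply]
    rw [← hτ, Equiv.apply_symm_apply, Equiv.apply_symm_apply]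
  rw [isConj_iff]
  refine ⟨mk (P' * Q * P⁻¹), ?_⟩
  rw [← map_inv, ← map_mul, ← map_mul]
  congr 1
  refine Units.ext ?_
  change _ = _ * Matrix.reindex e e (jordanMatrix a) * _ at hg
  change _ = _ * Matrix.reindex e' e' (jordanMatrix a') * _ at hg'
  rw [hg', hQ']
  simp only [Units.val_mul, hg, _root_.mul_inv_rev, inv_inv]
  have h1 : P⁻¹.1 * P.1 = 1 := by rw [← Units.val_mul, inv_mul_cancel, Units.val_one]
  simp only [mul_assoc]
  rw [← mul_assoc P⁻¹.1 P.1, h1, one_mul, ← mul_assoc P⁻¹.1 P.1, h1, one_mul]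

theorem HasJordanType.of_isConj {n : ℕ} {u u' : PGL(n, ℂ)} {p : n.Partition}
    (h : HasJordanType u p) (hc : IsConj u u') : HasJordanType u' p := by
  obtain ⟨m, a, e, P, g, ha, hg, rfl⟩ := h
  obtain ⟨c, rfl⟩ := isConj_iff.1 hc
  obtain ⟨c, rfl⟩ := mk_surjective c
  refine ⟨m, a, e, c * P, c * g * c⁻¹, ha, ?_, by simp⟩
  simp only [Units.val_mul, hg, _root_.mul_inv_rev, mul_assoc]

theorem IsUnipotentElt.of_isConj {n : ℕ} {u u' : PGL(n, ℂ)} (h : IsUnipotentElt u)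
    (hc : IsConj u u') : IsUnipotentElt u' := by
  obtain ⟨g, rfl, hg⟩ := h
  obtain ⟨c, rfl⟩ := isConj_iff.1 hc
  obtain ⟨c, rfl⟩ := mk_surjective c
  refine ⟨c * g * c⁻¹, by simp, ?_⟩
  have := hg.map (conjAlgEquiv c)
  rwa [map_sub, map_one] at this

/-! ### The Levi datum of a Jordan form -/

section

variable {A B : Type*} [Ring A] [Algebra ℂ A] [Ring B] [Algebra ℂ B]

/-- An isomorphism of algebras restricts to the centralizers of corresponding elements. -/
def centralizerMap (Ψ : A ≃ₐ[ℂ] B) {x : A} {y : B} (h : Ψ x = y) :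
    Subalgebra.centralizer ℂ {x} →ₐ[ℂ] Subalgebra.centralizer ℂ {y} :=
  (Ψ.toAlgHom.comp (Subalgebra.centralizer ℂ {x}).val).codRestrict _ fun z => by
    rw [Subalgebra.mem_centralizer_iff]
    intro w hw
    obtain rfl : w = y := hw
    change w * Ψ z.1 = Ψ z.1 * w
    rw [← h, ← map_mul, ← map_mul, (Subalgebra.mem_centralizer_iff ℂ).1 z.2 x rfl]

theorem coe_centralizerMap (Ψ : A ≃ₐ[ℂ] B) {x : A} {y : B} (h : Ψ x = y)
    (z : Subalgebra.centralizer ℂ {x}) : (centralizerMap Ψ h z).1 = Ψ z.1 := rfl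

end

/-- The Levi datum of a matrix isomorphic to a matrix in Jordan form. -/
def jordanLeviDatum {n : ℕ} {g : GL (Fin n) ℂ} {κ : Type*} [Fintype κ] [DecidableEq κ] {a : κ → ℕ}
    (ha : ∀ j, 0 < a j)
    (Ψ : Matrix (Σ j, Fin (a j)) (Σ j, Fin (a j)) ℂ ≃ₐ[ℂ] Matrix (Fin n) (Fin n) ℂ)
    (hΨ : Ψ (jordanMatrix a) = g.1) : LeviDatum g a where
  red := (jordanRed ha).comp (centralizerMap Ψ.symm (by rw [← hΨ, AlgEquiv.symm_apply_apply]))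
  emb := (centralizerMap Ψ hΨ).comp (jordanEmb a)
  red_emb b := by
    refine Eq.trans ?_ (jordanRed_jordanEmb ha b)
    rw [AlgHom.comp_apply]
    congr 1
    exact Subtype.ext (by simp [coe_centralizerMap])
  isNilpotent_of_red x hx := by
    obtain ⟨k, hk⟩ := isNilpotent_of_jordanRed_eq_zero ha _ hx
    refine ⟨k, Subtype.ext (Ψ.symm.injective ?_)⟩
    have := congrArg Subtype.val hk
    simpa [coe_centralizerMap] using this

/-- The isomorphism of matrix algebras given by a labelling of the basis and a change of basis. -/
def reindexConj {n : ℕ} {I : Type*} [Fintype I] [DecidableEq I] (e : I ≃ Fin n)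
    (P : GL (Fin n) ℂ) : Matrix I I ℂ ≃ₐ[ℂ] Matrix (Fin n) (Fin n) ℂ :=
  (Matrix.reindexAlgEquiv ℂ ℂ e).trans (conjAlgEquiv P)

end EllipticPGL

namespace EllipticPGL
open Matrix Matrix.ProjGenLinGroup

/-! ### Unipotent classes and their Jordan types -/

theorem isNilpotent_sub_one_of_eq {n : ℕ} {g : GL (Fin n) ℂ} {κ : Type*} [Fintype κ]
    [DecidableEq κ] {a : κ → ℕ}
    (Ψ : Matrix (Σ j, Fin (a j)) (Σ j, Fin (a j)) ℂ ≃ₐ[ℂ] Matrix (Fin n) (Fin n) ℂ)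
    (hΨ : Ψ (jordanMatrix a) = g.1) : IsNilpotent (g.1 - 1) := by
  have := (isNilpotent_jordanMatrix_sub_one a).map Ψ
  rwa [map_sub, map_one, hΨ] at this

theorem parts_pos_of_map_eq {n m : ℕ} {a : Fin m → ℕ} {p : n.Partition}
    (h : Multiset.map a Finset.univ.val = p.parts) (j : Fin m) : 0 < a j :=
  p.parts_pos (h ▸ Multiset.mem_map_of_mem a (Finset.mem_univ j))

theorem HasJordanType.isUnipotentElt {n : ℕ} {u : PGL(n, ℂ)} {p : n.Partition}
    (h : HasJordanType u p) : IsUnipotentElt u := by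
  obtain ⟨m, a, e, P, g, -, hg, rfl⟩ := h
  exact ⟨g, rfl, isNilpotent_sub_one_of_eq (reindexConj e P) hg.symm⟩

theorem exists_isReductivePart {n : ℕ} (hn : 0 < n) {u : PGL(n, ℂ)} (hu : IsUnipotentElt u) :
    ∃ Γ : Subgroup PGL(n, ℂ), IsReductivePart u Γ := by
  obtain ⟨p, m, a, e, P, g, ha, hg, rfl⟩ := exists_hasJordanType hu
  let L := jordanLeviDatum (parts_pos_of_map_eq ha) (reindexConj e P) hg.symm
  exact ⟨L.levi, L.isReductivePart_levi hn
    (isNilpotent_sub_one_of_eq (reindexConj e P) hg.symm)⟩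

theorem eq_replicate_of_ellSub_nonempty {n : ℕ} (hn : 0 < n) {u : PGL(n, ℂ)} {p : n.Partition}
    {Γ : Subgroup PGL(n, ℂ)} (hu : HasJordanType u p) (hΓ : IsReductivePart u Γ)
    (h : (ellSub Γ).Nonempty) : ∃ r i : ℕ, p.parts = Multiset.replicate r i := by
  obtain ⟨m, a, e, P, g, ha, hg, rfl⟩ := hu
  have hconst : ∀ j l, a j = a l := by
    intro j l
    by_contra hjl
    rw [(jordanLeviDatum (parts_pos_of_map_eq ha) (reindexConj e P) hg.symm).ellSub_eq_empty
      hn (isNilpotent_sub_one_of_eq (reindexConj e P) hg.symm) hΓ hjl] at h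
    exact Set.not_nonempty_empty h
  obtain ⟨i, hi⟩ : ∃ i, ∀ j, a j = i := by
    rcases isEmpty_or_nonempty (Fin m) with hm | ⟨⟨j⟩⟩
    -- With no blocks the common size is arbitrary.
    · exact ⟨0, fun j => hm.elim j⟩
    · exact ⟨a j, fun l => hconst l j⟩
  refine ⟨_, i, Multiset.eq_replicate.2 ⟨rfl, fun b hb => ?_⟩⟩
  rw [← ha] at hb
  obtain ⟨j, -, rfl⟩ := Multiset.mem_map.1 hb
  exact hi j

theorem mul_eq_of_parts_eq_replicate {n r i : ℕ} {p : n.Partition}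
    (h : p.parts = Multiset.replicate r i) : r * i = n := by
  rw [← p.parts_sum, h, Multiset.sum_replicate, smul_eq_mul]

theorem coe_diagEmb {n r i : ℕ} (e : Fin r × Fin i ≃ Fin n) (A : GL (Fin r) ℂ) :
    (diagEmb e A).1 = Matrix.reindex e e (blockDiagonal fun _ : Fin i => A.1) := rfl

theorem exists_equiv_of_parts_eq_replicate {n r i : ℕ} (hn : 0 < n) {u : PGL(n, ℂ)}
    {p : n.Partition} {Γ : Subgroup PGL(n, ℂ)} (hu : HasJordanType u p)
    (hΓ : IsReductivePart u Γ) (hp : p.parts = Multiset.replicate r i) :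
    ∃ (e : Fin r × Fin i ≃ Fin n) (P : GL (Fin n) ℂ) (φ : PGL(r, ℂ) ≃* Γ),
      (∀ A : GL (Fin r) ℂ, (φ (mk A) : PGL(n, ℂ)) = mk (P * diagEmb e A * P⁻¹)) ∧
      ∀ ζ : ℂˣ, IsPrimitiveRoot ζ r →
        IsStandardUnion (ellSub Γ) r (φ (Delta r ζ)) (φ (wdot r)) := by
  have hr : 0 < r := by
    refine Nat.pos_of_ne_zero fun h => hn.ne ?_
    rw [← mul_eq_of_parts_eq_replicate hp, h, zero_mul]
  obtain ⟨m, a, e, P, g, ha, hg, rfl⟩ := hu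
  have ha' := parts_pos_of_map_eq ha
  rw [hp] at ha
  obtain rfl : m = r := by simpa using congrArg Multiset.card ha
  obtain rfl : a = fun _ => i := funext fun j =>
    Multiset.eq_of_mem_replicate (ha ▸ Multiset.mem_map_of_mem a (Finset.mem_univ j))
  obtain ⟨c, φ, hφ⟩ := LeviDatum.exists_equiv_of_rect hn
    (isNilpotent_sub_one_of_eq (reindexConj e P) hg.symm) hr
    (jordanLeviDatum ha' (reindexConj e P) hg.symm) hΓ
  let e' : Fin m × Fin i ≃ Fin n := (Equiv.sigmaEquivProd (Fin m) (Fin i)).symm.trans e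
  refine ⟨e', c * P, φ, fun A => ?_, fun ζ hζ => ?_⟩
  · rw [hφ A (P * diagEmb e' A * P⁻¹)]
    · simp only [_root_.mul_inv_rev, mul_assoc]
    -- With equal blocks, the split embedding acts by `A` on the block index and trivially on the
    -- position in the block: the diagonal embedding up to the labelling.
    · change _ = P.1 * Matrix.reindex e e (jordanEmb (fun _ : Fin m => i) _).1 * P⁻¹.1
      rw [Units.val_mul, Units.val_mul, coe_diagEmb]
      congr 2
      ext x y
      simp [e', jordanEmb_apply, blockDiagonal_apply, Fin.ext_iff]
  · rw [ellSub, image_ellipticPairs φ]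
    -- An element of `PGL_r` with trivial `r`-th power has an image of finite order in `PGL_n`,
    -- hence semisimple there.
    refine (isStandardUnion_ellipticPairs hr (fun x hx => ?_) hζ).map φ
    refine isSemisimpleElt_of_pow_eq_one hr.ne' ?_
    rw [← Subgroup.coe_pow, ← map_pow, hx, map_one, Subgroup.coe_one]

theorem exists_isPrimitiveRoot_units {r : ℕ} (hr : r ≠ 0) : ∃ ζ : ℂˣ, IsPrimitiveRoot ζ r := by
  have h := Complex.isPrimitiveRoot_exp r hr
  exact ⟨(h.isUnit hr).unit, IsPrimitiveRoot.coe_units_iff.1 h⟩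

theorem IsStandardUnion.nonempty {H : Type*} [Group H] {Y : Set (H × H)} {m : ℕ} {s w : H}
    (h : IsStandardUnion Y m s w) : Y.Nonempty := by
  rw [h.eq_iUnion]
  exact ⟨_, Set.mem_iUnion.2 ⟨1, MulAction.mem_orbit_self _⟩⟩

theorem pos_of_parts_eq_replicate {n r i : ℕ} (hn : 0 < n) {p : n.Partition}
    (h : p.parts = Multiset.replicate r i) : 0 < r ∧ 0 < i := by
  have := mul_eq_of_parts_eq_replicate h
  constructor <;> refine Nat.pos_of_ne_zero fun h0 => hn.ne ?_ <;> simp [← this, h0]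

theorem ellSub_nonempty_of_parts_eq_replicate {n r i : ℕ} (hn : 0 < n) {u : PGL(n, ℂ)}
    {p : n.Partition} {Γ : Subgroup PGL(n, ℂ)} (hu : HasJordanType u p)
    (hΓ : IsReductivePart u Γ) (hp : p.parts = Multiset.replicate r i) :
    (ellSub Γ).Nonempty := by
  obtain ⟨e, P, φ, -, h⟩ := exists_equiv_of_parts_eq_replicate hn hu hΓ hp
  obtain ⟨ζ, hζ⟩ := exists_isPrimitiveRoot_units (pos_of_parts_eq_replicate hn hp).1.ne'
  exact (h ζ hζ).nonempty

theorem card_pairOrbits_of_parts_eq_replicate {n r i : ℕ} (hn : 0 < n) {u : PGL(n, ℂ)}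
    {p : n.Partition} {Γ : Subgroup PGL(n, ℂ)} (hu : HasJordanType u p)
    (hΓ : IsReductivePart u Γ) (hp : p.parts = Multiset.replicate r i) :
    (pairOrbits (ellSub Γ)).Finite ∧ (pairOrbits (ellSub Γ)).ncard = r.totient := by
  obtain ⟨e, P, φ, -, h⟩ := exists_equiv_of_parts_eq_replicate hn hu hΓ hp
  obtain ⟨ζ, hζ⟩ := exists_isPrimitiveRoot_units (pos_of_parts_eq_replicate hn hp).1.ne'
  exact (h ζ hζ).card_orbits

/-! ### Rectangular Jordan types -/

theorem jordanMatrix_sub_one_pow_apply {κ : Type*} [Fintype κ] [DecidableEq κ] (a : κ → ℕ) (k : ℕ)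
    (x y : Σ j, Fin (a j)) : ((jordanMatrix a - 1) ^ k) x y =
      if x.1 = y.1 ∧ (x.2 : ℕ) + k = y.2 then 1 else 0 := by
  induction k generalizing y with
  | zero =>
    rw [pow_zero, one_apply]
    refine if_congr ?_ rfl rfl
    obtain ⟨j, s⟩ := x
    obtain ⟨l, t⟩ := y
    constructor
    · rintro h
      cases h
      simp
    · rintro ⟨h1, h2⟩
      cases (h1 : j = l)
      simpa [Fin.ext_iff] using h2
  | succ k ih =>
    obtain ⟨l, t, ht⟩ := y
    rw [pow_succ, mul_sub, mul_one, Matrix.sub_apply, sum_shift_right, add_sub_cancel_left]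
    split_ifs with h1 h2 h2
    · rw [ih, if_pos ⟨h2.1, by have := h2.2; simp only at this ⊢; omega⟩]
    · rw [ih, if_neg]
      rintro ⟨h3, h4⟩
      exact h2 ⟨h3, by simp only at h4 ⊢; omega⟩
    · have := h2.2
      simp only at this
      omega
    · rfl

theorem jordanMatrix_sub_one_pow_eq_zero_iff {κ : Type*} [Fintype κ] [DecidableEq κ] (a : κ → ℕ)
    (k : ℕ) : (jordanMatrix a - 1) ^ k = 0 ↔ ∀ j, a j ≤ k := by
  constructor
  · intro h j
    by_contra! hk
    have := congrFun (congrFun h ⟨j, ⟨0, by omega⟩⟩) ⟨j, ⟨k, hk⟩⟩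
    rw [jordanMatrix_sub_one_pow_apply] at this
    simp at this
  · intro h
    ext x y
    rw [jordanMatrix_sub_one_pow_apply, Matrix.zero_apply, if_neg]
    rintro ⟨-, h2⟩
    have h3 := h y.1
    have h4 := y.2.isLt
    omega

theorem eq_of_mk_eq_of_isNilpotent {n : ℕ} (hn : 0 < n) {g h : GL (Fin n) ℂ} (e : mk g = mk h)
    (hg : IsNilpotent (g.1 - 1)) (hh : IsNilpotent (h.1 - 1)) : g = h := by
  obtain ⟨c, hc⟩ := mk_eq_mk_iff_smul.1 e
  have h1 := congrArg Matrix.trace hc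
  rw [trace_smul, trace_eq_card_of_isNilpotent_sub_one hg,
    trace_eq_card_of_isNilpotent_sub_one hh, Fintype.card_fin, smul_eq_mul] at h1
  have hc1 : (c : ℂ) = 1 :=
    mul_right_cancel₀ (b := (n : ℂ)) (by exact_mod_cast hn.ne') (by rw [← h1, one_mul])
  rw [hc1, one_smul] at hc
  exact Units.ext hc.symm

/-- The unipotent lift of `u` is unique, so its nilpotency index, which is the largest block size,
is an invariant of `u`. -/
theorem HasJordanType.pow_eq_zero_iff {n : ℕ} (hn : 0 < n) {u : PGL(n, ℂ)} {p : n.Partition}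
    (hu : HasJordanType u p) {g : GL (Fin n) ℂ} (hgu : mk g = u) (hg : IsNilpotent (g.1 - 1))
    (k : ℕ) : (g.1 - 1) ^ k = 0 ↔ ∀ b ∈ p.parts, b ≤ k := by
  obtain ⟨m, a, e, P, g', ha, hg', rfl⟩ := hu
  have hΨ : reindexConj e P (jordanMatrix a) = g'.1 := hg'.symm
  rw [eq_of_mk_eq_of_isNilpotent hn hgu hg (isNilpotent_sub_one_of_eq _ hΨ), ← hΨ,
    ← map_one (reindexConj e P), ← map_sub, ← map_pow, EmbeddingLike.map_eq_zero_iff,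
    jordanMatrix_sub_one_pow_eq_zero_iff, ← ha]
  simp

/-- The block size `i` is the nilpotency index and `r * i = n`, so `r` is determined by `u`. This
separates the classes attached to different divisors. -/
theorem eq_of_hasJordanType_replicate {n : ℕ} (hn : 0 < n) {u : PGL(n, ℂ)} {p p' : n.Partition}
    (hu : HasJordanType u p) (hu' : HasJordanType u p') {r i r' i' : ℕ}
    (hp : p.parts = Multiset.replicate r i) (hp' : p'.parts = Multiset.replicate r' i') :
    r = r' := by
  obtain ⟨g, hgu, hg⟩ := hu.isUnipotentElt
  obtain ⟨hr, hi⟩ := pos_of_parts_eq_replicate hn hp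
  obtain ⟨hr', hi'⟩ := pos_of_parts_eq_replicate hn hp'
  have h : ∀ k, i ≤ k ↔ i' ≤ k := by
    intro k
    have h1 := (hu.pow_eq_zero_iff hn hgu hg k).symm.trans (hu'.pow_eq_zero_iff hn hgu hg k)
    rw [hp, hp'] at h1
    simpa [Multiset.mem_replicate, hr.ne', hr'.ne'] using h1
  obtain rfl : i = i' := le_antisymm ((h i').2 le_rfl) ((h i).1 le_rfl)
  exact Nat.eq_of_mul_eq_mul_right hi
    ((mul_eq_of_parts_eq_replicate hp).trans (mul_eq_of_parts_eq_replicate hp').symm)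

theorem exists_hasJordanType_replicate {n r i : ℕ} (hi : 0 < i) (h : r * i = n) :
    ∃ (u : PGL(n, ℂ)) (p : n.Partition), HasJordanType u p ∧
      p.parts = Multiset.replicate r i := by
  let p : n.Partition :=
    { parts := Multiset.replicate r i
      parts_pos := fun hb => by rwa [Multiset.eq_of_mem_replicate hb]
      parts_sum := by rw [Multiset.sum_replicate, smul_eq_mul, h] }
  let e : (Σ _ : Fin r, Fin i) ≃ Fin n := Fintype.equivOfCardEq (by simp [h])
  have hunit : IsUnit (reindexConj e 1 (jordanMatrix fun _ => i)) := by
    refine IsUnit.map _ ?_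
    simpa using (isNilpotent_jordanMatrix_sub_one fun _ : Fin r => i).isUnit_add_one
  refine ⟨mk hunit.unit, p, ⟨r, fun _ => i, e, 1, hunit.unit, ?_, rfl, rfl⟩, rfl⟩
  simp [p]

/-! ### The count of orbits -/

theorem UnipotentClass.isUnipotentElt {n : ℕ} (c : UnipotentClass n) {u : PGL(n, ℂ)}
    (h : ConjClasses.mk u = c.1) : IsUnipotentElt u := by
  obtain ⟨v, hv, hvc⟩ := c.2
  exact hv.of_isConj (ConjClasses.mk_eq_mk_iff_isConj.1 (hvc.trans h.symm))

/-- A class is determined by a Jordan type, so the classes inject into the partitions of `n`. -/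
theorem finite_unipotentClass (n : ℕ) : Finite (UnipotentClass n) := by
  have h : ∀ c : UnipotentClass n, ∃ (p : n.Partition) (u : PGL(n, ℂ)),
      HasJordanType u p ∧ ConjClasses.mk u = c.1 := by
    rintro ⟨_, u, hu, rfl⟩
    obtain ⟨p, hp⟩ := exists_hasJordanType hu
    exact ⟨p, u, hp, rfl⟩
  choose p u hp hu using h
  refine Finite.of_injective p fun c c' hcc => Subtype.ext ?_
  rw [← hu c, ← hu c', ConjClasses.mk_eq_mk_iff_isConj]
  exact isConj_of_hasJordanType (hp c) (hcc ▸ hp c')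

theorem pairOrbits_ellSub_finite {n : ℕ} (hn : 0 < n) {u : PGL(n, ℂ)} {Γ : Subgroup PGL(n, ℂ)}
    (hu : IsUnipotentElt u) (hΓ : IsReductivePart u Γ) : (pairOrbits (ellSub Γ)).Finite := by
  obtain ⟨p, hp⟩ := exists_hasJordanType hu
  rcases (ellSub Γ).eq_empty_or_nonempty with h | h
  · rw [h, pairOrbits, Set.image_empty]
    exact Set.finite_empty
  · obtain ⟨r, i, hri⟩ := eq_replicate_of_ellSub_nonempty hn hp hΓ h
    exact (card_pairOrbits_of_parts_eq_replicate hn hp hΓ hri).1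

/-- The summand is supported on rectangular classes. These are parametrized injectively by the
divisors `r` of `n`, with blocks of size `n / r`, and each contributes `φ(r)`. -/
theorem finsum_ncard_pairOrbits {n : ℕ} (hn : 0 < n) (u : UnipotentClass n → PGL(n, ℂ))
    (Γ : UnipotentClass n → Subgroup PGL(n, ℂ)) (hu : ∀ c, ConjClasses.mk (u c) = c.1)
    (hΓ : ∀ c, IsReductivePart (u c) (Γ c)) :
    ∑ᶠ c, (pairOrbits (ellSub (Γ c))).ncard = n := by
  classical
  have hex : ∀ r : n.divisors, ∃ (v : PGL(n, ℂ)) (p : n.Partition), HasJordanType v p ∧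
      p.parts = Multiset.replicate r.1 (n / r.1) := fun r =>
    exists_hasJordanType_replicate (Nat.div_pos (Nat.divisor_le r.2) (Nat.pos_of_mem_divisors r.2))
      (Nat.mul_div_cancel' (Nat.dvd_of_mem_divisors r.2))
  choose v p hv hp using hex
  let C : n.divisors → UnipotentClass n := fun r =>
    ⟨ConjClasses.mk (v r), v r, (hv r).isUnipotentElt, rfl⟩
  have hC : ∀ r, HasJordanType (u (C r)) (p r) := fun r =>
    (hv r).of_isConj (ConjClasses.mk_eq_mk_iff_isConj.1 (hu (C r)).symm)
  have hinj : Function.Injective C := by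
    intro r r' h
    refine Subtype.ext (eq_of_hasJordanType_replicate hn (hC r) ?_ (hp r) (hp r'))
    rw [h]
    exact hC r'
  have hsupp : (Function.support fun c => (pairOrbits (ellSub (Γ c))).ncard) ⊆
      ((Finset.univ.image C : Finset _) : Set (UnipotentClass n)) := by
    intro c hc
    have hne : (ellSub (Γ c)).Nonempty := by
      rw [Set.nonempty_iff_ne_empty]
      intro h
      simp [pairOrbits, h] at hc
    obtain ⟨q, hq⟩ := exists_hasJordanType (c.isUnipotentElt (hu c))
    obtain ⟨r, i, hri⟩ := eq_replicate_of_ellSub_nonempty hn hq (hΓ c) hne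
    have hmul := mul_eq_of_parts_eq_replicate hri
    have hr : r ∈ n.divisors := Nat.mem_divisors.2 ⟨⟨i, hmul.symm⟩, hn.ne'⟩
    have hqp : q = p ⟨r, hr⟩ := by
      ext1
      rw [hri, hp, Nat.div_eq_of_eq_mul_right (Nat.pos_of_mem_divisors hr) hmul.symm]
    simp only [Finset.coe_image, Finset.coe_univ, Set.image_univ, Set.mem_range]
    refine ⟨⟨r, hr⟩, Subtype.ext ?_⟩
    rw [← hu c]
    exact ConjClasses.mk_eq_mk_iff_isConj.2 (isConj_of_hasJordanType (hv _) (hqp ▸ hq))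
  rw [finsum_eq_sum_of_support_subset _ hsupp, Finset.sum_image fun _ _ _ _ h => hinj h,
    Finset.sum_congr rfl fun r _ =>
      (card_pairOrbits_of_parts_eq_replicate hn (hC r) (hΓ _) (hp r)).2]
  rw [Finset.sum_coe_sort n.divisors Nat.totient, Nat.sum_totient]

end EllipticPGL

theorem propositionp (n : ℕ) (hn : 0 < n) :
    -- elliptic pairs in `PGL_n(ℂ)`
    (∀ ζ : ℂˣ, IsPrimitiveRoot ζ n →
      EllipticPGL.IsStandardUnion (EllipticPGL.ellPGL n) n
        (EllipticPGL.Delta n ζ) (EllipticPGL.wdot n)) ∧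
    -- elliptic pairs in `Γ_u`
    (∀ u : PGL(n, ℂ), EllipticPGL.IsUnipotentElt u →
      (∃ p : n.Partition, EllipticPGL.HasJordanType u p) ∧
      (∃ Γ : Subgroup PGL(n, ℂ), EllipticPGL.IsReductivePart u Γ) ∧
      ∀ (p : n.Partition) (Γ : Subgroup PGL(n, ℂ)),
        EllipticPGL.HasJordanType u p → EllipticPGL.IsReductivePart u Γ →
        ((EllipticPGL.ellSub Γ).Nonempty ↔ ∃ r i : ℕ, p.parts = Multiset.replicate r i) ∧
        ∀ r i : ℕ, p.parts = Multiset.replicate r i →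
          ∃ (e : Fin r × Fin i ≃ Fin n) (P : GL (Fin n) ℂ) (φ : PGL(r, ℂ) ≃* Γ),
            (∀ A : GL (Fin r) ℂ, (φ (Matrix.ProjGenLinGroup.mk A) : PGL(n, ℂ)) =
              Matrix.ProjGenLinGroup.mk (P * EllipticPGL.diagEmb e A * P⁻¹)) ∧
            ∀ ζ : ℂˣ, IsPrimitiveRoot ζ r →
              EllipticPGL.IsStandardUnion (EllipticPGL.ellSub Γ) r
                (φ (EllipticPGL.Delta r ζ)) (φ (EllipticPGL.wdot r))) ∧
    -- the number of orbits of elliptic pairs over all unipotent classes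
    (Finite (EllipticPGL.UnipotentClass n) ∧
      ∀ (u : EllipticPGL.UnipotentClass n → PGL(n, ℂ))
        (Γ : EllipticPGL.UnipotentClass n → Subgroup PGL(n, ℂ)),
        (∀ c, ConjClasses.mk (u c) = c.1) →
        (∀ c, EllipticPGL.IsReductivePart (u c) (Γ c)) →
        (∀ c, (EllipticPGL.pairOrbits (EllipticPGL.ellSub (Γ c))).Finite) ∧
        ∑ᶠ c, (EllipticPGL.pairOrbits (EllipticPGL.ellSub (Γ c))).ncard = n) := by
  refine ⟨fun ζ hζ => EllipticPGL.isStandardUnion_ellipticPairs hn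
      (fun x hx => EllipticPGL.isSemisimpleElt_of_pow_eq_one hn.ne' hx) hζ,
    fun u hu => ⟨EllipticPGL.exists_hasJordanType hu, EllipticPGL.exists_isReductivePart hn hu,
      fun p Γ hp hΓ => ⟨⟨EllipticPGL.eq_replicate_of_ellSub_nonempty hn hp hΓ, ?_⟩,
        fun r i hri => EllipticPGL.exists_equiv_of_parts_eq_replicate hn hp hΓ hri⟩⟩,
    EllipticPGL.finite_unipotentClass n, fun u Γ hu hΓ =>
      ⟨fun c => EllipticPGL.pairOrbits_ellSub_finite hn (c.isUnipotentElt (hu c)) (hΓ c),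
        EllipticPGL.finsum_ncard_pairOrbits hn u Γ hu hΓ⟩⟩
  rintro ⟨r, i, hri⟩
  exact EllipticPGL.ellSub_nonempty_of_parts_eq_replicate hn hp hΓ hri
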